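/- **Theorem.** Let $\mathbb K$ be $\mathbb R$ or $\mathbb C$ and consider the following Lie algebras over $\mathbb K$ (brackets of basis vectors that are neither listed nor obtained from the listed ones by skew-symmetry are zero). * $\mathfrak n_1^{\pm}$: let $\mathfrak s^{\pm}$ be the three-dimensional Lie algebra with basis $u,v,w$ and $[u,v]=w$, $[v,w]=\pm u$, $[w,u]=v$. Then $\mathfrak n_1^{\pm}$ is the subalgebra of $\mathfrak s^{\pm}\otimes\mathbb K[t]$ (with bracket $[a\otimes P,b\otimes Q]=[a,b]\otimes PQ$) spanned by $u\otimes t^{2k+1}$, $v\otimes t^{2k+1}$, $w\otimes t^{2k+2}$, $k\ge 0$. * $\mathfrak n_2$: basis $e_1,e_2,e_3,\dots$ and $[e_q,e_l]=d_{q,l}\,e_{q+l}$, where $d_{q,l}$ depends only on the residues of $q$ and $l$ modulo $8$ and is given by the matrix (rows $q$ and columns $l$ numbered $0,1,\dots,7$) $$\begin{pmatrix}0&1&-2&-1&0&1&2&-1\\-1&0&1&1&-3&-2&0&1\\2&-1&0&0&0&1&-1&0\\1&-1&0&0&3&-1&1&-2\\0&3&0&-3&0&3&0&-3\\-1&2&-1&1&-3&0&0&1\\-2&0&1&-1&0&0&0&1\\1&-1&0&2&3&-1&-1&0\end{pmatrix}.$$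 * $\mathfrak n_2^3$: basis $z,e_1,e_2,e_3,\dots$, where $z$ is central, $[e_2,e_3]=z$, and all other brackets of the $e_i$ are as in $\mathfrak n_2$ (in which $[e_2,e_3]=0$). * $\mathfrak m_0$: basis $e_1,e_2,e_3,\dots$ and $[e_1,e_i]=e_{i+1}$ for $i\ge 2$. * $\mathfrak m_0^S$, for a set $S\subset\{3,5,7,\dots\}$ (finite or infinite): basis $e_i$ ($i\ge1$) and $z_r$ ($r\in S$), with $[e_1,e_i]=e_{i+1}$ for $i\ge 2$ and $[e_l,e_{r-l+2}]=(-1)^{l+1}z_r$ for $r\in S$, $2\le l\le\frac{r+1}{2}$. Let $\mathfrak g=\bigoplus_{i=1}^{\infty}\mathfrak g_i$ be an infinite-dimensional Lie algebra over $\mathbb K$, graded by the positive integers ($[\mathfrak g_i,\mathfrak g_j]\subset\mathfrak g_{i+j}$), such that $$[\mathfrak g_1,\mathfrak g_i]=\mathfrak g_{i+1},\qquad \dim\mathfrak g_i+\dim\mathfrak g_{i+1}\le 3\qquad\text{for all } i\ge 1.$$ 1. If $\mathbb K=\mathbb R$, then $\mathfrak g$ is isomorphic, as a Lie algebra, to one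 and only one algebra on the list $\mathfrak n_1^+$, $\mathfrak n_1^-$, $\mathfrak n_2$, $\mathfrak n_2^3$, $\mathfrak m_0$, and $\mathfrak m_0^S$ with $\emptyset\ne S\subset\{3,5,7,\dots\}$. 2. If $\mathbb K=\mathbb C$, then $\mathfrak g$ is isomorphic to one and only one algebra on the list $\mathfrak n_1^+$, $\mathfrak n_2$, $\mathfrak n_2^3$, $\mathfrak m_0$, and $\mathfrak m_0^S$ with $\emptyset\ne S\subset\{3,5,7,\dots\}$; moreover $\mathfrak n_1^+\cong\mathfrak n_1^-$ over $\mathbb C$. -/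

import Mathlib

open scoped TensorProduct Polynomial

noncomputable section

namespace NarrowLie

/-! ### Lie algebras given by a basis and structure constants -/

section StructureConstants

variable {K ι : Type*} [CommRing K]

/-- The bilinear operation on the free module with basis `ι` which takes the pair of basis
vectors `(i, j)` to `c i j`. -/
def bilin {κ : Type*} (c : ι → ι → (κ →₀ K)) : (ι →₀ K) →ₗ[K] (ι →₀ K) →ₗ[K] (κ →₀ K) :=
  Finsupp.linearCombination K fun i => Finsupp.linearCombination K (c i)

@[simp]
theorem bilin_single {κ : Type*} (c : ι → ι → (κ →₀ K)) (i j : ι) (a b : K) :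
    bilin c (Finsupp.single i a) (Finsupp.single j b) = a • b • c i j := by
  simp [bilin, Finsupp.linearCombination_single]

variable (K ι) in
/-- Structure constants of a Lie algebra with basis `ι`: the brackets of the basis vectors,
alternating and satisfying the Jacobi identity. -/
structure LieConstants where
  /-- The bracket of two basis vectors. -/
  c : ι → ι → (ι →₀ K)
  c_self : ∀ i, c i i = 0
  c_skew : ∀ i j, c i j = -c j i
  jacobi : ∀ i j k, bilin c (c i j) (Finsupp.single k 1) + bilin c (c j k) (Finsupp.single i 1)
    + bilin c (c k i) (Finsupp.single j 1) = 0

namespace LieConstants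

variable (s : LieConstants K ι)

/-- The Lie algebra with basis `ι` and the given structure constants. -/
def Algebra (_s : LieConstants K ι) : Type _ := ι →₀ K

instance : AddCommGroup s.Algebra := inferInstanceAs (AddCommGroup (ι →₀ K))

instance : Module K s.Algebra := inferInstanceAs (Module K (ι →₀ K))

/-- The basis vectors. -/
def e (i : ι) : s.Algebra := (Finsupp.single i 1 : ι →₀ K)

/-- The bracket as a bilinear map. -/
def br : (ι →₀ K) →ₗ[K] (ι →₀ K) →ₗ[K] (ι →₀ K) := bilin s.c

theorem br_skew (x y : ι →₀ K) : s.br x y = -s.br y x := by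
  rw [← add_eq_zero_iff_eq_neg]
  induction x using Finsupp.induction_linear with
  | zero => simp
  | add x x' hx hx' =>
    have := congrArg₂ (· + ·) hx hx'
    simp only [map_add, LinearMap.add_apply, add_zero] at this ⊢
    rw [← this]; abel
  | single i a =>
  induction y using Finsupp.induction_linear with
  | zero => simp
  | add x x' hx hx' =>
    have := congrArg₂ (· + ·) hx hx'
    simp only [map_add, LinearMap.add_apply, add_zero] at this ⊢
    rw [← this]; abel
  | single j b =>
    simp only [br, bilin_single, s.c_skew j i, smul_smul, smul_neg, mul_comm b a, add_neg_cancel]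

theorem br_self (x : ι →₀ K) : s.br x x = 0 := by
  induction x using Finsupp.induction_linear with
  | zero => simp
  | add x y hx hy => simp [hx, hy, s.br_skew x y]
  | single i a => simp [br, s.c_self]

theorem br_jacobi (x y z : ι →₀ K) :
    s.br (s.br x y) z + s.br (s.br y z) x + s.br (s.br z x) y = 0 := by
  induction x using Finsupp.induction_linear with
  | zero => simp
  | add x x' hx hx' =>
    have := congrArg₂ (· + ·) hx hx'
    simp only [map_add, LinearMap.add_apply, add_zero] at this ⊢
    rw [← this]; abel
  | single i a =>
  induction y using Finsupp.induction_linear with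
  | zero => simp
  | add x x' hx hx' =>
    have := congrArg₂ (· + ·) hx hx'
    simp only [map_add, LinearMap.add_apply, add_zero] at this ⊢
    rw [← this]; abel
  | single j b =>
  induction z using Finsupp.induction_linear with
  | zero => simp
  | add x x' hx hx' =>
    have := congrArg₂ (· + ·) hx hx'
    simp only [map_add, LinearMap.add_apply, add_zero] at this ⊢
    rw [← this]; abel
  | single k d =>
    have h := s.jacobi i j k
    have e1 : ∀ (l : ι) (t : K), (Finsupp.single l t : ι →₀ K) = t • Finsupp.single l 1 := by simp
    rw [e1 i a, e1 j b, e1 k d]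
    simp only [br, map_smul, LinearMap.smul_apply, bilin_single, one_smul, smul_smul] at h ⊢
    linear_combination (norm := module) (a * b * d) • h

theorem br_leibniz (x y z : ι →₀ K) :
    s.br x (s.br y z) = s.br (s.br x y) z + s.br y (s.br x z) := by
  have h := s.br_jacobi x y z
  have h' : s.br (s.br x z) y = -s.br (s.br z x) y := by
    rw [s.br_skew x z, LinearMap.map_neg₂]
  rw [s.br_skew x (s.br y z), s.br_skew y (s.br x z), h', neg_neg, neg_eq_iff_add_eq_zero, ← h]
  abel

instance : LieRing s.Algebra where
  bracket x y := s.br x y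
  add_lie x y z := by
    change s.br (x + y) z = s.br x z + s.br y z
    exact LinearMap.map_add₂ _ _ _ _
  lie_add x y z := (s.br x).map_add y z
  lie_self x := s.br_self x
  leibniz_lie x y z := s.br_leibniz x y z

instance : LieAlgebra K s.Algebra where
  lie_smul t x y := (s.br x).map_smul t y

theorem lie_e (i j : ι) : (⁅s.e i, s.e j⁆ : s.Algebra) = s.c i j := by
  change bilin s.c (Finsupp.single i 1) (Finsupp.single j 1) = _
  simp

/-- The central extension with basis `ι ⊕ κ`: the new basis vectors `Sum.inr k` are central, and
`ω i j` is added to the bracket of the basis vectors `i` and `j`. The last hypothesis says that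
`ω` is a 2-cocycle. -/
def centralExt {κ : Type*} (ω : ι → ι → (κ →₀ K)) (ω_self : ∀ i, ω i i = 0)
    (ω_skew : ∀ i j, ω i j = -ω j i)
    (cocycle : ∀ i j k, bilin ω (s.c i j) (Finsupp.single k 1)
      + bilin ω (s.c j k) (Finsupp.single i 1) + bilin ω (s.c k i) (Finsupp.single j 1) = 0) :
    LieConstants K (ι ⊕ κ) where
  c
    | .inl i, .inl j => (s.c i j).mapDomain Sum.inl + (ω i j).mapDomain Sum.inr
    | _, _ => 0
  c_self
    | .inl i => by simp [s.c_self, ω_self]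
    | .inr k => rfl
  c_skew
    | .inl i, .inl j => by
      simp only [s.c_skew i j, ω_skew i j]
      rw [← Finsupp.lmapDomain_apply K K, ← Finsupp.lmapDomain_apply K K,
        ← Finsupp.lmapDomain_apply K K, ← Finsupp.lmapDomain_apply K K, map_neg, map_neg]
      abel
    | .inl _, .inr _ | .inr _, .inl _ | .inr _, .inr _ => by simp
  jacobi := by
    set c : ι ⊕ κ → ι ⊕ κ → (ι ⊕ κ →₀ K) := fun
      | .inl i, .inl j => (s.c i j).mapDomain Sum.inl + (ω i j).mapDomain Sum.inr
      | _, _ => 0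
    have key : ∀ (x : ι →₀ K) (k : ι),
        bilin c (x.mapDomain Sum.inl) (Finsupp.single (Sum.inl k) 1)
          = (bilin s.c x (Finsupp.single k 1)).mapDomain Sum.inl
            + (bilin ω x (Finsupp.single k 1)).mapDomain Sum.inr := by
      intro x k
      simp only [← Finsupp.lmapDomain_apply K K]
      induction x using Finsupp.induction_linear with
      | zero => simp
      | add x y hx hy =>
        simp only [map_add, LinearMap.add_apply, hx, hy]
        abel
      | single i a => simp [c]
    have key2 : ∀ (x : κ →₀ K) (k : ι ⊕ κ),
        bilin c (x.mapDomain Sum.inr) (Finsupp.single k 1) = 0 := by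
      intro x k
      simp only [← Finsupp.lmapDomain_apply K K]
      induction x using Finsupp.induction_linear with
      | zero => simp
      | add x y hx hy => simp only [map_add, LinearMap.add_apply, hx, hy, add_zero]
      | single i a => simp [c]
    have key3 : ∀ (x : ι ⊕ κ →₀ K) (k : κ),
        bilin c x (Finsupp.single (Sum.inr k) 1) = 0 := by
      intro x k
      induction x using Finsupp.induction_linear with
      | zero => simp
      | add x y hx hy => simp [hx, hy]
      | single i a => cases i <;> simp [c]
    rintro (i | i) (j | j) (k | k) <;>
      first
      | (simp only [c, map_add, LinearMap.add_apply, key, key2, key3, map_zero,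
          LinearMap.zero_apply, add_zero]; done)
      | skip
    simp only [c, map_add, LinearMap.add_apply, key, key2, add_zero]
    have h1 := congrArg (Finsupp.lmapDomain K K (Sum.inl : ι → ι ⊕ κ)) (s.jacobi i j k)
    have h2 := congrArg (Finsupp.lmapDomain K K (Sum.inr : κ → ι ⊕ κ)) (cocycle i j k)
    simp only [map_add, map_zero, Finsupp.lmapDomain_apply] at h1 h2
    have h := congrArg₂ (· + ·) h1 h2
    simp only [add_zero] at h
    rw [← h]
    abel

end LieConstants

/-- Structure constants `[e_i, e_j] = a i j • e_{i+j}` on the basis `e_1, e_2, e_3, …`. -/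
def widthOne (a : ℕ+ → ℕ+ → K) (a_self : ∀ i, a i i = 0) (a_skew : ∀ i j, a i j = -a j i)
    (jacobi : ∀ i j k, a i j * a (i + j) k + a j k * a (j + k) i + a k i * a (k + i) j = 0) :
    LieConstants K ℕ+ where
  c i j := Finsupp.single (i + j) (a i j)
  c_self i := by simp [a_self]
  c_skew i j := by rw [a_skew i j, add_comm i j, Finsupp.single_neg]
  jacobi i j k := by
    simp only [bilin_single, Finsupp.smul_single, smul_eq_mul, one_mul]
    rw [show j + k + i = i + j + k by ac_rfl, show k + i + j = i + j + k by ac_rfl,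
      ← Finsupp.single_add, ← Finsupp.single_add, jacobi, Finsupp.single_zero]

end StructureConstants

variable (K : Type*) [Field K]

/-! ### The algebra `m_0` and its central extensions `m_0^S` -/

/-- `[e_1, e_j] = e_{j+1}` for `j ≥ 2`, all other brackets of `e_i, e_j` with `i < j` vanish. -/
def m0Coeff (i j : ℕ+) : K :=
  if i = 1 ∧ 2 ≤ j then 1 else if j = 1 ∧ 2 ≤ i then -1 else 0

theorem m0Coeff_eq (i j : ℕ+) :
    m0Coeff K i j = if i = 1 then (if j = 1 then 0 else 1) else (if j = 1 then -1 else 0) := by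
  have h : ∀ n : ℕ+, 2 ≤ n ↔ n ≠ 1 := fun n => by
    rw [← PNat.coe_le_coe, ← PNat.coe_inj.ne, PNat.one_coe, PNat.val_ofNat]
    have := n.pos
    omega
  by_cases hi : i = 1 <;> by_cases hj : j = 1 <;> simp [m0Coeff, h, hi, hj]

theorem m0Coeff_self (i : ℕ+) : m0Coeff K i i = 0 := by
  by_cases hi : i = 1 <;> simp [m0Coeff_eq, hi]

theorem m0Coeff_skew (i j : ℕ+) : m0Coeff K i j = -m0Coeff K j i := by
  by_cases hi : i = 1 <;> by_cases hj : j = 1 <;> simp [m0Coeff_eq, hi, hj]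

theorem add_ne_one (i j : ℕ+) : i + j ≠ 1 := by
  rw [← PNat.coe_inj.ne, PNat.add_coe, PNat.one_coe]
  have := i.pos
  have := j.pos
  omega

theorem m0Coeff_jacobi (i j k : ℕ+) :
    m0Coeff K i j * m0Coeff K (i + j) k + m0Coeff K j k * m0Coeff K (j + k) i
      + m0Coeff K k i * m0Coeff K (k + i) j = 0 := by
  by_cases hi : i = 1 <;> by_cases hj : j = 1 <;> by_cases hk : k = 1 <;>
    simp [m0Coeff_eq, hi, hj, hk, add_ne_one]

/-- Structure constants of `m_0`. -/
def m0 : LieConstants K ℕ+ :=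
  widthOne (m0Coeff K) (m0Coeff_self K) (m0Coeff_skew K) (m0Coeff_jacobi K)

/-- The sets of odd integers `≥ 3`. -/
def OddSet : Type := {S : Set ℕ // ∀ r ∈ S, Odd r ∧ 3 ≤ r}

open Classical in
/-- The cocycle with `(e_l, e_{r-l+2}) ↦ (-1)^(l+1) z_r` for `r ∈ S` and `2 ≤ l ≤ r`. As `r` is
odd, this is skew-symmetric, so it is determined by its values for `2 ≤ l ≤ (r+1)/2`. -/
def m0Cocycle (S : OddSet) (i j : ℕ+) : S.1 →₀ K :=
  if h : 2 ≤ i ∧ 2 ≤ j ∧ (i : ℕ) + j - 2 ∈ S.1 then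
    Finsupp.single ⟨(i : ℕ) + j - 2, h.2.2⟩ ((-1) ^ ((i : ℕ) + 1))
  else 0

theorem m0Cocycle_self (S : OddSet) (i : ℕ+) : m0Cocycle K S i i = 0 := by
  unfold m0Cocycle
  split_ifs with h
  · obtain ⟨⟨m, hm⟩, -⟩ := S.2 _ h.2.2
    omega
  · rfl

theorem m0Cocycle_skew (S : OddSet) (i j : ℕ+) : m0Cocycle K S i j = -m0Cocycle K S j i := by
  unfold m0Cocycle
  by_cases h : 2 ≤ i ∧ 2 ≤ j ∧ (i : ℕ) + j - 2 ∈ S.1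
  · have h' : 2 ≤ j ∧ 2 ≤ i ∧ (j : ℕ) + i - 2 ∈ S.1 := ⟨h.2.1, h.1, by rw [add_comm]; exact h.2.2⟩
    obtain ⟨⟨m, hm⟩, -⟩ := S.2 _ h.2.2
    rw [dif_pos h, dif_pos h', ← Finsupp.single_neg]
    congr 1
    · simp only [add_comm]
    · rcases Nat.even_or_odd (i : ℕ) with hi | hi
      · have hj : Odd (j : ℕ) := by
          rw [Nat.odd_iff]; rw [Nat.even_iff] at hi
          have := PNat.coe_le_coe _ _ |>.2 h.1
          have := PNat.coe_le_coe _ _ |>.2 h.2.1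
          simp only [PNat.val_ofNat] at *
          omega
        simp [pow_succ, hi.neg_one_pow, hj.neg_one_pow]
      · have hj : Even (j : ℕ) := by
          rw [Nat.even_iff]; rw [Nat.odd_iff] at hi
          have := PNat.coe_le_coe _ _ |>.2 h.1
          have := PNat.coe_le_coe _ _ |>.2 h.2.1
          simp only [PNat.val_ofNat] at *
          omega
        simp [pow_succ, hi.neg_one_pow, hj.neg_one_pow]
  · have h' : ¬ (2 ≤ j ∧ 2 ≤ i ∧ (j : ℕ) + i - 2 ∈ S.1) := fun h' =>
      h ⟨h'.2.1, h'.1, by rw [add_comm]; exact h'.2.2⟩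
    rw [dif_neg h, dif_neg h', neg_zero]

/-- Moving one step along an antidiagonal changes the sign, unless the index `1` is involved. -/
theorem m0Cocycle_succ (S : OddSet) (i j : ℕ+) (hi : i ≠ 1) (hj : j ≠ 1) :
    m0Cocycle K S (1 + i) j + m0Cocycle K S i (1 + j) = 0 := by
  have two : ∀ n : ℕ+, n ≠ 1 → 2 ≤ n := fun n h => by
    rw [← PNat.coe_inj.ne, PNat.one_coe] at h
    rw [← PNat.coe_le_coe, PNat.val_ofNat]
    have := n.pos
    omega
  have h1 := two i hi
  have h2 := two j hj
  have h3 := two (1 + i) (add_ne_one 1 i)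
  have h4 := two (1 + j) (add_ne_one 1 j)
  have e : ((1 + i : ℕ+) : ℕ) + j - 2 = (i : ℕ) + (1 + j : ℕ+) - 2 := by
    simp only [PNat.add_coe]; congr 1; ring
  unfold m0Cocycle
  by_cases h : (i : ℕ) + (1 + j : ℕ+) - 2 ∈ S.1
  · have h' : ((1 + i : ℕ+) : ℕ) + j - 2 ∈ S.1 := by rw [e]; exact h
    rw [dif_pos ⟨h3, h2, h'⟩, dif_pos ⟨h1, h4, h⟩]
    have e' : (⟨_, h'⟩ : S.1) = ⟨_, h⟩ := Subtype.ext e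
    rw [e', ← Finsupp.single_add, ← Finsupp.single_zero (⟨_, h⟩ : S.1)]
    congr 1
    rw [PNat.add_coe, PNat.one_coe]
    ring
  · have h' : ((1 + i : ℕ+) : ℕ) + j - 2 ∉ S.1 := by rw [e]; exact h
    rw [dif_neg (fun t => h' t.2.2), dif_neg (fun t => h t.2.2), add_zero]

theorem m0Cocycle_one_right (S : OddSet) (i : ℕ+) : m0Cocycle K S i 1 = 0 :=
  dif_neg fun h => absurd h.2.1 (by decide)

theorem m0Cocycle_cocycle (S : OddSet) (i j k : ℕ+) :
    bilin (m0Cocycle K S) ((m0 K).c i j) (Finsupp.single k 1)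
      + bilin (m0Cocycle K S) ((m0 K).c j k) (Finsupp.single i 1)
      + bilin (m0Cocycle K S) ((m0 K).c k i) (Finsupp.single j 1) = 0 := by
  have key : ∀ i j : ℕ+, i ≠ 1 → j ≠ 1 →
      m0Cocycle K S (1 + i) j - m0Cocycle K S (1 + j) i = 0 := fun i j hi hj => by
    rw [m0Cocycle_skew K S (1 + j) i, sub_neg_eq_add, m0Cocycle_succ K S i j hi hj]
  simp only [m0, widthOne, bilin_single, one_smul, m0Coeff_eq]
  by_cases hi : i = 1 <;> by_cases hj : j = 1 <;> by_cases hk : k = 1 <;>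
    simp only [hi, hj, hk, if_true, if_false, m0Cocycle_one_right, zero_smul, smul_zero, one_smul,
      neg_smul, add_zero, zero_add]
  · rw [add_comm k 1, ← sub_eq_add_neg]
    exact key j k hj hk
  · rw [add_comm i 1, neg_add_eq_sub]
    exact key k i hk hi
  · rw [add_comm j 1, neg_add_eq_sub]
    exact key i j hi hj

/-- Structure constants of `m_0^S`, with basis `e_i` (`i ≥ 1`) and `z_r` (`r ∈ S`). -/
def m0S (S : OddSet) : LieConstants K (ℕ+ ⊕ S.1) :=
  (m0 K).centralExt (m0Cocycle K S) (m0Cocycle_self K S) (m0Cocycle_skew K S)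
    (m0Cocycle_cocycle K S)

/-! ### The algebra `n_2` and its central extension `n_2^3` -/

/-- The structure constants of `n_2`: `[e_q, e_l] = d q l • e_{q+l}`, where `d q l` depends only on
the residues of `q` and `l` modulo `8`; rows and columns are numbered `0, …, 7`. -/
def n2Table : Matrix (Fin 8) (Fin 8) ℤ :=
  !![ 0,  1, -2, -1,  0,  1,  2, -1;
     -1,  0,  1,  1, -3, -2,  0,  1;
      2, -1,  0,  0,  0,  1, -1,  0;
      1, -1,  0,  0,  3, -1,  1, -2;
      0,  3,  0, -3,  0,  3,  0, -3;
     -1,  2, -1,  1, -3,  0,  0,  1;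
     -2,  0,  1, -1,  0,  0,  0,  1;
      1, -1,  0,  2,  3, -1, -1,  0]

theorem n2Table_skew : ∀ q l : Fin 8, n2Table q l + n2Table l q = 0 := by decide

set_option maxRecDepth 100000 in
theorem n2Table_jacobi : ∀ i j k : Fin 8,
    n2Table i j * n2Table (i + j) k + n2Table j k * n2Table (j + k) i
      + n2Table k i * n2Table (k + i) j = 0 := by decide

/-- The residue modulo `8`. -/
def res8 (i : ℕ+) : Fin 8 := Fin.ofNat 8 i

theorem res8_add (i j : ℕ+) : res8 (i + j) = res8 i + res8 j := by
  apply Fin.ext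
  simp [res8, Fin.val_add]

/-- Structure constants of `n_2`. -/
def n2 : LieConstants K ℕ+ :=
  widthOne (fun q l => (n2Table (res8 q) (res8 l) : K))
    (fun q => by
      have : ∀ q : Fin 8, n2Table q q = 0 := by decide
      simp [this])
    (fun q l => by
      rw [← add_eq_zero_iff_eq_neg]
      exact_mod_cast congrArg (Int.cast : ℤ → K) (n2Table_skew (res8 q) (res8 l)))
    (fun i j k => by
      simp only [res8_add]
      exact_mod_cast congrArg (Int.cast : ℤ → K) (n2Table_jacobi (res8 i) (res8 j) (res8 k)))

/-- The cocycle with `(e_2, e_3) ↦ z` and `(e_i, e_j) ↦ 0` for all other `i < j`. -/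
def n2Cocycle (i j : ℕ+) : Unit →₀ K :=
  if i = 2 ∧ j = 3 then Finsupp.single () 1 else if i = 3 ∧ j = 2 then -Finsupp.single () 1 else 0

theorem n2Cocycle_cocycle (i j k : ℕ+) :
    bilin (n2Cocycle K) ((n2 K).c i j) (Finsupp.single k 1)
      + bilin (n2Cocycle K) ((n2 K).c j k) (Finsupp.single i 1)
      + bilin (n2Cocycle K) ((n2 K).c k i) (Finsupp.single j 1) = 0 := by
  simp only [n2, widthOne, bilin_single, one_smul]
  have big : ∀ i j k : ℕ+, (i + j + k : ℕ) ≠ 5 → n2Cocycle K (i + j) k = 0 := fun i j k h => by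
    unfold n2Cocycle
    simp only [← PNat.coe_inj, PNat.add_coe, PNat.val_ofNat]
    rw [if_neg (by omega), if_neg (by omega)]
  by_cases h : (i + j + k : ℕ) = 5
  · have hi := i.pos
    have hj := j.pos
    have hk := k.pos
    have t : (i = 1 ∧ j = 1 ∧ k = 3) ∨ (i = 1 ∧ j = 3 ∧ k = 1) ∨ (i = 3 ∧ j = 1 ∧ k = 1) ∨
        (i = 1 ∧ j = 2 ∧ k = 2) ∨ (i = 2 ∧ j = 1 ∧ k = 2) ∨ (i = 2 ∧ j = 2 ∧ k = 1) := by
      simp only [← PNat.coe_inj, PNat.val_ofNat]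
      omega
    have d11 : n2Table (res8 1) (res8 1) = 0 := by decide
    have d22 : n2Table (res8 2) (res8 2) = 0 := by decide
    have d12 : n2Table (res8 1) (res8 2) = 1 := by decide
    have d21 : n2Table (res8 2) (res8 1) = -1 := by decide
    have c13 : n2Cocycle K (1 + 3) 1 = 0 := by simp only [n2Cocycle]; rfl
    have c31 : n2Cocycle K (3 + 1) 1 = 0 := by simp only [n2Cocycle]; rfl
    have e12 : (1 + 2 : ℕ+) = 2 + 1 := by decide
    rcases t with ⟨rfl, rfl, rfl⟩ | ⟨rfl, rfl, rfl⟩ | ⟨rfl, rfl, rfl⟩ | ⟨rfl, rfl, rfl⟩ |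
        ⟨rfl, rfl, rfl⟩ | ⟨rfl, rfl, rfl⟩ <;>
      simp [d11, d22, d12, d21, c13, c31, e12]
  · rw [big i j k h, big j k i (by omega), big k i j (by omega)]
    simp

/-- Structure constants of `n_2^3`, with basis `e_i` (`i ≥ 1`) and one central vector `z`. -/
def n23 : LieConstants K (ℕ+ ⊕ Unit) :=
  (n2 K).centralExt (n2Cocycle K)
    (fun i => by
      unfold n2Cocycle
      split_ifs with h h
      · exact absurd (h.1.symm.trans h.2) (by decide)
      · exact absurd (h.1.symm.trans h.2) (by decide)
      · rfl)
    (fun i j => by unfold n2Cocycle; split_ifs <;> simp_all)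
    (n2Cocycle_cocycle K)

/-! ### The algebras `n_1^±` -/

variable {K}

/-- The bracket of two coordinate vectors with respect to `u, v, w`, where
`[u, v] = w`, `[v, w] = ε u`, `[w, u] = v`. -/
def cross (ε : K) (x y : Fin 3 → K) : Fin 3 → K :=
  ![ε * (x 1 * y 2 - x 2 * y 1), x 2 * y 0 - x 0 * y 2, x 0 * y 1 - x 1 * y 0]

theorem cross_add_left (ε : K) (x y z : Fin 3 → K) :
    cross ε (x + y) z = cross ε x z + cross ε y z := by
  funext i; fin_cases i <;> simp [cross] <;> ring

theorem cross_add_right (ε : K) (x y z : Fin 3 → K) :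
    cross ε x (y + z) = cross ε x y + cross ε x z := by
  funext i; fin_cases i <;> simp [cross] <;> ring

theorem cross_self (ε : K) (x : Fin 3 → K) : cross ε x x = 0 := by
  funext i; fin_cases i <;> simp [cross, mul_comm]

theorem cross_leibniz (ε : K) (x y z : Fin 3 → K) :
    cross ε x (cross ε y z) = cross ε (cross ε x y) z + cross ε y (cross ε x z) := by
  funext i; fin_cases i <;> simp [cross] <;> ring

theorem cross_smul (ε t : K) (x y : Fin 3 → K) : cross ε x (t • y) = t • cross ε x y := by
  funext i; fin_cases i <;> simp [cross] <;> ring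

/-- The three-dimensional Lie algebra with basis `u, v, w` and
`[u, v] = w`, `[v, w] = ε u`, `[w, u] = v`. Over `ℝ` it is `so(3)` for `ε = 1` and `so(1, 2)` for
`ε = -1`. -/
def UVW (_ε : K) : Type _ := Fin 3 → K

namespace UVW

variable (ε : K)

instance : AddCommGroup (UVW ε) := inferInstanceAs (AddCommGroup (Fin 3 → K))

instance : Module K (UVW ε) := inferInstanceAs (Module K (Fin 3 → K))

instance : LieRing (UVW ε) where
  bracket x y := cross ε x y
  add_lie := cross_add_left ε
  lie_add := cross_add_right ε
  lie_self := cross_self ε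
  leibniz_lie := cross_leibniz ε

instance : LieAlgebra K (UVW ε) where
  lie_smul t x y := cross_smul ε t x y

/-- The first basis vector. -/
def u : UVW ε := (![1, 0, 0] : Fin 3 → K)

/-- The second basis vector. -/
def v : UVW ε := (![0, 1, 0] : Fin 3 → K)

/-- The third basis vector. -/
def w : UVW ε := (![0, 0, 1] : Fin 3 → K)

theorem lie_u_v : ⁅u ε, v ε⁆ = w ε := by
  change cross ε ![1, 0, 0] ![0, 1, 0] = ![0, 0, 1]
  simp [cross]

theorem lie_v_w : ⁅v ε, w ε⁆ = ε • u ε := by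
  change cross ε ![0, 1, 0] ![0, 0, 1] = ε • (![1, 0, 0] : Fin 3 → K)
  funext i; fin_cases i <;> simp [cross]

theorem lie_w_u : ⁅w ε, u ε⁆ = v ε := by
  change cross ε ![0, 0, 1] ![1, 0, 0] = ![0, 1, 0]
  simp [cross]

end UVW

/-- The monomials `u ⊗ t^(2k+1)`, `v ⊗ t^(2k+1)`, `w ⊗ t^(2k+2)`, `k ≥ 0`, in the algebra of
polynomial loops. -/
def n1Monomials (ε : K) : Set (K[X] ⊗[K] UVW ε) :=
  {x | ∃ k : ℕ, x = (Polynomial.X ^ (2 * k + 1) : K[X]) ⊗ₜ[K] UVW.u ε ∨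
    x = (Polynomial.X ^ (2 * k + 1) : K[X]) ⊗ₜ[K] UVW.v ε ∨
    x = (Polynomial.X ^ (2 * k + 2) : K[X]) ⊗ₜ[K] UVW.w ε}

theorem lie_mem_n1Monomials (ε : K) {x y : K[X] ⊗[K] UVW ε} (hx : x ∈ n1Monomials ε)
    (hy : y ∈ n1Monomials ε) : ⁅x, y⁆ ∈ Submodule.span K (n1Monomials ε) := by
  have vu : ⁅UVW.v ε, UVW.u ε⁆ = -UVW.w ε := by rw [← lie_skew, UVW.lie_u_v]
  have wv : ⁅UVW.w ε, UVW.v ε⁆ = -(ε • UVW.u ε) := by rw [← lie_skew, UVW.lie_v_w]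
  have uw : ⁅UVW.u ε, UVW.w ε⁆ = -UVW.v ε := by rw [← lie_skew, UVW.lie_w_u]
  have hu : ∀ n k : ℕ, n = 2 * k + 1 → (Polynomial.X ^ n : K[X]) ⊗ₜ[K] UVW.u ε ∈
      Submodule.span K (n1Monomials ε) := fun n k h =>
    Submodule.subset_span ⟨k, Or.inl (by rw [h])⟩
  have hv : ∀ n k : ℕ, n = 2 * k + 1 → (Polynomial.X ^ n : K[X]) ⊗ₜ[K] UVW.v ε ∈
      Submodule.span K (n1Monomials ε) := fun n k h =>
    Submodule.subset_span ⟨k, Or.inr (Or.inl (by rw [h]))⟩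
  have hw : ∀ n k : ℕ, n = 2 * k + 2 → (Polynomial.X ^ n : K[X]) ⊗ₜ[K] UVW.w ε ∈
      Submodule.span K (n1Monomials ε) := fun n k h =>
    Submodule.subset_span ⟨k, Or.inr (Or.inr (by rw [h]))⟩
  obtain ⟨k, rfl | rfl | rfl⟩ := hx <;> obtain ⟨l, rfl | rfl | rfl⟩ := hy <;>
    simp only [LieAlgebra.ExtendScalars.bracket_tmul, lie_self, UVW.lie_u_v, UVW.lie_v_w,
      UVW.lie_w_u, vu, wv, uw, TensorProduct.tmul_zero, TensorProduct.tmul_neg,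
      TensorProduct.tmul_smul, ← pow_add, neg_mem_iff]
  · exact zero_mem _
  · exact hw _ (k + l) (by ring)
  · exact hv _ (k + l + 1) (by ring)
  · exact hw _ (k + l) (by ring)
  · exact zero_mem _
  · exact Submodule.smul_mem _ _ (hu _ (k + l + 1) (by ring))
  · exact hv _ (k + l + 1) (by ring)
  · exact Submodule.smul_mem _ _ (hu _ (k + l + 1) (by ring))
  · exact zero_mem _

/-- The span of a set whose pairwise brackets lie in the span is a Lie subalgebra. -/
def spanSubalgebra {L : Type*} [LieRing L] [LieAlgebra K L] (s : Set L)
    (hs : ∀ x ∈ s, ∀ y ∈ s, ⁅x, y⁆ ∈ Submodule.span K s) : LieSubalgebra K L where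
  __ := Submodule.span K s
  lie_mem' {x y} hx hy := by
    change x ∈ Submodule.span K s at hx
    change y ∈ Submodule.span K s at hy
    change ⁅x, y⁆ ∈ Submodule.span K s
    induction hx using Submodule.span_induction with
    | zero => rw [zero_lie]; exact zero_mem _
    | add a b _ _ ha hb => rw [add_lie]; exact add_mem ha hb
    | smul t a _ ha => rw [smul_lie]; exact Submodule.smul_mem _ _ ha
    | mem a ha =>
    induction hy using Submodule.span_induction with
    | zero => rw [lie_zero]; exact zero_mem _
    | add c b _ _ hc hb => rw [lie_add]; exact add_mem hc hb
    | smul t c _ hc => rw [lie_smul]; exact Submodule.smul_mem _ _ hc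
    | mem b hb => exact hs a ha b hb

/-- The algebra `n_1^+` (`ε = 1`) or `n_1^-` (`ε = -1`): the subalgebra of the algebra of polynomial
loops that is spanned by the above monomials. -/
def n1 (ε : K) : LieSubalgebra K (K[X] ⊗[K] UVW ε) :=
  spanSubalgebra (n1Monomials ε) fun _ hx _ hy => lie_mem_n1Monomials ε hx hy

/-! ### The list and the condition -/

/-- The names on the list: `n_1^+`, `n_1^-`, `n_2`, `n_2^3`, `m_0`, and `m_0^S` for the nonempty
sets `S` of odd integers `≥ 3` (`m_0^∅` is `m_0`). -/
inductive Name : Type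
  | n1Plus
  | n1Minus
  | n2
  | n23
  | m0
  | m0S (S : OddSet) (hS : S.1.Nonempty)

variable (K) in
/-- The Lie algebra `g` is isomorphic to the Lie algebra over `K` of the given name. -/
def IsoTo (g : Type*) [LieRing g] [LieAlgebra K g] : Name → Prop
  | .n1Plus => Nonempty (g ≃ₗ⁅K⁆ NarrowLie.n1 (1 : K))
  | .n1Minus => Nonempty (g ≃ₗ⁅K⁆ NarrowLie.n1 (-1 : K))
  | .n2 => Nonempty (g ≃ₗ⁅K⁆ (NarrowLie.n2 K).Algebra)
  | .n23 => Nonempty (g ≃ₗ⁅K⁆ (NarrowLie.n23 K).Algebra)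
  | .m0 => Nonempty (g ≃ₗ⁅K⁆ (NarrowLie.m0 K).Algebra)
  | .m0S S _ => Nonempty (g ≃ₗ⁅K⁆ (NarrowLie.m0S K S).Algebra)

/-- For a Lie algebra graded by the `𝒜 i`: the grading is positive, `[g_1, g_i] = g_{i+1}` and
`dim g_i + dim g_{i+1} ≤ 3` for all `i ≥ 1`. -/
structure IsNarrow {g : Type*} [LieRing g] [LieAlgebra K g] (𝒜 : ℕ → Submodule K g) : Prop where
  zero : 𝒜 0 = ⊥
  lie_eq : ∀ i, 1 ≤ i → Submodule.span K {z | ∃ x ∈ 𝒜 1, ∃ y ∈ 𝒜 i, ⁅x, y⁆ = z} = 𝒜 (i + 1)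
  rank_le : ∀ i, 1 ≤ i → Module.rank K (𝒜 i) + Module.rank K (𝒜 (i + 1)) ≤ 3

end NarrowLie

end

/-! The algebra is generated by g_1, and the dimension bound makes g_1 a plane with a basis a, b (a
`Frame`). Put c = [a,b]. Since [a,[b,c]] = [b,[a,c]], the map x ↦ [x,[x,c]] is a quadratic form on
g_1 with values in g_4. It is not zero, for otherwise g_4 = 0, and the dimension bound allows it to
be diagonalized: [a,[b,c]] = 0 and [b,[b,c]] = ε [a,[a,c]] with [a,[a,c]] ≠ 0
(`Frame.exists_diagonal`).

If ε ≠ 0, these two relations of degree four and the dimension bound determine all brackets with a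
and b, and g is a loop algebra `n1 ε` (`Frame.isLoop`). Rescaling v and w changes ε by a square,
which leaves a sign over ℝ and nothing over ℂ.

If ε = 0, then [b,c] is central. Put x_0 = b, x_{n+1} = [a,x_n] and z_n = [b,x_n]. As long as the
z_n are central, [x_i,x_j] = ±z_{i+j}, so z_n = 0 for even n. If all z_n are central, g is m_0 or
m_0^S, where S records the degrees of the nonzero z_n. Otherwise the first noncentral one is some
z_{2m+3}. It commutes with b but not with a, and replacing a by a + tb makes x_{2m+5} = 0. Comparing
the brackets [x_i,x_j] in the next degrees shows that g would become finite-dimensional unless m = 0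
(`Frame.eq_zero_of_chain_eq_zero`). For m = 0 the two facts that [b,[b,a]] is central and that (ad
a)^5 b = 0, together with the dimension bound, reproduce the table of n_2 eight basis vectors at a
time (`Frame.isBlock_nextBlock`). The only remaining freedom is whether [b,c] is zero (n_2) or not
(n_2^3).

A dimension bound enters in one recurring way: a vector that is killed by a and b is either zero, or
one of two independent vectors in its degree, and two consecutive components cannot both be planes.

The algebras are told apart by isomorphism invariants: whether the second derived algebra is
central, an identity satisfied by n_1^±, whether the center is trivial, and, for m_0^S, the levels
of the lower central series at which central elements occur. Over ℝ the sign in n_1^± is detected by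
the existence of x, y with [x,[x,y]] = 0 ≠ [x,y]. -/

noncomputable section

namespace NarrowLie

/-! ### Frames of a narrow Lie algebra -/

section Frame

variable {K : Type*} [Field K] {g : Type*} [LieRing g] [LieAlgebra K g]

variable (K) in
/-- Two vectors are linearly independent. -/
def Indep (x y : g) : Prop := ∀ s t : K, s • x + t • y = 0 → s = 0 ∧ t = 0

theorem exists_eq_smul_of_not_indep {x y : g} (hy : y ≠ 0) (h : ¬ Indep K x y) :
    ∃ t : K, x = t • y := by
  simp only [Indep, not_forall] at h
  obtain ⟨s, t, h0, h1⟩ := h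
  have hs : s ≠ 0 := by
    rintro rfl
    rw [zero_smul, zero_add, smul_eq_zero] at h0
    exact h1 ⟨rfl, h0.resolve_right hy⟩
  refine ⟨-(s⁻¹ * t), ?_⟩
  have := congrArg (fun v => s⁻¹ • v) h0
  simp only [smul_add, smul_smul, inv_mul_cancel₀ hs, one_smul, smul_zero] at this
  rw [neg_smul]
  exact eq_neg_of_add_eq_zero_left this

/-- A basis `a, b` of the degree one part of an infinite-dimensional narrow Lie algebra. -/
structure Frame (𝒜 : ℕ → Submodule K g) (a b : g) : Prop where
  narrow : IsNarrow 𝒜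
  ne_bot : ∀ n, 1 ≤ n → 𝒜 n ≠ ⊥
  span_eq : 𝒜 1 = Submodule.span K {a, b}

variable {𝒜 : ℕ → Submodule K g} {a b : g}

namespace Frame

theorem left_mem (F : Frame 𝒜 a b) : a ∈ 𝒜 1 :=
  F.span_eq ▸ Submodule.subset_span (by simp)

theorem right_mem (F : Frame 𝒜 a b) : b ∈ 𝒜 1 :=
  F.span_eq ▸ Submodule.subset_span (by simp)

theorem of_span_le (F : Frame 𝒜 a b) {a' b' : g} (ha' : a' ∈ 𝒜 1) (hb' : b' ∈ 𝒜 1)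
    (ha : a ∈ Submodule.span K {a', b'}) (hb : b ∈ Submodule.span K {a', b'}) :
    Frame 𝒜 a' b' where
  narrow := F.narrow
  ne_bot := F.ne_bot
  span_eq := by
    apply le_antisymm
    · rw [F.span_eq, Submodule.span_le]
      rintro x (rfl | rfl)
      exacts [ha, hb]
    · rw [Submodule.span_le]
      rintro x (rfl | rfl)
      exacts [ha', hb']

theorem swap (F : Frame 𝒜 a b) : Frame 𝒜 b a :=
  F.of_span_le F.right_mem F.left_mem (Submodule.subset_span (by simp))
    (Submodule.subset_span (by simp))

theorem add_smul_left (F : Frame 𝒜 a b) (t : K) : Frame 𝒜 (a + t • b) b := by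
  refine F.of_span_le (add_mem F.left_mem (Submodule.smul_mem _ _ F.right_mem)) F.right_mem ?_
    (Submodule.subset_span (by simp))
  exact Submodule.mem_span_pair.2 ⟨1, -t, by module⟩

theorem lie_left_mem [SetLike.GradedBracket 𝒜] (F : Frame 𝒜 a b) {n : ℕ} {x : g} (hx : x ∈ 𝒜 n) :
    ⁅a, x⁆ ∈ 𝒜 (n + 1) :=
  add_comm 1 n ▸ SetLike.GradedBracket.bracket_mem F.left_mem hx

theorem lie_right_mem [SetLike.GradedBracket 𝒜] (F : Frame 𝒜 a b) {n : ℕ} {x : g} (hx : x ∈ 𝒜 n) :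
    ⁅b, x⁆ ∈ 𝒜 (n + 1) :=
  F.swap.lie_left_mem hx

/-- As [g_1, g_n] is all of g_{n+1}, brackets of a and b with a spanning set suffice. This is how
all upper bounds on components are propagated from one degree to the next. -/
theorem succ_le (F : Frame 𝒜 a b) {n : ℕ} (hn : 1 ≤ n) {s : Set g} {M : Submodule K g}
    (hs : 𝒜 n ≤ Submodule.span K s) (h : ∀ x ∈ s, ⁅a, x⁆ ∈ M ∧ ⁅b, x⁆ ∈ M) : 𝒜 (n + 1) ≤ M := by
  have key : ∀ x ∈ Submodule.span K s, ⁅a, x⁆ ∈ M ∧ ⁅b, x⁆ ∈ M := by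
    intro x hx
    induction hx using Submodule.span_induction with
    | mem x hx => exact h x hx
    | zero => simp
    | add x y _ _ hx hy =>
      rw [lie_add, lie_add]; exact ⟨add_mem hx.1 hy.1, add_mem hx.2 hy.2⟩
    | smul t x _ hx =>
      rw [lie_smul, lie_smul]; exact ⟨M.smul_mem _ hx.1, M.smul_mem _ hx.2⟩
  rw [← F.narrow.lie_eq n hn, Submodule.span_le]
  rintro _ ⟨x, hx, y, hy, rfl⟩
  rw [F.span_eq, Submodule.mem_span_pair] at hx
  obtain ⟨p, q, rfl⟩ := hx
  rw [add_lie, smul_lie, smul_lie]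
  exact add_mem (M.smul_mem _ (key y (hs hy)).1) (M.smul_mem _ (key y (hs hy)).2)

/-- Otherwise the next component would vanish. This is the form in which infinite-dimensionality is
used. -/
theorem not_le_span_of_killed (F : Frame 𝒜 a b) {n : ℕ} (hn : 1 ≤ n) {x : g} (ha : ⁅a, x⁆ = 0)
    (hb : ⁅b, x⁆ = 0) : ¬ 𝒜 n ≤ Submodule.span K {x} := fun h =>
  F.ne_bot (n + 1) (by omega) <| le_bot_iff.1 <| F.succ_le hn h <| by
    rintro _ rfl
    simp [ha, hb]

/-- The form in which the dimension bound is used: two consecutive components cannot both have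
dimension at least two. -/
theorem not_indep_indep (F : Frame 𝒜 a b) {n : ℕ} (hn : 1 ≤ n) {p q r s : g} (hp : p ∈ 𝒜 n)
    (hq : q ∈ 𝒜 n) (hr : r ∈ 𝒜 (n + 1)) (hs : s ∈ 𝒜 (n + 1)) (h : Indep K p q)
    (h' : Indep K r s) : False := by
  have two : ∀ (m : ℕ) (p q : g), p ∈ 𝒜 m → q ∈ 𝒜 m → Indep K p q →
      2 ≤ Module.rank K (𝒜 m) := by
    intro m p q hp hq h
    have li : LinearIndependent K ![(⟨p, hp⟩ : 𝒜 m), ⟨q, hq⟩] := by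
      rw [LinearIndependent.pair_iff]
      intro s t hst
      exact h s t (congrArg Subtype.val hst)
    simpa using li.cardinal_lift_le_rank
  have h4 := (add_le_add (two n p q hp hq h) (two (n + 1) r s hr hs h')).trans
    (F.narrow.rank_le n hn)
  norm_num at h4

/-- A subalgebra that contains a frame is everything. -/
theorem eq_top_of_mem [DirectSum.Decomposition 𝒜] (F : Frame 𝒜 a b) {H : LieSubalgebra K g}
    (ha : a ∈ H) (hb : b ∈ H) (x : g) : x ∈ H := by
  have h1 : 𝒜 1 ≤ H.toSubmodule := by
    rw [F.span_eq, Submodule.span_le]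
    rintro x (rfl | rfl)
    exacts [ha, hb]
  have h : ∀ n, 𝒜 n ≤ H.toSubmodule := by
    intro n
    induction n with
    | zero => rw [F.narrow.zero]; exact bot_le
    | succ n ih =>
      rcases Nat.eq_zero_or_pos n with rfl | hn
      · exact h1
      · rw [← F.narrow.lie_eq n hn, Submodule.span_le]
        rintro _ ⟨x, hx, y, hy, rfl⟩
        exact H.lie_mem (h1 hx) (ih hy)
  induction x using DirectSum.Decomposition.inductionOn 𝒜 with
  | zero => exact H.zero_mem
  | homogeneous x => exact h _ x.2
  | add x y hx hy => exact H.add_mem hx hy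

/-- The centralizer of z is a subalgebra, and a, b generate. So centrality only has to be tested on
the frame. -/
theorem lie_eq_zero_of_killed [DirectSum.Decomposition 𝒜] (F : Frame 𝒜 a b) {z : g}
    (ha : ⁅a, z⁆ = 0) (hb : ⁅b, z⁆ = 0) (x : g) : ⁅x, z⁆ = 0 := by
  let H : LieSubalgebra K g :=
    { carrier := {x | ⁅x, z⁆ = 0}
      add_mem' := fun {x y} hx hy => by
        simp only [Set.mem_ofPred_eq] at *; rw [add_lie, hx, hy, add_zero]
      zero_mem' := zero_lie z
      smul_mem' := fun t x hx => by
        simp only [Set.mem_ofPred_eq] at *; rw [smul_lie, hx, smul_zero]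
      lie_mem' := fun {x y} hx hy => by
        change ⁅⁅x, y⁆, z⁆ = 0
        change ⁅x, z⁆ = 0 at hx
        change ⁅y, z⁆ = 0 at hy
        rw [lie_lie, hx, hy, lie_zero, lie_zero, sub_zero] }
  exact F.eq_top_of_mem (H := H) ha hb x

end Frame

/-- A vanishing component forces all later ones to vanish, and then g would be finite-dimensional.
Hence g_2 ≠ 0, so dim g_1 ≤ 2 by the bound, while dim g_1 ≤ 1 would give g_2 = [g_1, g_1] = 0. -/
theorem IsNarrow.exists_frame [DirectSum.Decomposition 𝒜] (h : IsNarrow 𝒜)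
    (hinf : ¬ FiniteDimensional K g) : ∃ a b, Frame 𝒜 a b := by
  have fin : ∀ n, FiniteDimensional K (𝒜 n) := by
    intro n
    rcases Nat.eq_zero_or_pos n with rfl | hn
    · rw [h.zero]; infer_instance
    · refine Module.rank_lt_aleph0_iff.1 (lt_of_le_of_lt (le_trans le_self_add (h.rank_le n hn)) ?_)
      exact_mod_cast Cardinal.natCast_lt_aleph0 (n := 3)
  have ne_bot : ∀ n, 1 ≤ n → 𝒜 n ≠ ⊥ := by
    intro n hn h0
    have hz : ∀ m, 𝒜 (n + m) = ⊥ := by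
      intro m
      induction m with
      | zero => exact h0
      | succ m ih =>
        rw [← add_assoc, ← h.lie_eq (n + m) (by omega), ih, Submodule.span_eq_bot]
        rintro _ ⟨x, -, y, hy, rfl⟩
        rw [(Submodule.mem_bot K).1 hy, lie_zero]
    refine hinf ?_
    have top : (⨆ i : Fin n, 𝒜 i) = ⊤ := by
      rw [eq_top_iff, ← (DirectSum.Decomposition.isInternal 𝒜).submodule_iSup_eq_top]
      refine iSup_le fun i => ?_
      by_cases hi : i < n
      · exact le_iSup (fun i : Fin n => 𝒜 i) ⟨i, hi⟩
      · obtain ⟨m, rfl⟩ := Nat.exists_eq_add_of_le (not_lt.1 hi)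
        rw [hz]; exact bot_le
    have : FiniteDimensional K (⨆ i : Fin n, 𝒜 i : Submodule K g) := Submodule.finite_iSup _
    rw [top] at this
    exact Module.finite_def.2 (Module.Finite.iff_fg.1 this)
  have h12 : Module.finrank K (𝒜 1) + Module.finrank K (𝒜 2) ≤ 3 := by
    have := h.rank_le 1 le_rfl
    rw [← Module.finrank_eq_rank, ← Module.finrank_eq_rank] at this
    exact_mod_cast this
  have pos : 0 < Module.finrank K (𝒜 2) := by
    rw [Nat.pos_iff_ne_zero]
    intro h0
    exact ne_bot 2 (by norm_num) (Submodule.finrank_eq_zero.1 h0)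
  have key : ∃ a b, 𝒜 1 = Submodule.span K {a, b} := by
    have : Module.finrank K (𝒜 1) ≤ 2 := by omega
    let B := Module.finBasis K (𝒜 1)
    rcases Nat.lt_or_ge (Module.finrank K (𝒜 1)) 2 with h1 | h2
    · exfalso
      obtain ⟨v, hv⟩ := finrank_le_one_iff.1 (Nat.lt_succ_iff.1 h1)
      refine ne_bot 2 (by norm_num) ?_
      rw [← h.lie_eq 1 le_rfl, Submodule.span_eq_bot]
      rintro _ ⟨x, hx, y, hy, rfl⟩
      obtain ⟨s, hs⟩ := hv ⟨x, hx⟩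
      obtain ⟨t, ht⟩ := hv ⟨y, hy⟩
      replace hs := congrArg Subtype.val hs
      replace ht := congrArg Subtype.val ht
      simp only [Submodule.coe_smul] at hs ht
      rw [← hs, ← ht, smul_lie, lie_smul, lie_self, smul_zero, smul_zero]
    · have e : Module.finrank K (𝒜 1) = 2 := le_antisymm this h2
      let B := Module.finBasisOfFinrankEq K (𝒜 1) e
      refine ⟨B 0, B 1, le_antisymm (fun x hx => ?_) ?_⟩
      · have := B.sum_repr ⟨x, hx⟩
        rw [Fin.sum_univ_two] at this
        exact Submodule.mem_span_pair.2 ⟨_, _, congrArg Subtype.val this⟩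
      · rw [Submodule.span_le]
        rintro x (rfl | rfl)
        exacts [(B 0).2, (B 1).2]
  obtain ⟨a, b, hab⟩ := key
  exact ⟨a, b, h, ne_bot, hab⟩

end Frame


/-! ### The quadratic form x ↦ [x,[x,[a,b]]] on the degree one part -/

section Select

variable {K : Type*} [Field K] {g : Type*} [LieRing g] [LieAlgebra K g]
variable {𝒜 : ℕ → Submodule K g} {a b : g}

/-- The two brackets of degree four that involve both basis vectors agree. -/
theorem lie_lie_comm (a b : g) : ⁅b, ⁅a, ⁅a, b⁆⁆⁆ = ⁅a, ⁅b, ⁅a, b⁆⁆⁆ := by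
  have h := lie_lie a b ⁅a, b⁆
  rw [lie_self] at h
  exact (sub_eq_zero.1 h.symm).symm

namespace Frame

theorem two_le_span (F : Frame 𝒜 a b) : 𝒜 2 ≤ Submodule.span K {⁅a, b⁆} := by
  refine F.succ_le le_rfl F.span_eq.le ?_
  have h : ⁅a, b⁆ ∈ Submodule.span K {⁅a, b⁆} := Submodule.mem_span_singleton_self _
  rintro x (hx | hx) <;> rw [hx]
  · rw [lie_self, ← lie_skew b]
    exact ⟨zero_mem _, neg_mem h⟩
  · rw [lie_self]
    exact ⟨h, zero_mem _⟩

theorem three_le_span (F : Frame 𝒜 a b) :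
    𝒜 3 ≤ Submodule.span K {⁅a, ⁅a, b⁆⁆, ⁅b, ⁅a, b⁆⁆} := by
  refine F.succ_le (by norm_num) F.two_le_span ?_
  rintro x rfl
  exact ⟨Submodule.subset_span (by simp), Submodule.subset_span (by simp)⟩

theorem four_le (F : Frame 𝒜 a b) {M : Submodule K g} (h1 : ⁅a, ⁅a, ⁅a, b⁆⁆⁆ ∈ M)
    (h2 : ⁅a, ⁅b, ⁅a, b⁆⁆⁆ ∈ M) (h3 : ⁅b, ⁅b, ⁅a, b⁆⁆⁆ ∈ M) : 𝒜 4 ≤ M := by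
  refine F.succ_le (by norm_num) F.three_le_span ?_
  rintro x (rfl | rfl)
  · exact ⟨h1, lie_lie_comm a b ▸ h2⟩
  · exact ⟨h2, h3⟩

/-- Polarization: if the quadratic form vanishes at a, b and a + b, then so does its polar form
2[a,[b,c]], c = [a,b], and the three values spanning g_4 are all zero. -/
theorem exists_ne_zero [CharZero K] (F : Frame 𝒜 a b) :
    ∃ a b : g, Frame 𝒜 a b ∧ ⁅a, ⁅a, ⁅a, b⁆⁆⁆ ≠ 0 := by
  by_contra! h
  have h1 := h a b F
  have h3 : ⁅b, ⁅b, ⁅a, b⁆⁆⁆ = 0 := by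
    have := h b a F.swap
    rwa [← lie_skew b a, lie_neg, lie_neg, neg_eq_zero] at this
  have h2 : ⁅a, ⁅b, ⁅a, b⁆⁆⁆ = 0 := by
    have := h _ b (F.add_smul_left 1)
    rw [one_smul] at this
    simp only [add_lie, lie_self, add_zero, lie_add, h1, h3, lie_lie_comm a b, zero_add] at this
    rw [← two_smul K] at this
    exact (smul_eq_zero.1 this).resolve_left two_ne_zero
  refine F.ne_bot 4 (by norm_num) (le_bot_iff.1 (F.four_le ?_ ?_ ?_)) <;> simp [h1, h2, h3]

/-- The quadratic form `x ↦ [x, [x, [a, b]]]` can be diagonalized. -/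
theorem exists_diagonal [CharZero K] [SetLike.GradedBracket 𝒜] (F : Frame 𝒜 a b) :
    ∃ (a b : g) (ε : K), Frame 𝒜 a b ∧ ⁅a, ⁅a, ⁅a, b⁆⁆⁆ ≠ 0 ∧ ⁅a, ⁅b, ⁅a, b⁆⁆⁆ = 0 ∧
      ⁅b, ⁅b, ⁅a, b⁆⁆⁆ = ε • ⁅a, ⁅a, ⁅a, b⁆⁆⁆ := by
  obtain ⟨a, b, F, hf⟩ := F.exists_ne_zero
  have hc : ∀ t : K, ⁅a, b + t • a⁆ = ⁅a, b⁆ := fun t => by simp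
  have key : ∃ s : K, ⁅a, ⁅b + s • a, ⁅a, b⁆⁆⁆ = 0 ∧ ∃ ε : K,
      ⁅b + s • a, ⁅b + s • a, ⁅a, b⁆⁆⁆ = ε • ⁅a, ⁅a, ⁅a, b⁆⁆⁆ := by
    have hac : ⁅a, ⁅a, b⁆⁆ ≠ 0 := fun h => hf (by rw [h, lie_zero])
    have mem2 : ⁅a, b⁆ ∈ 𝒜 2 := F.lie_left_mem F.right_mem
    have mem4 : ∀ x y : g, x ∈ 𝒜 1 → y ∈ 𝒜 1 → ⁅x, ⁅y, ⁅a, b⁆⁆⁆ ∈ 𝒜 4 := fun x y hx hy =>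
      SetLike.GradedBracket.bracket_mem (i := 1) (j := 3) hx
        (SetLike.GradedBracket.bracket_mem (i := 1) (j := 2) hy mem2)
    -- If g_3 is a plane, then g_4 is the line through [a,[a,c]], where c = [a,b], and one completes
    -- the square. If [b,c] = l [a,c], then b - l a commutes with c and the form has rank one.
    by_cases hi : Indep K ⁅b, ⁅a, b⁆⁆ ⁅a, ⁅a, b⁆⁆
    · have one : ∀ x ∈ 𝒜 4, ∃ t : K, x = t • ⁅a, ⁅a, ⁅a, b⁆⁆⁆ := fun x hx =>
        exists_eq_smul_of_not_indep hf fun h =>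
          F.not_indep_indep (n := 3) (by norm_num) (F.lie_right_mem mem2) (F.lie_left_mem mem2) hx
            (mem4 a a F.left_mem F.left_mem) hi h
      obtain ⟨β, hβ⟩ := one _ (mem4 a b F.left_mem F.right_mem)
      have hb : b + (-β) • a ∈ 𝒜 1 := add_mem F.right_mem (Submodule.smul_mem _ _ F.left_mem)
      refine ⟨-β, ?_, one _ (mem4 _ _ hb hb)⟩
      rw [add_lie, smul_lie, lie_add, lie_smul, hβ, ← add_smul, add_neg_cancel, zero_smul]
    · obtain ⟨l, hl⟩ := exists_eq_smul_of_not_indep hac hi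
      have : ⁅b + (-l) • a, ⁅a, b⁆⁆ = 0 := by
        rw [add_lie, smul_lie, hl, ← add_smul, add_neg_cancel, zero_smul]
      exact ⟨-l, by rw [this, lie_zero], 0, by rw [this, lie_zero, zero_smul]⟩
  obtain ⟨s, h1, ε, h2⟩ := key
  refine ⟨a, b + s • a, ε, (F.swap.add_smul_left s).swap, ?_⟩
  rw [hc]
  exact ⟨hf, h1, h2⟩

end Frame

end Select


/-! ### The degenerate case: the chain x_n = (ad a)^n b and the brackets z_n = [b, x_n] -/

section Chain

variable {K : Type*} [Field K] {g : Type*} [LieRing g] [LieAlgebra K g]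
variable {𝒜 : ℕ → Submodule K g} {a b : g}

/-- The iterated brackets `[a, [a, …, [a, b]]]`. -/
def chain (a b : g) : ℕ → g
  | 0 => b
  | n + 1 => ⁅a, chain a b n⁆

theorem chain_zero (a b : g) : chain a b 0 = b := rfl

theorem chain_succ (a b : g) (n : ℕ) : chain a b (n + 1) = ⁅a, chain a b n⁆ := rfl

/-- The brackets of the chain in degree `N + 1`, in terms of those in degree `N`. -/
theorem lie_chain_succ {N : ℕ} {C D : ℕ → g}
    (hC : ∀ i j, i + j = N → ⁅chain a b i, chain a b j⁆ = (-1 : K) ^ i • C i)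
    (h0 : ⁅b, chain a b (N + 1)⁆ = D 0) (hD : ∀ i, D (i + 1) = D i - ⁅a, C i⁆) :
    ∀ i j, i + j = N + 1 → ⁅chain a b i, chain a b j⁆ = (-1 : K) ^ i • D i := by
  intro i
  induction i with
  | zero =>
    intro j hj
    rw [zero_add] at hj
    rw [hj, chain_zero, h0, pow_zero, one_smul]
  | succ i ih =>
    intro j hj
    -- The identity [x_{i+1},x_j] = [a,[x_i,x_j]] - [x_i,x_{j+1}] is the recursion D (i+1) = D i -
    -- [a, C i] after removal of the alternating sign.
    rw [chain_succ, lie_lie, ← chain_succ a b j, ih (j + 1) (by omega), hC i j (by omega), hD,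
      lie_smul, pow_succ]
    module

/-- The brackets `[b, x]` with the first elements of the chain are central. -/
def Killed (a b : g) (n : ℕ) : Prop :=
  ∀ m ≤ n, ⁅a, ⁅b, chain a b m⁆⁆ = 0 ∧ ⁅b, ⁅b, chain a b m⁆⁆ = 0

-- While a kills z_N, passing from x_i, x_{j+1} to x_{i+1}, x_j only changes the sign, so up to sign
-- the bracket depends on i + j alone. The range reaches n + 1 because the brackets with i + j = N +
-- 1 only require that z_N is killed.
variable (K) in
theorem Killed.lie_chain {n : ℕ} (h : Killed a b n) (i j : ℕ) (hij : i + j ≤ n + 1) :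
    ⁅chain a b i, chain a b j⁆ = (-1 : K) ^ i • ⁅b, chain a b (i + j)⁆ := by
  have key : ∀ N, N ≤ n + 1 → ∀ i j, i + j = N →
      ⁅chain a b i, chain a b j⁆ = (-1 : K) ^ i • ⁅b, chain a b N⁆ := by
    intro N
    induction N with
    | zero =>
      intro _ i j hij
      obtain ⟨rfl, rfl⟩ : i = 0 ∧ j = 0 := by omega
      simp [chain_zero]
    | succ N ih =>
      intro hN
      exact lie_chain_succ (C := fun _ => ⁅b, chain a b N⁆) (D := fun _ => ⁅b, chain a b (N + 1)⁆)
        (ih (by omega)) rfl fun i => by rw [(h N (by omega)).1, sub_zero]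
  exact key _ hij i j rfl

/-- Since [x_i, x_i] = 0 equals z_{2i} up to sign. -/
theorem Killed.lie_even (K : Type*) [Field K] {g : Type*} [LieRing g] [LieAlgebra K g] {a b : g}
    {n : ℕ} (h : Killed a b n) (i : ℕ) (hi : 2 * i ≤ n + 1) :
    ⁅b, chain a b (2 * i)⁆ = 0 := by
  have := h.lie_chain K i i (by omega)
  rw [lie_self, ← two_mul] at this
  exact (smul_eq_zero.1 this.symm).resolve_left (pow_ne_zero _ (neg_ne_zero.2 one_ne_zero))

/-- The even bracket z_{2m+2} is zero, so the first noncentral z_n has odd index. -/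
theorem Killed.succ_odd (K : Type*) [Field K] {g : Type*} [LieRing g] [LieAlgebra K g] {a b : g}
    {m : ℕ} (h : Killed a b (2 * m + 1)) : Killed a b (2 * m + 2) := by
  intro i hi
  rcases Nat.lt_or_ge i (2 * m + 2) with h1 | h1
  · exact h i (by omega)
  · obtain rfl : i = 2 * (m + 1) := by omega
    rw [h.lie_even K (m + 1) (by omega), lie_zero, lie_zero]
    exact ⟨rfl, rfl⟩

/-- With y = [a, z_{2m+3}] possibly nonzero, each step of the recursion subtracts y, so the
coefficient is affine in i with slope -1. It vanishes at i = m + 2 because [x_{m+2}, x_{m+2}] = 0.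
-/
theorem Killed.lie_chain_add_four [CharZero K] {m : ℕ} (h : Killed a b (2 * m + 2)) (i j : ℕ)
    (hij : i + j = 2 * m + 4) : ⁅chain a b i, chain a b j⁆ =
      (-1 : K) ^ i • ((m : K) + 2 - i) • ⁅a, ⁅b, chain a b (2 * m + 3)⁆⁆ := by
  set y := ⁅a, ⁅b, chain a b (2 * m + 3)⁆⁆ with hy
  have key := lie_chain_succ (K := K) (a := a) (b := b) (N := 2 * m + 3)
    (C := fun _ => ⁅b, chain a b (2 * m + 3)⁆)
    (D := fun i => ⁅b, chain a b (2 * m + 4)⁆ - (i : K) • y)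
    (fun i j hij => by rw [h.lie_chain K i j (by omega), hij]) (by simp)
    (fun i => by push_cast; rw [← hy]; module)
  have h0 : ⁅b, chain a b (2 * m + 4)⁆ = ((m : K) + 2) • y := by
    have := key (m + 2) (m + 2) (by ring)
    rw [lie_self] at this
    have := (smul_eq_zero.1 this.symm).resolve_left (pow_ne_zero _ (neg_ne_zero.2 one_ne_zero))
    rw [sub_eq_zero.1 this]
    push_cast
    rfl
  rw [key i j hij, h0]
  module

namespace Frame

theorem chain_mem [GradedLieAlgebra 𝒜] (F : Frame 𝒜 a b) (n : ℕ) : chain a b n ∈ 𝒜 (n + 1) := by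
  induction n with
  | zero => exact F.right_mem
  | succ n ih => exact F.lie_left_mem ih

/-- The homogeneous components are spanned by the chain and the brackets with `b`. -/
theorem le_span_chain (F : Frame 𝒜 a b) {n : ℕ} (h : Killed a b n) (i : ℕ) (hi : i ≤ n + 1) :
    𝒜 (i + 2) ≤ Submodule.span K {chain a b (i + 1), ⁅b, chain a b i⁆} := by
  induction i with
  | zero =>
    refine F.two_le_span.trans (Submodule.span_mono ?_)
    simp [chain_succ, chain_zero]
  | succ i ih =>
    refine F.succ_le (by omega) (ih (by omega)) ?_
    rintro x (hx | hx) <;> rw [hx]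
    · exact ⟨Submodule.subset_span (by simp [chain_succ]), Submodule.subset_span (by simp)⟩
    · rw [(h i (by omega)).1, (h i (by omega)).2]
      exact ⟨zero_mem _, zero_mem _⟩

/-- Up to sign z_{2m+3} is [x_1, x_{2m+2}], and ad b sends the two factors to the central vectors
z_1 and z_{2m+2}. So only a can fail to commute with the next z. -/
theorem lie_lie_chain_odd [GradedLieAlgebra 𝒜] (F : Frame 𝒜 a b) {m : ℕ} (h : Killed a b
    (2 * m + 2)) :
    ⁅b, ⁅b, chain a b (2 * m + 3)⁆⁆ = 0 := by
  have h1 := h.lie_chain K 1 (2 * m + 2) (by omega)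
  have c : ∀ i ≤ 2 * m + 2, ∀ x : g, ⁅x, ⁅b, chain a b i⁆⁆ = 0 := fun i hi =>
    F.lie_eq_zero_of_killed (h i hi).1 (h i hi).2
  have h2 : ⁅b, ⁅chain a b 1, chain a b (2 * m + 2)⁆⁆ = 0 := by
    rw [leibniz_lie, c _ le_rfl, ← lie_skew, c 1 (by omega), neg_zero, add_zero]
  rw [h1, lie_smul, show 1 + (2 * m + 2) = 2 * m + 3 by ring, pow_one, neg_smul, one_smul,
    neg_eq_zero] at h2
  exact h2

/-- Both vectors are images under ad a, of x_{2m+4} and z_{2m+3}. If the images were independent, so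
would be the preimages, and two consecutive components would have dimension two. -/
theorem chain_eq_smul [GradedLieAlgebra 𝒜] (F : Frame 𝒜 a b) (m : ℕ)
    (hy : ⁅a, ⁅b, chain a b (2 * m + 3)⁆⁆ ≠ 0) :
    ∃ t : K, chain a b (2 * m + 5) = t • ⁅a, ⁅b, chain a b (2 * m + 3)⁆⁆ := by
  refine exists_eq_smul_of_not_indep hy fun hi => ?_
  have h1 : chain a b (2 * m + 4) ∈ 𝒜 (2 * m + 5) := F.chain_mem _
  have h2 : ⁅b, chain a b (2 * m + 3)⁆ ∈ 𝒜 (2 * m + 5) := F.lie_right_mem (F.chain_mem _)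
  refine F.not_indep_indep (by omega) h1 h2 (F.lie_left_mem h1) (F.lie_left_mem h2) ?_ hi
  intro s t hst
  refine hi s t ?_
  have := congrArg (fun x => ⁅a, x⁆) hst
  simpa [chain_succ] using this

end Frame

/-- The correction t z_i is killed by a and b for i ≤ n, hence does not propagate to the next term.
-/
theorem Killed.chain_add_smul {n : ℕ} (h : Killed a b n) (t : K) (i : ℕ) (hi : i ≤ n + 1) :
    chain (a + t • b) b (i + 1) = chain a b (i + 1) + t • ⁅b, chain a b i⁆ := by
  induction i with
  | zero => simp [chain_succ, chain_zero]
  | succ i ih =>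
    rw [chain_succ, ih (by omega), chain_succ a b (i + 1)]
    simp only [lie_add, add_lie, smul_lie, lie_smul, (h i (by omega)).1, (h i (by omega)).2]
    simp

/-- After a change of basis, the first non-central bracket occurs where the chain stops. -/
theorem Frame.exists_chain_eq_zero [GradedLieAlgebra 𝒜] [CharZero K] (F : Frame 𝒜 a b) {m : ℕ}
    (h : Killed a b (2 * m + 2)) (hy : ⁅a, ⁅b, chain a b (2 * m + 3)⁆⁆ ≠ 0) :
    ∃ a : g, Frame 𝒜 a b ∧ Killed a b (2 * m + 2) ∧ ⁅a, ⁅b, chain a b (2 * m + 3)⁆⁆ ≠ 0 ∧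
      chain a b (2 * m + 5) = 0 := by
  obtain ⟨μ, hμ⟩ := F.chain_eq_smul m hy
  have hl : ((m : K) + 3) ≠ 0 := by exact_mod_cast Nat.succ_ne_zero (m + 2)
  -- With y = [a, z_{2m+3}], the new x_{2m+5} is (μ + t(m+2) + t) y: the old x_{2m+5} gives μ y,
  -- t[b, x_{2m+4}] gives t(m+2) y, and t[a, z_{2m+3}] gives t y.
  set t : K := -(μ / (m + 3)) with ht
  have hbz := F.lie_lie_chain_odd h
  have hb4 : ⁅b, chain a b (2 * m + 4)⁆ = ((m : K) + 2) • ⁅a, ⁅b, chain a b (2 * m + 3)⁆⁆ := by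
    have := h.lie_chain_add_four (K := K) 0 (2 * m + 4) (by ring)
    simpa [chain_zero] using this
  have hX := fun i hi => h.chain_add_smul t i hi
  have hz : ∀ i ≤ 2 * m + 4, ⁅b, chain (a + t • b) b i⁆ = ⁅b, chain a b i⁆ := by
    intro i hi
    rcases i with _ | i
    · rfl
    · have : ⁅b, ⁅b, chain a b i⁆⁆ = 0 := by
        rcases Nat.lt_or_ge i (2 * m + 3) with h1 | h1
        · exact (h i (by omega)).2
        · obtain rfl : i = 2 * m + 3 := by omega
          exact hbz
      rw [hX i (by omega), lie_add, lie_smul, this, smul_zero, add_zero]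
  refine ⟨a + t • b, F.add_smul_left t, fun i hi => ?_, ?_, ?_⟩
  · rw [hz i (by omega), add_lie, smul_lie, (h i hi).1, (h i hi).2, smul_zero, add_zero]
    exact ⟨rfl, rfl⟩
  · rw [hz _ (by omega), add_lie, smul_lie, hbz, smul_zero, add_zero]
    exact hy
  · rw [chain_succ, hX (2 * m + 3) (by omega)]
    simp only [lie_add, add_lie, smul_lie, lie_smul, hbz, hb4, ← chain_succ a b, hμ]
    simp only [smul_zero, add_zero, smul_smul, ← add_smul]
    have : μ + t * (↑m + 2) + t = 0 := by rw [ht]; field_simp; ring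
    linear_combination (norm := module) this • ⁅a, ⁅b, chain a b (2 * m + 3)⁆⁆

/-- If the chain stops, it stops after five steps. -/
theorem Frame.eq_zero_of_chain_eq_zero [GradedLieAlgebra 𝒜] [CharZero K] (F : Frame 𝒜 a b) {m : ℕ}
    (h : Killed a b (2 * m + 2)) (h5 : chain a b (2 * m + 5) = 0) : m = 0 := by
  by_contra hm
  have hm' : (m : K) ≠ 0 := Nat.cast_ne_zero.2 hm
  set z := ⁅b, chain a b (2 * m + 3)⁆ with hz
  set y := ⁅a, z⁆ with hy
  have hw : ∀ i j, i + j = 2 * m + 4 →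
      ⁅chain a b i, chain a b j⁆ = (-1 : K) ^ i • ((m : K) + 2 - i) • y :=
    fun i j hij => h.lie_chain_add_four i j hij
  -- The coefficients are minus the partial sums of m + 2 - k over k < i. They start from zero
  -- because x_{2m+5} = 0. The next line sums once more.
  have hv := lie_chain_succ (D := fun i => (-(i * (2 * m + 5 - i) / 2 : K)) • ⁅a, y⁆) hw
    (by simp [h5]) (fun i => by rw [lie_smul]; push_cast; module)
  have hs := lie_chain_succ (D := fun i => ((i * (i - 1) * (3 * m + 8 - i) / 6 : K)) • ⁅a, ⁅a, y⁆⁆)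
    hv (by simp [chain_succ a b (2 * m + 5), h5])
    (fun i => by rw [lie_smul, ← sub_smul]; congr 1; push_cast; field_simp; ring)
  -- On the diagonal i = j = m + 3 the bracket is zero while the coefficient (m+3)(m+2)(2m+5)/6 is
  -- not.
  have hay : ⁅a, ⁅a, y⁆⁆ = 0 := by
    have := hs (m + 3) (m + 3) (by ring)
    rw [lie_self] at this
    have := (smul_eq_zero.1 this.symm).resolve_left (pow_ne_zero _ (neg_ne_zero.2 one_ne_zero))
    refine (smul_eq_zero.1 this).resolve_left ?_
    have e : (((m + 3 : ℕ) : K) * ((m + 3 : ℕ) - 1) * (3 * m + 8 - (m + 3 : ℕ)) / 6)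
        = (((m + 3) * (m + 2) * (2 * m + 5) : ℕ) : K) / 6 := by push_cast; ring
    rw [e]
    exact div_ne_zero (Nat.cast_ne_zero.2 (by positivity)) (by norm_num)
  have hz2 : ⁅b, chain a b 2⁆ = 0 := h.lie_even K 1 (by omega)
  have hbz : ⁅b, z⁆ = 0 := F.lie_lie_chain_odd h
  -- Here m ≠ 0 enters: [x_2, x_{2m+2}] = m y, and ad b annihilates this bracket since z_2 =
  -- z_{2m+2} = 0.
  have hby : ⁅b, y⁆ = 0 := by
    have e : ⁅b, ⁅chain a b 2, chain a b (2 * m + 2)⁆⁆ = 0 := by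
      have h2 : ⁅b, chain a b (2 * m + 2)⁆ = 0 := h.lie_even K (m + 1) (by omega)
      rw [leibniz_lie, hz2, h2, lie_zero, zero_lie, zero_add]
    rw [hw 2 (2 * m + 2) (by ring), lie_smul, lie_smul, smul_smul] at e
    refine (smul_eq_zero.1 e).resolve_left ?_
    simpa using hm'
  -- The vector [b,[x_2, x_{2m+3}]] is -(2m+3)[b,[a,y]] by the formula above, and [x_2, z_{2m+3}] =
  -- [b,[a,y]] by the Leibniz rule.
  have hbay : ⁅b, ⁅a, y⁆⁆ = 0 := by
    have e : ⁅b, ⁅chain a b 2, chain a b (2 * m + 3)⁆⁆ = ⁅chain a b 2, z⁆ := by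
      rw [leibniz_lie, hz2, zero_lie, zero_add]
    have e2 : ⁅chain a b 2, z⁆ = ⁅b, ⁅a, y⁆⁆ := by
      simp only [chain_succ, chain_zero, lie_lie, hbz, hby, ← hy, lie_zero, lie_sub]
      abel
    rw [hv 2 (2 * m + 3) (by ring), e2, lie_smul, lie_smul, smul_smul, ← sub_eq_zero] at e
    have e3 : (2 * (m + 2) : K) • ⁅b, ⁅a, y⁆⁆ = 0 := by
      rw [← neg_eq_zero, ← e]
      push_cast
      module
    refine (smul_eq_zero.1 e3).resolve_left ?_
    exact_mod_cast (by positivity : 2 * (m + 2) ≠ 0)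
  -- Now degree 2m+6 is spanned by y and degree 2m+7 by [a,y], which a and b kill, so the algebra
  -- would stop.
  have s1 : 𝒜 (2 * m + 3 + 2 + 1) ≤ Submodule.span K {y} := by
    refine F.succ_le (by omega) (F.le_span_chain h (2 * m + 3) le_rfl) ?_
    have my : y ∈ Submodule.span K {y} := Submodule.mem_span_singleton_self _
    have h4 := hw 0 (2 * m + 4) (by ring)
    rw [chain_zero] at h4
    rintro x (hx | hx) <;> rw [hx]
    · rw [← chain_succ, h5, h4]
      exact ⟨zero_mem _, Submodule.smul_mem _ _ (Submodule.smul_mem _ _ my)⟩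
    · exact ⟨my, hbz ▸ zero_mem _⟩
  have s2 : 𝒜 (2 * m + 3 + 2 + 2) ≤ Submodule.span K {⁅a, y⁆} := by
    refine F.succ_le (by omega) s1 ?_
    rintro x rfl
    exact ⟨Submodule.mem_span_singleton_self _, hby ▸ zero_mem _⟩
  exact F.not_le_span_of_killed (by omega) hay hbay s2

/-- The alternative for a frame with degenerate quadratic form. -/
theorem Frame.killed_or [GradedLieAlgebra 𝒜] [CharZero K] (F : Frame 𝒜 a b)
    (h : Killed a b 1) : (∀ n, Killed a b n) ∨ ∃ a : g, Frame 𝒜 a b ∧ Killed a b 2 ∧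
      chain a b 5 = 0 := by
  -- Only the brackets of a with z of odd index at least 3 can obstruct: z_1 is covered by the
  -- hypothesis, even z vanish, and b kills the next odd z automatically.
  by_cases hall : ∀ m, ⁅a, ⁅b, chain a b (2 * m + 3)⁆⁆ = 0
  · left
    have step : ∀ m, Killed a b (2 * m + 1) := by
      intro m
      induction m with
      | zero => exact h
      | succ m ih =>
        have ih' := ih.succ_odd K
        intro i hi
        rcases Nat.lt_or_ge i (2 * m + 3) with h1 | h1
        · exact ih' i (by omega)
        · obtain rfl : i = 2 * m + 3 := by omega
          exact ⟨hall m, F.lie_lie_chain_odd ih'⟩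
    exact fun n i hi => step n i (by omega)
  · right
    push Not at hall
    classical
    set m := Nat.find hall with hm
    have hy := Nat.find_spec hall
    have step : ∀ k ≤ m, Killed a b (2 * k + 1) := by
      intro k
      induction k with
      | zero => exact fun _ => h
      | succ k ih =>
        intro hk
        have ih' := (ih (by omega)).succ_odd K
        intro i hi
        rcases Nat.lt_or_ge i (2 * k + 3) with h1 | h1
        · exact ih' i (by omega)
        · obtain rfl : i = 2 * k + 3 := by omega
          exact ⟨not_not.1 (Nat.find_min hall (show k < m by omega)), F.lie_lie_chain_odd ih'⟩
    obtain ⟨a', F', h', -, h5⟩ := F.exists_chain_eq_zero ((step m le_rfl).succ_odd K) hy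
    have m0 := F'.eq_zero_of_chain_eq_zero h' h5
    rw [m0] at h' h5
    exact ⟨a', F', h', h5⟩

end Chain


/-! ### The algebras n_2 and n_2^3: eight basis vectors at a time -/

section Blocks

variable {K : Type*} [Field K] {g : Type*} [LieRing g] [LieAlgebra K g]
variable {𝒜 : ℕ → Submodule K g} {a b : g}

variable (K) in
/-- The operator form of `[[b, [b, a]], x] = 0`. -/
theorem cubic_relation (x : g) (h : ⁅⁅b, ⁅b, a⁆⁆, x⁆ = 0) :
    ⁅b, ⁅b, ⁅a, x⁆⁆⁆ - (2 : K) • ⁅b, ⁅a, ⁅b, x⁆⁆⁆ + ⁅a, ⁅b, ⁅b, x⁆⁆⁆ = 0 := by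
  rw [← h]
  simp only [lie_lie, lie_sub]
  module

variable (K) in
/-- The operator form of `[[a, [a, [a, [a, [a, b]]]]], x] = 0`. -/
theorem quintic_relation (x : g) (h : ⁅⁅a, ⁅a, ⁅a, ⁅a, ⁅a, b⁆⁆⁆⁆⁆, x⁆ = 0) :
    ⁅a, ⁅a, ⁅a, ⁅a, ⁅a, ⁅b, x⁆⁆⁆⁆⁆⁆ - (5 : K) • ⁅a, ⁅a, ⁅a, ⁅a, ⁅b, ⁅a, x⁆⁆⁆⁆⁆⁆
      + (10 : K) • ⁅a, ⁅a, ⁅a, ⁅b, ⁅a, ⁅a, x⁆⁆⁆⁆⁆⁆ - (10 : K) • ⁅a, ⁅a, ⁅b, ⁅a, ⁅a, ⁅a, x⁆⁆⁆⁆⁆⁆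
      + (5 : K) • ⁅a, ⁅b, ⁅a, ⁅a, ⁅a, ⁅a, x⁆⁆⁆⁆⁆⁆ - ⁅b, ⁅a, ⁅a, ⁅a, ⁅a, ⁅a, x⁆⁆⁆⁆⁆⁆ = 0 := by
  rw [← h]
  simp only [lie_lie, lie_sub]
  module

/-- An element of a large component that is killed by the frame vanishes. -/
theorem Frame.eq_zero_of_killed (F : Frame 𝒜 a b) {n : ℕ} (hn : 1 ≤ n) {p q x z : g}
    (hp : p ∈ 𝒜 n) (hq : q ∈ 𝒜 n) (hx : x ∈ 𝒜 (n + 1)) (hz : z ∈ 𝒜 (n + 1))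
    (ha : ⁅a, z⁆ = 0) (hb : ⁅b, z⁆ = 0) (hs : 𝒜 (n + 1) ≤ Submodule.span K {x, z})
    (h : Indep K x z → Indep K p q) : z = 0 := by
  by_contra hz0
  -- Either two consecutive components are at least two-dimensional, or the component is the line
  -- through z, after which the algebra would stop.
  by_cases hi : Indep K x z
  · exact F.not_indep_indep hn hp hq hx hz (h hi) hi
  · obtain ⟨t, rfl⟩ := exists_eq_smul_of_not_indep hz0 hi
    refine F.not_le_span_of_killed (n := n + 1) (by omega) ha hb (hs.trans ?_)
    rw [Submodule.span_le]
    have hm := Submodule.mem_span_singleton_self (R := K) z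
    rintro y (rfl | rfl)
    exacts [Submodule.smul_mem _ _ hm, hm]

variable (K) in
/-- The brackets of `a, b` with eight consecutive basis vectors of `n_2`. -/
structure IsBlock (a b : g) (e : Fin 8 → g) : Prop where
  a0 : ⁅a, e 0⁆ = 0
  a1 : ⁅a, e 1⁆ = e 2
  a2 : ⁅a, e 2⁆ = e 3
  a3 : ⁅a, e 3⁆ = (-3 : K) • e 4
  a4 : ⁅a, e 4⁆ = (-2 : K) • e 5
  a5 : ⁅a, e 5⁆ = 0
  a6 : ⁅a, e 6⁆ = e 7
  b0 : ⁅b, e 0⁆ = -e 2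
  b1 : ⁅b, e 1⁆ = 0
  -- In the first block [b, e 2] is the vector z of n_2^3, which need not vanish. So only its
  -- brackets with a and b are required to be zero.
  ab2 : ⁅a, ⁅b, e 2⁆⁆ = 0
  bb2 : ⁅b, ⁅b, e 2⁆⁆ = 0
  b3 : ⁅b, e 3⁆ = 0
  b4 : ⁅b, e 4⁆ = e 6
  b5 : ⁅b, e 5⁆ = -e 7
  b6 : ⁅b, e 6⁆ = 0

/-- The degrees of eight consecutive basis vectors of `n_2`. -/
structure InDegree (𝒜 : ℕ → Submodule K g) (d : ℕ) (b : g) (e : Fin 8 → g) : Prop where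
  m0 : e 0 ∈ 𝒜 d
  m1 : e 1 ∈ 𝒜 d
  m2 : e 2 ∈ 𝒜 (d + 1)
  m3 : e 3 ∈ 𝒜 (d + 2)
  m4 : e 4 ∈ 𝒜 (d + 3)
  m5 : e 5 ∈ 𝒜 (d + 4)
  m6 : e 6 ∈ 𝒜 (d + 4)
  m7 : e 7 ∈ 𝒜 (d + 5)
  s0 : 𝒜 d ≤ Submodule.span K {e 0, e 1}
  s2 : 𝒜 (d + 1) ≤ Submodule.span K {e 2}
  s3 : 𝒜 (d + 2) ≤ Submodule.span K {e 3, ⁅b, e 2⁆}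
  s4 : 𝒜 (d + 3) ≤ Submodule.span K {e 4}
  s5 : 𝒜 (d + 4) ≤ Submodule.span K {e 5, e 6}
  s7 : 𝒜 (d + 5) ≤ Submodule.span K {e 7}

variable (K) in
/-- The vectors obtained from `p, q` in the way in which eight consecutive basis vectors of `n_2`
are obtained from the first two of them. -/
def block (a b p q : g) : Fin 8 → g :=
  let e4 := (-3 : K)⁻¹ • ⁅a, ⁅a, ⁅a, q⁆⁆⁆
  ![p, q, ⁅a, q⁆, ⁅a, ⁅a, q⁆⁆, e4, (-2 : K)⁻¹ • ⁅a, e4⁆, ⁅b, e4⁆, ⁅a, ⁅b, e4⁆⁆]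

variable (K) in
/-- The next eight vectors after the block `e`. -/
def nextBlock (a b : g) (e : Fin 8 → g) : Fin 8 → g :=
  block K a b (-⁅a, e 7⁆) ((2 : K)⁻¹ • ⁅b, e 7⁆)

variable (K) in
/-- The blocks of the images of the basis vectors of `n_2`. -/
def blocks (a b : g) : ℕ → Fin 8 → g
  | 0 => block K a b a b
  | m + 1 => nextBlock K a b (blocks a b m)

theorem lie_left_blocks_seven (a b : g) (m : ℕ) :
    ⁅a, blocks K a b m 7⁆ = -blocks K a b (m + 1) 0 := (neg_neg _).symm

/-- The memberships follow from the construction. The bounds on the components follow degree by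
degree from the table of brackets, which is closed up to the vector [b, e 2] killed by a and b. -/
theorem Frame.inDegree_block [GradedLieAlgebra 𝒜] (F : Frame 𝒜 a b) {p q : g} {d : ℕ} (hd : 1 ≤ d)
    (hp : p ∈ 𝒜 d) (hq : q ∈ 𝒜 d) (hs : 𝒜 d ≤ Submodule.span K {p, q})
    (h : IsBlock K a b (block K a b p q)) : InDegree 𝒜 d b (block K a b p q) := by
  set e := block K a b p q
  have m0 : e 0 ∈ 𝒜 d := hp
  have m1 : e 1 ∈ 𝒜 d := hq
  have m2 : e 2 ∈ 𝒜 (d + 1) := F.lie_left_mem m1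
  have m3 : e 3 ∈ 𝒜 (d + 2) := F.lie_left_mem m2
  have m4 : e 4 ∈ 𝒜 (d + 3) := Submodule.smul_mem _ _ (F.lie_left_mem m3)
  have m5 : e 5 ∈ 𝒜 (d + 4) := Submodule.smul_mem _ _ (F.lie_left_mem m4)
  have m6 : e 6 ∈ 𝒜 (d + 4) := F.lie_right_mem m4
  have m7 : e 7 ∈ 𝒜 (d + 5) := F.lie_left_mem m6
  have s2 : 𝒜 (d + 1) ≤ Submodule.span K {e 2} := by
    have hm := Submodule.mem_span_singleton_self (R := K) (e 2)
    refine F.succ_le hd hs ?_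
    rintro x (hx | hx) <;> rw [hx]
    · rw [show p = e 0 from rfl, h.a0, h.b0]
      exact ⟨zero_mem _, neg_mem hm⟩
    · rw [show q = e 1 from rfl, h.a1, h.b1]
      exact ⟨hm, zero_mem _⟩
  have s3 : 𝒜 (d + 2) ≤ Submodule.span K {e 3, ⁅b, e 2⁆} := by
    refine F.succ_le (by omega) s2 ?_
    rintro x rfl
    rw [h.a2]
    exact ⟨Submodule.subset_span (by simp), Submodule.subset_span (by simp)⟩
  have s4 : 𝒜 (d + 3) ≤ Submodule.span K {e 4} := by
    have hm := Submodule.mem_span_singleton_self (R := K) (e 4)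
    refine F.succ_le (by omega) s3 ?_
    rintro x (hx | hx) <;> rw [hx]
    · rw [h.a3, h.b3]
      exact ⟨Submodule.smul_mem _ _ hm, zero_mem _⟩
    · rw [h.ab2, h.bb2]
      exact ⟨zero_mem _, zero_mem _⟩
  have s5 : 𝒜 (d + 4) ≤ Submodule.span K {e 5, e 6} := by
    refine F.succ_le (by omega) s4 ?_
    rintro x rfl
    rw [h.a4, h.b4]
    exact ⟨Submodule.smul_mem _ _ (Submodule.subset_span (by simp)),
      Submodule.subset_span (by simp)⟩
  have s7 : 𝒜 (d + 5) ≤ Submodule.span K {e 7} := by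
    have hm := Submodule.mem_span_singleton_self (R := K) (e 7)
    refine F.succ_le (by omega) s5 ?_
    rintro x (hx | hx) <;> rw [hx]
    · rw [h.a5, h.b5]
      exact ⟨zero_mem _, neg_mem hm⟩
    · rw [h.a6, h.b6]
      exact ⟨hm, zero_mem _⟩
  exact ⟨m0, m1, m2, m3, m4, m5, m6, m7, hs, s2, s3, s4, s5, s7⟩

variable [CharZero K]

/-- Some brackets of the new block f hold by its definition. The others follow by evaluating the
cubic relation (ad [b,[b,a]] = 0) or the quintic relation ((ad a)^5 b = 0) at a suitable earlier
vector, where it collapses to a nonzero multiple of the desired identity. The single exception is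
[b, f 5] = -f 7, which also needs the dimension bound. -/
theorem Frame.isBlock_nextBlock [GradedLieAlgebra 𝒜] (F : Frame 𝒜 a b) {e : Fin 8 → g} {d : ℕ}
    (hcub : ∀ x : g, ⁅⁅b, ⁅b, a⁆⁆, x⁆ = 0) (hquin : ⁅a, ⁅a, ⁅a, ⁅a, ⁅a, b⁆⁆⁆⁆⁆ = 0)
    (he : IsBlock K a b e) (hd : InDegree 𝒜 d b e) :
    IsBlock K a b (nextBlock K a b e) ∧ ⁅b, nextBlock K a b e 2⁆ = 0 ∧
      InDegree 𝒜 (d + 6) b (nextBlock K a b e) := by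
  have n3 : (-3 : K) ≠ 0 := by norm_num
  have n2 : (-2 : K) ≠ 0 := by norm_num
  have hc := fun x => cubic_relation K (a := a) (b := b) x (hcub x)
  have hq := fun x => quintic_relation K (a := a) (b := b) x (by rw [hquin, zero_lie])
  set f := nextBlock K a b e with hf
  have ea7 : ⁅a, e 7⁆ = -f 0 := (neg_neg _).symm
  have eb7 : ⁅b, e 7⁆ = (2 : K) • f 1 := (smul_inv_smul₀ two_ne_zero _).symm
  have fa1 : ⁅a, f 1⁆ = f 2 := rfl
  have fa2 : ⁅a, f 2⁆ = f 3 := rfl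
  have fa3 : ⁅a, f 3⁆ = (-3 : K) • f 4 := (smul_inv_smul₀ n3 _).symm
  have fa4 : ⁅a, f 4⁆ = (-2 : K) • f 5 := (smul_inv_smul₀ n2 _).symm
  have fb4 : ⁅b, f 4⁆ = f 6 := rfl
  have fa6 : ⁅a, f 6⁆ = f 7 := rfl
  have cancel : ∀ (t : K) {x : g}, t ≠ 0 → t • x = 0 → x = 0 := fun t x ht h =>
    (smul_eq_zero.1 h).resolve_left ht
  have fa0 : ⁅a, f 0⁆ = 0 := by
    have := hq (e 2)
    simp only [he.a2, he.a3, he.a4, he.a5, he.b3, he.b4, he.b5, he.a6, he.ab2, ea7, lie_smul,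
      lie_neg, lie_zero] at this
    refine cancel (-30) (by norm_num) ?_
    rw [← this]
    module
  have fb1 : ⁅b, f 1⁆ = 0 := by
    have := hc (e 6)
    simp only [he.a6, he.b6, eb7, lie_smul, lie_zero] at this
    refine cancel 2 (by norm_num) ?_
    rw [← this]
    module
  have fb0 : ⁅b, f 0⁆ = -f 2 := by
    have := hc (e 5)
    simp only [he.a5, he.b5, ea7, eb7, fa1, lie_smul, lie_neg, lie_zero] at this
    rw [← add_eq_zero_iff_eq_neg]
    refine cancel (-2) (by norm_num) ?_
    rw [← this]
    module
  have fb2 : ⁅b, f 2⁆ = 0 := by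
    have := hc (e 7)
    simp only [ea7, eb7, fa1, fb0, fb1, lie_smul, lie_neg, lie_zero] at this
    refine cancel (-3) (by norm_num) ?_
    rw [← this]
    module
  have fb3 : ⁅b, f 3⁆ = 0 := by
    have := hc (f 0)
    simp only [fa0, fb0, fa2, fb2, lie_neg, lie_zero] at this
    refine cancel 2 (by norm_num) ?_
    rw [← this]
    module
  have fa5 : ⁅a, f 5⁆ = 0 := by
    have := hq (e 7)
    simp only [ea7, eb7, fa0, fa1, fa2, fa3, fa4, fb0, lie_smul, lie_neg, lie_zero] at this
    refine cancel (-18) (by norm_num) ?_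
    rw [← this]
    module
  have fb6 : ⁅b, f 6⁆ = 0 := by
    have := hc (f 3)
    simp only [fa3, fb3, fb4, lie_smul, lie_zero] at this
    refine cancel (-3) (by norm_num) ?_
    rw [← this]
    module
  have m0 : f 0 ∈ 𝒜 (d + 6) := neg_mem (F.lie_left_mem hd.m7)
  have m1 : f 1 ∈ 𝒜 (d + 6) := Submodule.smul_mem _ _ (F.lie_right_mem hd.m7)
  have m2 : f 2 ∈ 𝒜 (d + 7) := F.lie_left_mem m1
  have m3 : f 3 ∈ 𝒜 (d + 8) := F.lie_left_mem m2
  have m4 : f 4 ∈ 𝒜 (d + 9) := Submodule.smul_mem _ _ (F.lie_left_mem m3)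
  have m5 : f 5 ∈ 𝒜 (d + 10) := Submodule.smul_mem _ _ (F.lie_left_mem m4)
  have m6 : f 6 ∈ 𝒜 (d + 10) := F.lie_right_mem m4
  have s0 : 𝒜 (d + 6) ≤ Submodule.span K {f 0, f 1} := by
    refine F.succ_le (by omega) hd.s7 ?_
    rintro x rfl
    rw [ea7, eb7]
    exact ⟨neg_mem (Submodule.subset_span (by simp)),
      Submodule.smul_mem _ _ (Submodule.subset_span (by simp))⟩
  have s2 : 𝒜 (d + 7) ≤ Submodule.span K {f 2} := by
    have hm := Submodule.mem_span_singleton_self (R := K) (f 2)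
    refine F.succ_le (by omega) s0 ?_
    rintro x (hx | hx) <;> rw [hx]
    · rw [fa0, fb0]
      exact ⟨zero_mem _, neg_mem hm⟩
    · rw [fa1, fb1]
      exact ⟨hm, zero_mem _⟩
  have s3 : 𝒜 (d + 8) ≤ Submodule.span K {f 3} := by
    refine F.succ_le (by omega) s2 ?_
    rintro x rfl
    rw [fa2, fb2]
    exact ⟨Submodule.mem_span_singleton_self _, zero_mem _⟩
  have s4 : 𝒜 (d + 9) ≤ Submodule.span K {f 4} := by
    refine F.succ_le (by omega) s3 ?_
    rintro x rfl
    rw [fa3, fb3]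
    exact ⟨Submodule.smul_mem _ _ (Submodule.mem_span_singleton_self _), zero_mem _⟩
  have s5 : 𝒜 (d + 10) ≤ Submodule.span K {f 5, f 6} := by
    refine F.succ_le (by omega) s4 ?_
    rintro x rfl
    rw [fa4, fb4]
    exact ⟨Submodule.smul_mem _ _ (Submodule.subset_span (by simp)),
      Submodule.subset_span (by simp)⟩
  -- The relations only show that this sum is killed by a (quintic at f 1) and by b (cubic at f 4).
  -- If it were not zero, it would either span its component or be independent of f 7, and then f 5,
  -- f 6 would be independent one degree below.
  have fb5 : f 7 + ⁅b, f 5⁆ = 0 := by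
    refine F.eq_zero_of_killed (n := d + 10) (by omega) m5 m6 (x := f 7) (F.lie_left_mem m6)
      (add_mem (F.lie_left_mem m6) (F.lie_right_mem m5)) ?_ ?_ ?_ ?_
    · have := hq (f 1)
      simp only [fa1, fa2, fa3, fa4, fa5, fb1, fb2, fb3, fb4, fa6, lie_smul, lie_zero] at this
      refine cancel 30 (by norm_num) ?_
      rw [lie_add, ← this]
      module
    · have := hc (f 4)
      simp only [fa4, fb4, fa6, fb6, lie_smul, lie_zero] at this
      refine cancel (-2) (by norm_num) ?_
      rw [lie_add, ← this]
      module
    · refine F.succ_le (by omega) s5 ?_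
      rintro x (hx | hx) <;> rw [hx]
      · rw [fa5]
        exact ⟨zero_mem _, Submodule.mem_span_pair.2 ⟨-1, 1, by module⟩⟩
      · rw [fa6, fb6]
        exact ⟨Submodule.subset_span (by simp), zero_mem _⟩
    · intro hi s t hst
      have h1 : t • f 7 = 0 := by
        have := congrArg (fun x => ⁅a, x⁆) hst
        simpa [fa5, fa6] using this
      have h2 : s • ⁅b, f 5⁆ = 0 := by
        have := congrArg (fun x => ⁅b, x⁆) hst
        simpa [fb6] using this
      have h3 := hi (t - s) s (by linear_combination (norm := module) h1 + h2)
      exact ⟨h3.2, by simpa [h3.2] using h3.1⟩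
  have hB : IsBlock K a b f := ⟨fa0, fa1, fa2, fa3, fa4, fa5, fa6, fb0, fb1, by rw [fb2, lie_zero],
    by rw [fb2, lie_zero], fb3, fb4, (neg_eq_of_add_eq_zero_right fb5).symm, fb6⟩
  exact ⟨hB, fb2, F.inDegree_block (by omega) m0 m1 s0 hB⟩

theorem Frame.isBlock_first [GradedLieAlgebra 𝒜] (F : Frame 𝒜 a b) (h : Killed a b 2)
    (h5 : chain a b 5 = 0) : IsBlock K a b (block K a b a b) ∧
      InDegree 𝒜 1 b (block K a b a b) := by
  have n3 : (-3 : K) ≠ 0 := by norm_num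
  have n2 : (-2 : K) ≠ 0 := by norm_num
  set e := block K a b a b with he
  -- This is [b, x_4] = 2 [a,[b, x_3]], the source of the entry [b, e 5] = -e 7.
  have h4 := h.lie_chain_add_four (K := K) (m := 0) 0 4 rfl
  have hB : IsBlock K a b e :=
    { a0 := lie_self a
      a1 := rfl
      a2 := rfl
      a3 := (smul_inv_smul₀ n3 _).symm
      a4 := (smul_inv_smul₀ n2 _).symm
      a5 := by
        change ⁅a, (-2 : K)⁻¹ • ⁅a, (-3 : K)⁻¹ • chain a b 3⁆⁆ = 0
        rw [lie_smul, lie_smul, lie_smul, ← chain_succ, ← chain_succ, h5, smul_zero, smul_zero]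
      a6 := rfl
      b0 := (lie_skew b a).symm
      b1 := lie_self b
      ab2 := (h 1 (by norm_num)).1
      bb2 := (h 1 (by norm_num)).2
      b3 := h.lie_even K 1 (by norm_num)
      b4 := rfl
      b5 := by
        change ⁅b, (-2 : K)⁻¹ • ⁅a, (-3 : K)⁻¹ • chain a b 3⁆⁆ =
          -⁅a, ⁅b, (-3 : K)⁻¹ • chain a b 3⁆⁆
        rw [chain_zero] at h4
        simp only [lie_smul, ← chain_succ, h4, smul_smul]
        rw [← neg_smul]
        congr 1
        norm_num
      b6 := by
        change ⁅b, ⁅b, (-3 : K)⁻¹ • chain a b 3⁆⁆ = 0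
        rw [lie_smul, lie_smul, F.lie_lie_chain_odd (m := 0) h, smul_zero] }
  exact ⟨hB, F.inDegree_block le_rfl F.left_mem F.right_mem F.span_eq.le hB⟩

theorem Frame.blocks_spec [GradedLieAlgebra 𝒜] (F : Frame 𝒜 a b) (h : Killed a b 2)
    (h5 : chain a b 5 = 0) (m : ℕ) : IsBlock K a b (blocks K a b m) ∧
      InDegree 𝒜 (6 * m + 1) b (blocks K a b m) := by
  induction m with
  | zero => exact F.isBlock_first h h5
  | succ m ih =>
    have hcub : ∀ x : g, ⁅⁅b, ⁅b, a⁆⁆, x⁆ = 0 := fun x => by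
      rw [← lie_skew b a, lie_neg, neg_lie, ← lie_skew, neg_neg]
      exact F.lie_eq_zero_of_killed (h 1 (by norm_num)).1 (h 1 (by norm_num)).2 x
    have := F.isBlock_nextBlock hcub h5 ih.1 ih.2
    exact ⟨this.1, this.2.2⟩

/-- The cubic relation at the last vector of the preceding block forces this. The first block has no
predecessor, which is why an exceptional central vector can occur only there. -/
theorem Frame.lie_blocks_succ_two [GradedLieAlgebra 𝒜] (F : Frame 𝒜 a b) (h : Killed a b 2)
    (h5 : chain a b 5 = 0) (m : ℕ) : ⁅b, blocks K a b (m + 1) 2⁆ = 0 := by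
  have hcub : ∀ x : g, ⁅⁅b, ⁅b, a⁆⁆, x⁆ = 0 := fun x => by
    rw [← lie_skew b a, lie_neg, neg_lie, ← lie_skew, neg_neg]
    exact F.lie_eq_zero_of_killed (h 1 (by norm_num)).1 (h 1 (by norm_num)).2 x
  have := F.blocks_spec h h5 m
  exact (F.isBlock_nextBlock hcub h5 this.1 this.2).2.1

theorem lie_right_blocks_seven (a b : g) (m : ℕ) :
    ⁅b, blocks K a b m 7⁆ = (2 : K) • blocks K a b (m + 1) 1 :=
  (smul_inv_smul₀ two_ne_zero _).symm

end Blocks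


/-! ### The nondegenerate case: brackets of a loop algebra -/

section Loops

variable {K : Type*} [Field K] {g : Type*} [LieRing g] [LieAlgebra K g]
variable {𝒜 : ℕ → Submodule K g} {a b : g}

/-- The images of `u ⊗ t^(2k+1)` and `v ⊗ t^(2k+1)`. -/
def loopUV (ε : K) (a b : g) : ℕ → g × g
  | 0 => (a, b)
  | k + 1 => (ε⁻¹ • ⁅b, ⁅a, (loopUV ε a b k).2⁆⁆, -⁅a, ⁅a, (loopUV ε a b k).2⁆⁆)

/-- The images of the monomials `u ⊗ t^(2k+1)`, `v ⊗ t^(2k+1)`, `w ⊗ t^(2k+2)`. -/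
def loopVec (ε : K) (a b : g) (k : ℕ) : Fin 3 → g :=
  ![(loopUV ε a b k).1, (loopUV ε a b k).2, ⁅a, (loopUV ε a b k).2⁆]

variable {ε : K}

theorem lie_left_loopVec_one (k : ℕ) : ⁅a, loopVec ε a b k 1⁆ = loopVec ε a b k 2 := rfl

theorem lie_left_loopVec_two (k : ℕ) : ⁅a, loopVec ε a b k 2⁆ = -loopVec ε a b (k + 1) 1 :=
  (neg_neg _).symm

theorem lie_right_loopVec_two (hε : ε ≠ 0) (k : ℕ) :
    ⁅b, loopVec ε a b k 2⁆ = ε • loopVec ε a b (k + 1) 0 := (smul_inv_smul₀ hε _).symm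

/-- The brackets and degrees of the images of the monomials with given `k`. -/
structure IsLoop (𝒜 : ℕ → Submodule K g) (a b : g) (n : ℕ) (e : Fin 3 → g) : Prop where
  a0 : ⁅a, e 0⁆ = 0
  a1 : ⁅a, e 1⁆ = e 2
  b0 : ⁅b, e 0⁆ = -e 2
  b1 : ⁅b, e 1⁆ = 0
  m0 : e 0 ∈ 𝒜 n
  m1 : e 1 ∈ 𝒜 n
  m2 : e 2 ∈ 𝒜 (n + 1)
  s2 : 𝒜 (n + 1) ≤ Submodule.span K {e 2}

variable [CharZero K] [GradedLieAlgebra 𝒜]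

/-- The adjoint actions of the two degree-four relations are applied to vectors already understood.
They reach two levels up, so the induction carries two consecutive values of k. They leave one
unknown, [a, f 0], which the dimension bound removes. -/
theorem Frame.isLoop (F : Frame 𝒜 a b) (hε : ε ≠ 0)
    (h1 : ⁅a, ⁅b, ⁅a, b⁆⁆⁆ = 0) (h2 : ⁅b, ⁅b, ⁅a, b⁆⁆⁆ = ε • ⁅a, ⁅a, ⁅a, b⁆⁆⁆) (k : ℕ) :
    IsLoop 𝒜 a b (2 * k + 1) (loopVec ε a b k) := by
  have cancel : ∀ (t : K) {x : g}, t ≠ 0 → t • x = 0 → x = 0 := fun t x ht h =>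
    (smul_eq_zero.1 h).resolve_left ht
  have r1 : ∀ x : g, ⁅⁅a, ⁅b, ⁅a, b⁆⁆⁆, x⁆ = 0 := fun x => by rw [h1, zero_lie]
  have r2 : ∀ x : g, ⁅⁅b, ⁅b, ⁅a, b⁆⁆⁆, x⁆ - ε • ⁅⁅a, ⁅a, ⁅a, b⁆⁆⁆, x⁆ = 0 := fun x => by
    rw [h2, smul_lie, sub_self]
  have mem : ∀ {n : ℕ} {e f : Fin 3 → g}, IsLoop 𝒜 a b n e → ⁅a, e 2⁆ = -f 1 →
      ⁅b, e 2⁆ = ε • f 0 → f 0 ∈ 𝒜 (n + 2) ∧ f 1 ∈ 𝒜 (n + 2) ∧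
        𝒜 (n + 2) ≤ Submodule.span K {f 0, f 1} := by
    intro n e f he ha hb
    refine ⟨?_, ?_, F.succ_le (by omega) he.s2 ?_⟩
    · rw [← inv_smul_smul₀ hε (f 0), ← hb]
      exact Submodule.smul_mem _ _ (F.lie_right_mem he.m2)
    · rw [← neg_neg (f 1), ← ha]
      exact neg_mem (F.lie_left_mem he.m2)
    · rintro x rfl
      rw [ha, hb]
      exact ⟨neg_mem (Submodule.subset_span (by simp)),
        Submodule.smul_mem _ _ (Submodule.subset_span (by simp))⟩
  have finish : ∀ {n : ℕ} {f : Fin 3 → g}, 1 ≤ n → f 0 ∈ 𝒜 n → f 1 ∈ 𝒜 n →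
      𝒜 n ≤ Submodule.span K {f 0, f 1} → ⁅a, f 0⁆ = 0 → ⁅a, f 1⁆ = f 2 → ⁅b, f 0⁆ = -f 2 →
      ⁅b, f 1⁆ = 0 → IsLoop 𝒜 a b n f := by
    intro n f hn m0 m1 s a0 a1 b0 b1
    have hm := Submodule.mem_span_singleton_self (R := K) (f 2)
    refine ⟨a0, a1, b0, b1, m0, m1, a1 ▸ F.lie_left_mem m1, F.succ_le hn s ?_⟩
    rintro x (hx | hx) <;> rw [hx]
    · rw [a0, b0]
      exact ⟨zero_mem _, neg_mem hm⟩
    · rw [a1, b1]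
      exact ⟨hm, zero_mem _⟩
  have zero : IsLoop 𝒜 a b 1 (loopVec ε a b 0) :=
    finish le_rfl F.left_mem F.right_mem F.span_eq.le (lie_self a) rfl (lie_skew b a).symm
      (lie_self b)
  have one : IsLoop 𝒜 a b 3 (loopVec ε a b 1) := by
    obtain ⟨m0, m1, s⟩ := mem zero (lie_left_loopVec_two 0) (lie_right_loopVec_two hε 0)
    refine finish (by norm_num) m0 m1 s ?_ rfl ?_ ?_
    · change ⁅a, ε⁻¹ • ⁅b, ⁅a, b⁆⁆⁆ = 0
      rw [lie_smul, h1, smul_zero]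
    · change ⁅b, ε⁻¹ • ⁅b, ⁅a, b⁆⁆⁆ = -⁅a, -⁅a, ⁅a, b⁆⁆⁆
      rw [lie_smul, h2, inv_smul_smul₀ hε, lie_neg, neg_neg]
    · change ⁅b, -⁅a, ⁅a, b⁆⁆⁆ = 0
      rw [lie_neg, lie_lie_comm, h1, neg_zero]
  have step : ∀ k, IsLoop 𝒜 a b (2 * k + 1) (loopVec ε a b k) ∧
      IsLoop 𝒜 a b (2 * k + 3) (loopVec ε a b (k + 1)) := by
    intro k
    induction k with
    | zero => exact ⟨zero, one⟩
    | succ k ih =>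
      refine ⟨ih.2, ?_⟩
      obtain ⟨-, ih⟩ := ih
      have da := lie_left_loopVec_two (ε := ε) (a := a) (b := b) k
      have db := lie_right_loopVec_two (a := a) (b := b) hε k
      have ea := lie_left_loopVec_two (ε := ε) (a := a) (b := b) (k + 1)
      have eb := lie_right_loopVec_two (a := a) (b := b) hε (k + 1)
      have fa := lie_left_loopVec_one (ε := ε) (a := a) (b := b) (k + 2)
      obtain ⟨m0, m1, s⟩ := mem ih ea eb
      obtain ⟨a0, a1, b0, b1, -, -, -, -⟩ := id ih
      generalize loopVec ε a b k = d at *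
      generalize loopVec ε a b (k + 1) = e at *
      generalize loopVec ε a b (k + 2) = f at *
      have hb0 : ⁅b, f 0⁆ = -f 2 := by
        have := r1 (d 2)
        simp only [lie_lie, lie_sub, da, db, a0, a1, b0, b1, ea, eb, fa, lie_neg, lie_smul,
          lie_zero] at this
        rw [← add_eq_zero_iff_eq_neg]
        refine cancel ε hε ?_
        rw [← neg_eq_zero, ← this]
        module
      have hb1 : ⁅b, f 1⁆ = ε • ⁅a, f 0⁆ := by
        have := r2 (d 2)
        simp only [lie_lie, lie_sub, da, db, a0, a1, b0, b1, ea, eb, lie_neg, lie_smul,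
          lie_zero] at this
        rw [← sub_eq_zero]
        refine cancel (-2 * ε) (by simpa using hε) ?_
        rw [← this]
        module
      -- The relation [a,[b,[a,b]]] = 0, applied to e 0 and e 1, shows that this vector is killed by
      -- a and by b. If it were independent of f 2 = [a, f 1], then f 0 and f 1 would be independent
      -- as well.
      have hp : ⁅a, f 0⁆ = 0 := by
        refine F.eq_zero_of_killed (n := 2 * (k + 1) + 3) (by omega) m0 m1 (x := f 2)
          (fa ▸ F.lie_left_mem m1) (F.lie_left_mem m0) ?_ ?_ ?_ ?_
        · have := r1 (e 0)
          simp only [lie_lie, lie_sub, a0, b0, ea, eb, hb1, lie_neg, lie_smul,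
            lie_zero] at this
          refine cancel (3 * ε) (by simpa using hε) ?_
          rw [← this]
          module
        · have := r1 (e 1)
          simp only [lie_lie, lie_sub, a1, b1, ea, eb, hb0, hb1, lie_neg, lie_smul,
            lie_zero] at this
          refine cancel (-3 * ε) (by simpa using hε) ?_
          rw [← this]
          module
        · refine F.succ_le (by omega) s ?_
          rintro x (hx | hx) <;> rw [hx]
          · rw [hb0]
            exact ⟨Submodule.subset_span (by simp),
              neg_mem (Submodule.subset_span (by simp))⟩
          · rw [fa, hb1]
            exact ⟨Submodule.subset_span (by simp),
              Submodule.smul_mem _ _ (Submodule.subset_span (by simp))⟩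
        · intro hi s t hst
          have := congrArg (fun x => ⁅a, x⁆) hst
          simp only [lie_add, lie_smul, fa, lie_zero] at this
          exact (hi t s (by rw [add_comm]; exact this)).symm
      exact finish (by omega) m0 m1 s hp fa hb0 (by rw [hb1, hp, smul_zero])
  exact (step k).1

end Loops


/-! ### Isomorphisms -/

section Iso

variable {K : Type*} [Field K] {g : Type*} [LieRing g] [LieAlgebra K g]
variable {𝒜 : ℕ → Submodule K g} {a b : g}

/-- Homogeneous vectors are linearly independent if each of them is separated by a subspace from
the others of the same degree. -/
theorem linearIndependent_of_degree [DirectSum.Decomposition 𝒜] {ι : Type*} {E : ι → g}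
    {deg : ι → ℕ} (hE : ∀ i, E i ∈ 𝒜 (deg i))
    (h : ∀ i, ∃ p : Submodule K g, E i ∉ p ∧ ∀ k, k ≠ i → deg k = deg i → E k ∈ p) :
    LinearIndependent K E := by
  classical
  rw [linearIndependent_iff']
  intro s l hl i hi
  obtain ⟨p, hp, hk⟩ := h i
  -- Projecting to the degree of E i leaves only vectors of that degree, and all of them but E i lie
  -- in p.
  have h1 := congrArg (fun x => ((DirectSum.decompose 𝒜 x (deg i) : 𝒜 (deg i)) : g)) hl
  simp only [DirectSum.decompose_sum, DirectSum.decompose_smul, DirectSum.decompose_zero] at h1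
  have h2 : ∑ k ∈ s, (if deg k = deg i then l k • E k else 0) = 0 := by
    rw [DFinsupp.finsetSum_apply] at h1
    simp only [AddSubmonoidClass.coe_finsetSum, DirectSum.smul_apply, Submodule.coe_smul,
      DirectSum.zero_apply, ZeroMemClass.coe_zero] at h1
    refine Eq.trans (Finset.sum_congr rfl fun k _ => ?_) h1
    split_ifs with hd
    · rw [← hd, DirectSum.decompose_of_mem_same 𝒜 (hE k)]
    · rw [DirectSum.decompose_of_mem_ne 𝒜 (hE k) hd, smul_zero]
  rw [← Finset.add_sum_erase _ _ hi, if_pos rfl] at h2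
  have h3 : l i • E i ∈ p := by
    rw [eq_neg_of_add_eq_zero_left h2]
    refine neg_mem (sum_mem fun k hks => ?_)
    split_ifs with hd
    · exact p.smul_mem _ (hk k (Finset.ne_of_mem_erase hks) hd)
    · exact zero_mem _
  by_contra hli
  exact hp ((Submodule.smul_mem_iff _ hli).1 h3)

variable {L : Type*} [LieRing L] [LieAlgebra K L] {ι : Type*}

/-- A linear map that respects the brackets with two generators is a homomorphism. -/
theorem map_lie_of_generators (B : Module.Basis ι K L) (φ : L →ₗ[K] g) {x y : L}
    (hgen : ∀ H : LieSubalgebra K L, x ∈ H → y ∈ H → ∀ i, B i ∈ H)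
    (hx : ∀ i, φ ⁅x, B i⁆ = ⁅φ x, φ (B i)⁆) (hy : ∀ i, φ ⁅y, B i⁆ = ⁅φ y, φ (B i)⁆) (u v : L) :
    φ ⁅u, v⁆ = ⁅φ u, φ v⁆ := by
  -- The u for which φ respects every bracket [u, v] form a subalgebra by the Jacobi identity.
  let H : LieSubalgebra K L :=
    { carrier := {u | ∀ v, φ ⁅u, v⁆ = ⁅φ u, φ v⁆}
      add_mem' := fun {u u'} h h' v => by
        rw [add_lie, map_add, h v, h' v, map_add, add_lie]
      zero_mem' := fun v => by simp
      smul_mem' := fun t u h v => by rw [smul_lie, map_smul, h v, map_smul, smul_lie]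
      lie_mem' := fun {u u'} h h' v => by
        change ∀ v, φ ⁅u, v⁆ = ⁅φ u, φ v⁆ at h
        change ∀ v, φ ⁅u', v⁆ = ⁅φ u', φ v⁆ at h'
        rw [lie_lie, map_sub, h, h', h', h, h, lie_lie] }
  have ext : ∀ x : L, (∀ i, φ ⁅x, B i⁆ = ⁅φ x, φ (B i)⁆) → x ∈ H := by
    intro x hx v
    have : φ ∘ₗ (LieModule.toEnd K L L x : L →ₗ[K] L)
        = (LieModule.toEnd K g g (φ x) : g →ₗ[K] g) ∘ₗ φ :=
      B.ext fun i => by simpa using hx i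
    simpa using LinearMap.congr_fun this v
  have hH := hgen H (ext x hx) (ext y hy)
  have top : H.toSubmodule = ⊤ := by
    rw [eq_top_iff, ← B.span_eq, Submodule.span_le]
    rintro _ ⟨i, rfl⟩
    exact hH i
  exact (top ▸ Submodule.mem_top : u ∈ H.toSubmodule) v

theorem nonempty_lieEquiv_of_generators (B : Module.Basis ι K L) (φ : L ≃ₗ[K] g) {x y : L}
    (hgen : ∀ H : LieSubalgebra K L, x ∈ H → y ∈ H → ∀ i, B i ∈ H)
    (hx : ∀ i, φ ⁅x, B i⁆ = ⁅φ x, φ (B i)⁆) (hy : ∀ i, φ ⁅y, B i⁆ = ⁅φ y, φ (B i)⁆) :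
    Nonempty (g ≃ₗ⁅K⁆ L) := by
  let f : L ≃ₗ⁅K⁆ g :=
    { φ with map_lie' := fun {u v} => map_lie_of_generators B (φ : L →ₗ[K] g) hgen hx hy u v }
  exact ⟨f.symm⟩

/-- The criterion for an isomorphism with a narrow Lie algebra. -/
theorem Frame.nonempty_lieEquiv [DirectSum.Decomposition 𝒜] (F : Frame 𝒜 a b)
    (B : Module.Basis ι K L) {E : ι → g} (hE : LinearIndependent K E) {p q : ι} (hp : E p = a)
    (hq : E q = b) (hgen : ∀ H : LieSubalgebra K L, B p ∈ H → B q ∈ H → ∀ i, B i ∈ H)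
    (ha : ∀ i, B.constr K E ⁅B p, B i⁆ = ⁅a, E i⁆)
    (hb : ∀ i, B.constr K E ⁅B q, B i⁆ = ⁅b, E i⁆) : Nonempty (g ≃ₗ⁅K⁆ L) := by
  set φ : L →ₗ[K] g := B.constr K E with hφ
  have hφB : ∀ i, φ (B i) = E i := fun i => B.constr_basis K E i
  have hx : ∀ i, φ ⁅B p, B i⁆ = ⁅φ (B p), φ (B i)⁆ := fun i => by rw [hφB, hφB, hp, ha]
  have hy : ∀ i, φ ⁅B q, B i⁆ = ⁅φ (B q), φ (B i)⁆ := fun i => by rw [hφB, hφB, hq, hb]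
  have inj : Function.Injective φ := by
    rw [← LinearMap.ker_eq_bot, LinearMap.ker_eq_bot']
    intro x hx
    rw [hφ, Module.Basis.constr_apply] at hx
    have := (linearIndependent_iff.1 hE) (B.repr x) hx
    simpa using this
  let f : L →ₗ⁅K⁆ g := { φ with map_lie' := fun {u v} => map_lie_of_generators B φ hgen hx hy u v }
  -- The range is a subalgebra that contains a and b.
  have surj : Function.Surjective φ := by
    intro x
    exact (f.mem_range _).1 (F.eq_top_of_mem ((f.mem_range _).2 ⟨B p, (hφB p).trans hp⟩)
      ((f.mem_range _).2 ⟨B q, (hφB q).trans hq⟩) x)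
  exact nonempty_lieEquiv_of_generators B (LinearEquiv.ofBijective φ ⟨inj, surj⟩) hgen hx hy

/-- The vector with given coordinates in a Lie algebra given by structure constants. -/
def LieConstants.of (s : LieConstants K ι) : (ι →₀ K) ≃ₗ[K] s.Algebra :=
  LinearEquiv.refl K (ι →₀ K)

theorem LieConstants.of_single (s : LieConstants K ι) (i : ι) (t : K) :
    s.of (Finsupp.single i t) = t • s.e i := by
  have : s.e i = s.of (Finsupp.single i 1) := rfl
  rw [this, ← map_smul, Finsupp.smul_single_one]

theorem LieConstants.lie_e_eq_of (s : LieConstants K ι) (i j : ι) :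
    ⁅s.e i, s.e j⁆ = s.of (s.c i j) := s.lie_e i j

/-- The basis vectors of a Lie algebra given by structure constants form a basis. -/
def LieConstants.basis (s : LieConstants K ι) : Module.Basis ι K s.Algebra :=
  Module.Basis.ofRepr s.of.symm

theorem LieConstants.basis_apply (s : LieConstants K ι) (i : ι) : s.basis i = s.e i := rfl

theorem LieConstants.constr_lie (s : LieConstants K ι) (E : ι → g) (i j : ι) :
    s.basis.constr K E ⁅s.basis i, s.basis j⁆ = Finsupp.linearCombination K E (s.c i j) := by
  rw [s.basis_apply, s.basis_apply, s.lie_e_eq_of, Module.Basis.constr_apply]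
  simp [LieConstants.basis, Finsupp.linearCombination_apply]

end Iso

/-! ### The case of central brackets: m_0 and m_0^S -/

section FiliformModel

variable {K : Type*} [Field K] {g : Type*} [LieRing g] [LieAlgebra K g]
variable {𝒜 : ℕ → Submodule K g} {a b : g}

/-- The images of the basis vectors `e_1, e_2, …` of `m_0`. -/
def filSeq (a b : g) : ℕ → g
  | 0 => a
  | n + 1 => chain a b n

theorem exists_succPNat (n : ℕ+) : ∃ k : ℕ, n = k.succPNat := ⟨n.natPred, n.succPNat_natPred.symm⟩

theorem one_eq_succPNat : (1 : ℕ+) = Nat.succPNat 0 := rfl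

theorem two_eq_succPNat : (2 : ℕ+) = Nat.succPNat 1 := rfl

theorem succPNat_add (m n : ℕ) : m.succPNat + n.succPNat = (m + n + 1).succPNat :=
  PNat.eq (by simp only [PNat.add_coe, Nat.succPNat_coe]; omega)

theorem succPNat_eq_one_iff (n : ℕ) : n.succPNat = 1 ↔ n = 0 := by
  rw [one_eq_succPNat, Nat.succPNat_inj]

/-- The integers `r` for which `[b, x]` does not vanish in degree `r`. -/
def centralDegrees (a b : g) : Set ℕ := {r | 3 ≤ r ∧ ⁅b, chain a b (r - 2)⁆ ≠ 0}

/-- The vector z_{r-2} has degree r, and z with even index vanishes. -/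
theorem odd_of_mem_centralDegrees (K : Type*) [Field K] {g : Type*} [LieRing g] [LieAlgebra K g]
    {a b : g} (h : ∀ n, Killed a b n) (r : ℕ) (hr : r ∈ centralDegrees a b) : Odd r ∧ 3 ≤ r := by
  refine ⟨?_, hr.1⟩
  rw [← Nat.not_even_iff_odd]
  rintro ⟨k, rfl⟩
  refine hr.2 ?_
  rw [show k + k - 2 = 2 * (k - 1) by omega]
  exact (h (2 * (k - 1))).lie_even K (k - 1) (by omega)

/-- The images of the basis vectors of `m_0^S`. -/
def filVec (a b : g) (T : Set ℕ) : ℕ+ ⊕ T → g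
  | .inl n => filSeq a b n.natPred
  -- In m_0^S the case l = 2 reads [e_2, e_r] = -z_r, and e_2, e_r correspond to b, x_{r-2}.
  | .inr r => -⁅b, chain a b (r - 2)⁆

/-- The degrees of the basis vectors of `m_0^S`. -/
def filDegree (T : Set ℕ) : ℕ+ ⊕ T → ℕ
  -- Both e_1 and e_2 have degree one, and e_n has degree n - 1 for n ≥ 2.
  | .inl n => max 1 n.natPred
  | .inr r => r

theorem filVec_one (a b : g) (T : Set ℕ) : filVec a b T (.inl (Nat.succPNat 0)) = a := rfl

theorem filVec_succ (a b : g) (T : Set ℕ) (n : ℕ) :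
    filVec a b T (.inl (Nat.succPNat (n + 1))) = chain a b n := rfl

theorem filVec_inr (a b : g) (T : Set ℕ) (r : T) :
    filVec a b T (.inr r) = -⁅b, chain a b (r - 2)⁆ := rfl

theorem filDegree_inl (T : Set ℕ) (n : ℕ) : filDegree T (.inl n.succPNat) = max 1 n := rfl

theorem filDegree_inr (T : Set ℕ) (r : T) : filDegree T (.inr r) = r := rfl

namespace Frame

/-- Otherwise the component of degree n + 2 would be spanned by the central z_n alone. -/
theorem chain_ne_zero (F : Frame 𝒜 a b) (h : ∀ n, Killed a b n) (n : ℕ) : chain a b n ≠ 0 := by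
  intro h0
  have h1 : chain a b (n + 1) = 0 := by rw [chain_succ, h0, lie_zero]
  refine F.not_le_span_of_killed (n := n + 2) (by omega) (h n n le_rfl).1 (h n n le_rfl).2 ?_
  refine (F.le_span_chain (h n) n (by omega)).trans ?_
  rw [h1, Submodule.span_insert_zero]

/-- In degree one, ad b separates a from b. In higher degrees ad a kills the z's but not the chain,
which also excludes that a nonzero z is a multiple of the chain vector of its degree. -/
theorem linearIndependent_filVec [GradedLieAlgebra 𝒜] (F : Frame 𝒜 a b)
    (h : ∀ n, Killed a b n) {T : Set ℕ} (hT : T ⊆ centralDegrees a b) :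
    LinearIndependent K (filVec a b T) := by
  have hba : ⁅b, a⁆ ≠ 0 := by
    rw [← lie_skew, neg_ne_zero]
    exact F.chain_ne_zero h 1
  refine linearIndependent_of_degree (𝒜 := 𝒜) (deg := filDegree T) ?_ ?_
  · rintro (n | ⟨r, hr⟩)
    · obtain ⟨k, rfl⟩ := exists_succPNat n
      rw [filDegree_inl]
      rcases k with _ | k
      · exact F.left_mem
      · rw [filVec_succ, max_eq_right (by omega)]
        exact F.chain_mem k
    · have h3 := (hT hr).1
      have := F.lie_right_mem (F.chain_mem (r - 2))
      rw [show r - 2 + 1 + 1 = r by omega] at this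
      exact neg_mem this
  · rintro (n | ⟨r, hr⟩)
    · obtain ⟨k, rfl⟩ := exists_succPNat n
      rcases k with _ | k
      · refine ⟨LinearMap.ker (LieModule.toEnd K g g b : g →ₗ[K] g),
          by simpa [filVec_one] using hba, ?_⟩
        rintro (m | ⟨r, hr⟩) hm hd
        · obtain ⟨l, rfl⟩ := exists_succPNat m
          rw [filDegree_inl, filDegree_inl] at hd
          rcases l with _ | l
          · exact absurd rfl hm
          · obtain rfl : l = 0 := by omega
            rw [filVec_succ]
            simp [chain_zero]
        · have h3 := (hT hr).1
          rw [filDegree_inl, filDegree_inr] at hd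
          simp only at hd
          omega
      · refine ⟨LinearMap.ker (LieModule.toEnd K g g a : g →ₗ[K] g), ?_, ?_⟩
        · simpa [filVec_succ, ← chain_succ] using F.chain_ne_zero h (k + 1)
        · rintro (m | ⟨r, hr⟩) hm hd
          · obtain ⟨l, rfl⟩ := exists_succPNat m
            rw [filDegree_inl, filDegree_inl] at hd
            rcases l with _ | l
            · simp [filVec_one]
            · obtain rfl : l = k := by omega
              exact absurd rfl hm
          · rw [filVec_inr, LinearMap.mem_ker, LieModule.toEnd_apply_apply, lie_neg,
              (h (r - 2) _ le_rfl).1, neg_zero]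
    · have h3 := (hT hr).1
      refine ⟨Submodule.span K {chain a b (r - 1)}, ?_, ?_⟩
      · intro hmem
        rw [filVec_inr, neg_mem_iff] at hmem
        obtain ⟨t, ht⟩ := Submodule.mem_span_singleton.1 hmem
        have ht0 : t ≠ 0 := by
          rintro rfl
          exact (hT hr).2 (by rw [← ht, zero_smul])
        have := (h (r - 2) _ le_rfl).1
        rw [← ht, lie_smul, ← chain_succ] at this
        exact F.chain_ne_zero h _ ((smul_eq_zero.1 this).resolve_left ht0)
      · rintro (m | ⟨s, hs⟩) hm hd
        · obtain ⟨l, rfl⟩ := exists_succPNat m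
          rw [filDegree_inl, filDegree_inr] at hd
          simp only at hd
          obtain ⟨l, rfl⟩ : ∃ i, l = i + 1 := ⟨l - 1, by omega⟩
          rw [filVec_succ, show l = r - 1 by omega]
          exact Submodule.mem_span_singleton_self _
        · refine absurd ?_ hm
          rw [filDegree_inr, filDegree_inr] at hd
          exact congrArg _ (Subtype.ext hd)

end Frame

theorem m0_c_one (n : ℕ) :
    (m0 K).c 1 (n + 1).succPNat = Finsupp.single (n + 2).succPNat 1 := by
  simp only [m0, widthOne, m0Coeff_eq, if_true, succPNat_eq_one_iff]
  rw [one_eq_succPNat, succPNat_add, if_neg (by omega), show 0 + (n + 1) + 1 = n + 2 by omega]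

theorem m0_c_two_one : (m0 K).c 2 1 = Finsupp.single (Nat.succPNat 2) (-1) := by
  simp only [m0, widthOne, m0Coeff_eq]
  rfl

theorem m0_c_two (n : ℕ) : (m0 K).c 2 (n + 1).succPNat = 0 := by
  simp only [m0, widthOne, m0Coeff_eq, succPNat_eq_one_iff]
  rw [if_neg (by decide), if_neg (by omega), Finsupp.single_zero]

theorem m0_gen (H : LieSubalgebra K (m0 K).Algebra) (h1 : (m0 K).e 1 ∈ H) (h2 : (m0 K).e 2 ∈ H)
    (n : ℕ+) : (m0 K).e n ∈ H := by
  have key : ∀ k : ℕ, (m0 K).e (k + 1).succPNat ∈ H := by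
    intro k
    induction k with
    | zero => exact h2
    | succ k ih =>
      have := H.lie_mem h1 ih
      rwa [LieConstants.lie_e_eq_of, m0_c_one, LieConstants.of_single, one_smul] at this
  obtain ⟨k, rfl⟩ := exists_succPNat n
  rcases k with _ | k
  exacts [h1, key k]

theorem Frame.nonempty_equiv_m0 [GradedLieAlgebra 𝒜] (F : Frame 𝒜 a b) (h : ∀ n, Killed a b n)
    (hS : ¬ (centralDegrees a b).Nonempty) : Nonempty (g ≃ₗ⁅K⁆ (m0 K).Algebra) := by
  have hz : ∀ n, ⁅b, chain a b n⁆ = 0 := by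
    intro n
    rcases n with _ | n
    · exact lie_self b
    · by_contra h0
      exact hS ⟨n + 3, by omega, h0⟩
  refine F.nonempty_lieEquiv (m0 K).basis (E := filVec a b ∅ ∘ Sum.inl) (p := 1) (q := 2)
    ((F.linearIndependent_filVec h (Set.empty_subset _)).comp Sum.inl Sum.inl_injective) rfl
    rfl (m0_gen (K := K)) ?_ ?_
  · intro n
    obtain ⟨k, rfl⟩ := exists_succPNat n
    rw [LieConstants.constr_lie, Function.comp_apply]
    rcases k with _ | k
    · rw [filVec_one, lie_self, ← one_eq_succPNat, (m0 K).c_self, map_zero]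
    · rw [m0_c_one, Finsupp.linearCombination_single, one_smul, filVec_succ, Function.comp_apply,
        filVec_succ, chain_succ]
  · intro n
    obtain ⟨k, rfl⟩ := exists_succPNat n
    rw [LieConstants.constr_lie, Function.comp_apply]
    rcases k with _ | k
    · rw [← one_eq_succPNat, m0_c_two_one, Finsupp.linearCombination_single, neg_smul, one_smul,
        one_eq_succPNat, filVec_one, Function.comp_apply, filVec_succ, ← lie_skew]
      rfl
    · rw [m0_c_two, map_zero, filVec_succ, hz]

theorem m0S_c_inl (S : OddSet) (i j : ℕ+) : (m0S K S).c (.inl i) (.inl j) =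
    ((m0 K).c i j).mapDomain Sum.inl + (m0Cocycle K S i j).mapDomain Sum.inr := rfl

theorem m0S_c_inr (S : OddSet) (i : ℕ+ ⊕ S.1) (r : S.1) : (m0S K S).c i (.inr r) = 0 := by
  cases i <;> rfl

theorem m0Cocycle_one_left (S : OddSet) (i : ℕ+) : m0Cocycle K S 1 i = 0 := by
  rw [m0Cocycle_skew, m0Cocycle_one_right, neg_zero]

theorem m0Cocycle_two (S : OddSet) (n : ℕ) (h : n + 2 ∈ S.1) :
    m0Cocycle K S 2 (n + 1).succPNat = Finsupp.single ⟨n + 2, h⟩ (-1) := by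
  have h' : ((2 : ℕ+) : ℕ) + (n + 1).succPNat - 2 = n + 2 := by simp
  have hm : ((2 : ℕ+) : ℕ) + (n + 1).succPNat - 2 ∈ S.1 := h'.symm ▸ h
  have h2 : 2 ≤ (n + 1).succPNat := by
    rw [two_eq_succPNat, Nat.succPNat_le_succPNat]; omega
  refine (dif_pos ⟨le_rfl, h2, hm⟩).trans ?_
  have e : (⟨_, hm⟩ : S.1) = ⟨n + 2, h⟩ := Subtype.ext h'
  rw [e]
  congr 1
  simp [pow_succ]

theorem m0Cocycle_two_of_notMem (S : OddSet) (n : ℕ) (h : n + 2 ∉ S.1) :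
    m0Cocycle K S 2 (n + 1).succPNat = 0 := by
  have h' : ((2 : ℕ+) : ℕ) + (n + 1).succPNat - 2 = n + 2 := by simp
  exact dif_neg fun h0 => h (h' ▸ h0.2.2)

theorem m0S_lie_one (S : OddSet) (n : ℕ) :
    ⁅(m0S K S).e (.inl 1), (m0S K S).e (.inl (n + 1).succPNat)⁆ =
      (m0S K S).e (.inl (n + 2).succPNat) := by
  rw [LieConstants.lie_e_eq_of, m0S_c_inl, m0_c_one, m0Cocycle_one_left, Finsupp.mapDomain_single,
    Finsupp.mapDomain_zero, add_zero, LieConstants.of_single, one_smul]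

theorem m0S_lie_two (S : OddSet) (n : ℕ) (h : n + 2 ∈ S.1) :
    ⁅(m0S K S).e (.inl 2), (m0S K S).e (.inl (n + 1).succPNat)⁆ =
      -(m0S K S).e (.inr ⟨n + 2, h⟩) := by
  rw [LieConstants.lie_e_eq_of, m0S_c_inl, m0_c_two, m0Cocycle_two S n h, Finsupp.mapDomain_single,
    Finsupp.mapDomain_zero, zero_add, LieConstants.of_single, neg_smul, one_smul]

theorem m0S_gen (S : OddSet) (H : LieSubalgebra K (m0S K S).Algebra)
    (h1 : (m0S K S).e (.inl 1) ∈ H) (h2 : (m0S K S).e (.inl 2) ∈ H) (i : ℕ+ ⊕ S.1) :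
    (m0S K S).e i ∈ H := by
  have hl : ∀ k : ℕ, (m0S K S).e (.inl (k + 1).succPNat) ∈ H := by
    intro k
    induction k with
    | zero => exact h2
    | succ k ih => exact m0S_lie_one (K := K) S k ▸ H.lie_mem h1 ih
  rcases i with n | ⟨r, hr⟩
  · obtain ⟨k, rfl⟩ := exists_succPNat n
    rcases k with _ | k
    exacts [h1, hl k]
  · obtain ⟨k, rfl⟩ : ∃ k, r = k + 2 := ⟨r - 2, by have := (S.2 r hr).2; omega⟩
    exact neg_mem_iff.1 (m0S_lie_two (K := K) S k hr ▸ H.lie_mem h2 (hl k))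

/-- The degrees of central elements, as an index set for `m_0^S`. -/
def centralOddSet (K : Type*) [Field K] {g : Type*} [LieRing g] [LieAlgebra K g] {a b : g}
    (h : ∀ n, Killed a b n) : OddSet := ⟨centralDegrees a b, odd_of_mem_centralDegrees K h⟩

/-- Since e_1 and e_2 generate m_0^S, only their brackets with the basis have to be matched. They
are the definition of the chain and of the z's. -/
theorem Frame.nonempty_equiv_m0S [GradedLieAlgebra 𝒜] (F : Frame 𝒜 a b) (h : ∀ n, Killed a b n) :
    Nonempty (g ≃ₗ⁅K⁆ (m0S K (centralOddSet K h)).Algebra) := by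
  refine F.nonempty_lieEquiv (m0S K (centralOddSet K h)).basis (E := filVec a b
    (centralOddSet K h).1) (p := .inl 1)
    (q := .inl 2) (F.linearIndependent_filVec h (T := (centralOddSet K h).1) subset_rfl) rfl
    rfl (m0S_gen (K := K) (centralOddSet K h)) ?_ ?_
  · rintro (n | r)
    · obtain ⟨k, rfl⟩ := exists_succPNat n
      rw [LieConstants.constr_lie, m0S_c_inl, m0Cocycle_one_left, Finsupp.mapDomain_zero, add_zero]
      rcases k with _ | k
      · rw [filVec_one, lie_self, ← one_eq_succPNat, (m0 K).c_self, Finsupp.mapDomain_zero,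
          map_zero]
      · rw [m0_c_one, Finsupp.mapDomain_single, Finsupp.linearCombination_single, one_smul,
          filVec_succ, filVec_succ, chain_succ]
    · rw [LieConstants.constr_lie, m0S_c_inr, map_zero, filVec_inr, lie_neg, (h _ _ le_rfl).1,
        neg_zero]
  · rintro (n | r)
    · obtain ⟨k, rfl⟩ := exists_succPNat n
      rw [LieConstants.constr_lie, m0S_c_inl]
      rcases k with _ | k
      · rw [← one_eq_succPNat, m0Cocycle_one_right, Finsupp.mapDomain_zero, add_zero, m0_c_two_one,
          Finsupp.mapDomain_single, Finsupp.linearCombination_single, one_eq_succPNat, filVec_one,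
          filVec_succ, neg_smul, one_smul, ← lie_skew]
        rfl
      · rw [m0_c_two, Finsupp.mapDomain_zero, zero_add, filVec_succ]
        by_cases hk : k + 2 ∈ centralDegrees a b
        · rw [m0Cocycle_two (centralOddSet K h) k hk, Finsupp.mapDomain_single,
            Finsupp.linearCombination_single, neg_smul, one_smul, filVec_inr, neg_neg]
          rfl
        · rw [m0Cocycle_two_of_notMem (centralOddSet K h) k hk, Finsupp.mapDomain_zero, map_zero]
          rcases k with _ | k
          · exact (lie_self b).symm
          · by_contra h0
            exact hk ⟨by omega, fun h1 => h0 h1.symm⟩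
    · rw [LieConstants.constr_lie, m0S_c_inr, map_zero, filVec_inr, lie_neg, (h _ _ le_rfl).2,
        neg_zero]

end FiliformModel


/-! ### Identification with n_2 and n_2^3 -/

section TwistedModel

variable {K : Type*} [Field K] {g : Type*} [LieRing g] [LieAlgebra K g]
variable {𝒜 : ℕ → Submodule K g} {a b : g}

variable (K) in
/-- The coefficient in `[e_1, e_{k+1}]` in `n_2`. -/
def n2Left (k : ℕ) : K := (n2Table (res8 1) (res8 k.succPNat) : K)

variable (K) in
/-- The coefficient in `[e_2, e_{k+1}]` in `n_2`. -/
def n2Right (k : ℕ) : K := (n2Table (res8 2) (res8 k.succPNat) : K)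

theorem res8_succPNat (m : ℕ) (r : Fin 8) : res8 (8 * m + r : ℕ).succPNat = r + 1 := by
  apply Fin.ext
  simp only [res8, Fin.ofNat, Nat.succPNat_coe, Fin.val_add]
  simp
  omega

/-- This is row 1 of the table read from column 1 and ending with column 0, since positions in a
block start at e_{8m+1}. -/
theorem n2Left_eq (m : ℕ) (r : Fin 8) :
    n2Left K (8 * m + r) = ((![0, 1, 1, -3, -2, 0, 1, -1] r : ℤ) : K) := by
  rw [n2Left, res8_succPNat]
  congr 1
  revert r
  decide

theorem n2Right_eq (m : ℕ) (r : Fin 8) :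
    n2Right K (8 * m + r) = ((![-1, 0, 0, 0, 1, -1, 0, 2] r : ℤ) : K) := by
  rw [n2Right, res8_succPNat]
  congr 1
  revert r
  decide

variable (K) in
/-- The images of the basis vectors `e_1, e_2, …` of `n_2`. -/
def blockSeq (a b : g) (k : ℕ) : g := blocks K a b (k / 8) (Fin.ofNat 8 k)

theorem blockSeq_eq (a b : g) (m : ℕ) (r : Fin 8) :
    blockSeq K a b (8 * m + r) = blocks K a b m r := by
  have h1 : (8 * m + (r : ℕ)) / 8 = m := by omega
  have h2 : Fin.ofNat 8 (8 * m + r) = r := by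
    apply Fin.ext
    simp only [Fin.ofNat]
    omega
  rw [blockSeq, h1, h2]

/-- The degrees of the basis vectors `e_1, e_2, …` of `n_2`. -/
def blockDegree (k : ℕ) : ℕ := 6 * (k / 8) + ![1, 1, 2, 3, 4, 5, 5, 6] (Fin.ofNat 8 k)

theorem blockDegree_eq (m : ℕ) (r : Fin 8) :
    blockDegree (8 * m + r) = 6 * m + ![1, 1, 2, 3, 4, 5, 5, 6] r := by
  have h1 : (8 * m + (r : ℕ)) / 8 = m := by omega
  have h2 : Fin.ofNat 8 (8 * m + r) = r := by
    apply Fin.ext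
    simp only [Fin.ofNat]
    omega
  rw [blockDegree, h1, h2]

theorem exists_block (k : ℕ) : ∃ (m : ℕ) (r : Fin 8), k = 8 * m + r :=
  ⟨k / 8, ⟨k % 8, Nat.mod_lt _ (by norm_num)⟩, (Nat.div_add_mod k 8).symm⟩

namespace Frame

variable [CharZero K] [GradedLieAlgebra 𝒜]

theorem lie_left_blockSeq (F : Frame 𝒜 a b) (h : Killed a b 2) (h5 : chain a b 5 = 0) (k : ℕ) :
    ⁅a, blockSeq K a b k⁆ = n2Left K k • blockSeq K a b (k + 1) := by
  obtain ⟨m, r, rfl⟩ := exists_block k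
  have hB := (F.blocks_spec h h5 m).1
  rw [blockSeq_eq, n2Left_eq]
  have last : blockSeq K a b (8 * m + 7 + 1) = blocks K a b (m + 1) 0 := blockSeq_eq a b (m + 1) 0
  fin_cases r
  · simpa using hB.a0
  · simpa [show blockSeq K a b (8 * m + 1 + 1) = blocks K a b m 2 from blockSeq_eq a b m 2] using
      hB.a1
  · simpa [show blockSeq K a b (8 * m + 2 + 1) = blocks K a b m 3 from blockSeq_eq a b m 3] using
      hB.a2
  · simpa [show blockSeq K a b (8 * m + 3 + 1) = blocks K a b m 4 from blockSeq_eq a b m 4] using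
      hB.a3
  · simpa [show blockSeq K a b (8 * m + 4 + 1) = blocks K a b m 5 from blockSeq_eq a b m 5] using
      hB.a4
  · simpa using hB.a5
  · simpa [show blockSeq K a b (8 * m + 6 + 1) = blocks K a b m 7 from blockSeq_eq a b m 7] using
      hB.a6
  · simpa [last] using lie_left_blocks_seven (K := K) a b m

/-- The excluded k = 2 is [e_2, e_3], the only bracket with e_1 or e_2 in which n_2 and n_2^3
differ. -/
theorem lie_right_blockSeq (F : Frame 𝒜 a b) (h : Killed a b 2) (h5 : chain a b 5 = 0) (k : ℕ)
    (hk : k ≠ 2) : ⁅b, blockSeq K a b k⁆ = n2Right K k • blockSeq K a b (k + 2) := by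
  obtain ⟨m, r, rfl⟩ := exists_block k
  have hB := (F.blocks_spec h h5 m).1
  rw [blockSeq_eq, n2Right_eq]
  have last : blockSeq K a b (8 * m + 7 + 2) = blocks K a b (m + 1) 1 := blockSeq_eq a b (m + 1) 1
  fin_cases r
  · simpa [show blockSeq K a b (8 * m + 2) = blocks K a b m 2 from blockSeq_eq a b m 2] using
      hB.b0
  · simpa using hB.b1
  · obtain ⟨m, rfl⟩ : ∃ l, m = l + 1 := ⟨m - 1, by simp at hk; omega⟩
    simpa using F.lie_blocks_succ_two h h5 m
  · simpa using hB.b3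
  · simpa [show blockSeq K a b (8 * m + 4 + 2) = blocks K a b m 6 from blockSeq_eq a b m 6] using
      hB.b4
  · simpa [show blockSeq K a b (8 * m + 5 + 2) = blocks K a b m 7 from blockSeq_eq a b m 7] using
      hB.b5
  · simpa using hB.b6
  · simpa [last] using lie_right_blocks_seven (K := K) a b m

theorem blockSeq_mem (F : Frame 𝒜 a b) (h : Killed a b 2) (h5 : chain a b 5 = 0) (k : ℕ) :
    blockSeq K a b k ∈ 𝒜 (blockDegree k) := by
  obtain ⟨m, r, rfl⟩ := exists_block k
  have hD := (F.blocks_spec h h5 m).2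
  rw [blockSeq_eq, blockDegree_eq]
  fin_cases r
  exacts [hD.m0, hD.m1, hD.m2, hD.m3, hD.m4, hD.m5, hD.m6, hD.m7]

/-- The vectors at positions 2, 4, 7 span whole components, which are nonzero. Each of the others
has one of these, up to a nonzero scalar, as a bracket with a or b. -/
theorem blocks_ne_zero (F : Frame 𝒜 a b) (h : Killed a b 2) (h5 : chain a b 5 = 0) (m : ℕ)
    (r : Fin 8) : blocks K a b m r ≠ 0 := by
  obtain ⟨hB, hD⟩ := F.blocks_spec h h5 m
  have ne : ∀ {n : ℕ} {x : g}, 1 ≤ n → 𝒜 n ≤ Submodule.span K {x} → x ≠ 0 := by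
    rintro n x hn hs rfl
    exact F.ne_bot n hn (le_bot_iff.1 (by simpa using hs))
  have h2 := ne (by omega) hD.s2
  have h4 := ne (by omega) hD.s4
  have h7 := ne (by omega) hD.s7
  fin_cases r
  · exact fun h0 => h2 (by simpa [show blocks K a b m 0 = 0 from h0] using hB.b0.symm)
  · exact fun h0 => h2 (by simpa [show blocks K a b m 1 = 0 from h0] using hB.a1.symm)
  · exact h2
  · exact fun h0 => h4 (by simpa [show blocks K a b m 3 = 0 from h0] using hB.a3.symm)
  · exact h4
  · exact fun h0 => h7 (by simpa [show blocks K a b m 5 = 0 from h0] using hB.b5.symm)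
  · exact fun h0 => h7 (by simpa [show blocks K a b m 6 = 0 from h0] using hB.a6.symm)
  · exact h7

theorem blockSeq_ne_zero (F : Frame 𝒜 a b) (h : Killed a b 2) (h5 : chain a b 5 = 0) (k : ℕ) :
    blockSeq K a b k ≠ 0 := F.blocks_ne_zero h h5 _ _

end Frame

variable (K) in
/-- The images of the basis vectors of `n_2` and of a central extension of it. -/
def twistVec (a b : g) (T : Type) : ℕ+ ⊕ T → g
  | .inl n => blockSeq K a b n.natPred
  | .inr _ => ⁅b, ⁅a, b⁆⁆

theorem twistVec_inl (a b : g) (T : Type) (k : ℕ) :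
    twistVec K a b T (.inl k.succPNat) = blockSeq K a b k := rfl

theorem twistVec_inr (a b : g) (T : Type) (t : T) :
    twistVec K a b T (.inr t) = ⁅b, ⁅a, b⁆⁆ := rfl

/-- The degrees of the basis vectors of `n_2` and of a central extension of it. -/
def twistDegree (T : Type) : ℕ+ ⊕ T → ℕ
  | .inl n => blockDegree n.natPred
  | .inr _ => 3

theorem twistDegree_inl (T : Type) (k : ℕ) :
    twistDegree T (.inl k.succPNat) = blockDegree k := rfl

theorem twistDegree_inr (T : Type) (t : T) : twistDegree T (.inr t) = 3 := rfl

theorem eq_or_of_blockDegree_eq {m n : ℕ} {r s : Fin 8}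
    (h : blockDegree (8 * m + r) = blockDegree (8 * n + s)) :
    m = n ∧ (r = s ∨ r = 0 ∧ s = 1 ∨ r = 1 ∧ s = 0 ∨ r = 5 ∧ s = 6 ∨ r = 6 ∧ s = 5) := by
  rw [blockDegree_eq, blockDegree_eq] at h
  have hb : ∀ r : Fin 8, 1 ≤ ![1, 1, 2, 3, 4, 5, 5, 6] r ∧ ![1, 1, 2, 3, 4, 5, 5, 6] r ≤ 6 := by
    decide
  have := hb r
  have := hb s
  have hmn : m = n := by omega
  refine ⟨hmn, ?_⟩
  subst hmn
  have h' : ![1, 1, 2, 3, 4, 5, 5, 6] r = ![1, 1, 2, 3, 4, 5, 5, 6] s := by omega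
  clear h this hb
  revert r s
  decide

theorem eq_three_of_blockDegree_eq {m : ℕ} {r : Fin 8} (h : blockDegree (8 * m + r) = 3) :
    m = 0 ∧ r = 3 := by
  have h' : blockDegree (8 * m + r) = blockDegree (8 * 0 + (3 : Fin 8)) := h
  obtain ⟨rfl, h1⟩ := eq_or_of_blockDegree_eq h'
  refine ⟨rfl, ?_⟩
  revert h1
  revert r
  decide

/-- Within a block, degrees coincide only at positions 0, 1 and 5, 6: ad a kills exactly 0 and 5,
and ad b kills 1 and 6 but not 0 and 5. The vector z shares degree 3 with position 3 of the first
block, which ad a does not kill. With an empty T the same statement covers n_2, where z may vanish.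
-/
theorem Frame.linearIndependent_twistVec [CharZero K] [GradedLieAlgebra 𝒜] (F : Frame 𝒜 a b)
    (h : Killed a b 2)
    (h5 : chain a b 5 = 0) {T : Type} [Subsingleton T] (hT : T → ⁅b, ⁅a, b⁆⁆ ≠ 0) :
    LinearIndependent K (twistVec K a b T) := by
  have hza : ⁅a, ⁅b, ⁅a, b⁆⁆⁆ = 0 := (h 1 (by norm_num)).1
  have hl := F.lie_left_blockSeq (K := K) h h5
  have hr := F.lie_right_blockSeq (K := K) h h5
  have hne := F.blockSeq_ne_zero (K := K) h h5
  refine linearIndependent_of_degree (𝒜 := 𝒜) (deg := twistDegree T) ?_ ?_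
  · rintro (n | t)
    · obtain ⟨k, rfl⟩ := exists_succPNat n
      exact F.blockSeq_mem h h5 k
    · exact F.lie_right_mem (F.lie_left_mem F.right_mem)
  · rintro (n | t)
    · obtain ⟨k, rfl⟩ := exists_succPNat n
      obtain ⟨m, r, rfl⟩ := exists_block k
      by_cases hr05 : r = 0 ∨ r = 5
      · refine ⟨LinearMap.ker (LieModule.toEnd K g g b : g →ₗ[K] g), ?_, ?_⟩
        · rw [twistVec_inl, LinearMap.mem_ker, LieModule.toEnd_apply_apply, hr]
          · refine smul_ne_zero ?_ (hne _)
            rw [n2Right_eq]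
            rcases hr05 with rfl | rfl <;> simp
          · rcases hr05 with rfl | rfl
            · change 8 * m + 0 ≠ 2
              omega
            · change 8 * m + 5 ≠ 2
              omega
        · rintro (n | t) hn hd
          · obtain ⟨k, rfl⟩ := exists_succPNat n
            obtain ⟨m', r', rfl⟩ := exists_block k
            rw [twistDegree_inl, twistDegree_inl] at hd
            obtain ⟨rfl, hrr⟩ := eq_or_of_blockDegree_eq hd
            have hne' : r' ≠ r := fun e => hn (by rw [e])
            have hr16 : r' = 1 ∨ r' = 6 := by
              clear hd hn
              revert r r'
              decide
            rw [twistVec_inl, LinearMap.mem_ker, LieModule.toEnd_apply_apply, hr]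
            · rw [n2Right_eq]
              rcases hr16 with rfl | rfl <;> simp
            · rcases hr16 with rfl | rfl
              · change 8 * m' + 1 ≠ 2
                omega
              · change 8 * m' + 6 ≠ 2
                omega
          · rw [twistDegree_inl, twistDegree_inr] at hd
            have := (eq_three_of_blockDegree_eq hd.symm).2
            rcases hr05 with rfl | rfl <;> exact absurd this (by decide)
      · refine ⟨LinearMap.ker (LieModule.toEnd K g g a : g →ₗ[K] g), ?_, ?_⟩
        · rw [twistVec_inl, LinearMap.mem_ker, LieModule.toEnd_apply_apply, hl]
          refine smul_ne_zero ?_ (hne _)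
          rw [n2Left_eq]
          have : (![0, 1, 1, -3, -2, 0, 1, -1] r : ℤ) ≠ 0 := by
            clear hr
            revert r
            decide
          exact_mod_cast this
        · rintro (n | t) hn hd
          · obtain ⟨k, rfl⟩ := exists_succPNat n
            obtain ⟨m', r', rfl⟩ := exists_block k
            rw [twistDegree_inl, twistDegree_inl] at hd
            obtain ⟨rfl, hrr⟩ := eq_or_of_blockDegree_eq hd
            have hne' : r' ≠ r := fun e => hn (by rw [e])
            have hr05' : r' = 0 ∨ r' = 5 := by
              clear hd hn
              revert r r'
              decide
            rw [twistVec_inl, LinearMap.mem_ker, LieModule.toEnd_apply_apply, hl, n2Left_eq]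
            rcases hr05' with rfl | rfl <;> simp
          · rw [twistVec_inr, LinearMap.mem_ker, LieModule.toEnd_apply_apply, hza]
    · refine ⟨Submodule.span K {blockSeq K a b 3}, ?_, ?_⟩
      · intro hmem
        rw [twistVec_inr] at hmem
        obtain ⟨s, hs⟩ := Submodule.mem_span_singleton.1 hmem
        have hs0 : s ≠ 0 := by
          rintro rfl
          exact hT t (by rw [← hs, zero_smul])
        rw [← hs, lie_smul, hl] at hza
        have h3 : n2Left K 3 = -3 := by simpa using n2Left_eq (K := K) 0 3
        exact smul_ne_zero hs0 (smul_ne_zero (by rw [h3]; norm_num) (hne _)) hza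
      · rintro (n | t') hn hd
        · obtain ⟨k, rfl⟩ := exists_succPNat n
          obtain ⟨m', r', rfl⟩ := exists_block k
          rw [twistDegree_inl, twistDegree_inr] at hd
          obtain ⟨rfl, rfl⟩ := eq_three_of_blockDegree_eq hd
          exact Submodule.mem_span_singleton_self _
        · exact absurd (congrArg Sum.inr (Subsingleton.elim t' t)) hn

/-- A subalgebra that contains `e_1` and `e_2` contains all `e_i`. -/
theorem mem_of_n2_relations [CharZero K] {L : Type*} [LieRing L] [LieAlgebra K L] {v : ℕ → L}
    (hl : ∀ k, ⁅v 0, v k⁆ = n2Left K k • v (k + 1))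
    (hr : ∀ k, k ≠ 2 → ⁅v 1, v k⁆ = n2Right K k • v (k + 2)) (H : LieSubalgebra K L)
    (h0 : v 0 ∈ H) (h1 : v 1 ∈ H) (k : ℕ) : v k ∈ H := by
  have left : ∀ k, v k ∈ H → n2Left K k ≠ 0 → v (k + 1) ∈ H := fun k hk hc => by
    have := H.smul_mem (n2Left K k)⁻¹ (H.lie_mem h0 hk)
    rwa [hl, inv_smul_smul₀ hc] at this
  have right : ∀ k, k ≠ 2 → v k ∈ H → n2Right K k ≠ 0 → v (k + 2) ∈ H := fun k h2 hk hc => by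
    have := H.smul_mem (n2Right K k)⁻¹ (H.lie_mem h1 hk)
    rwa [hr k h2, inv_smul_smul₀ hc] at this
  -- Positions 0, 2, 3, 4, 5 are reached by bracketing the preceding vector with e_1, positions 1,
  -- 6, 7 by bracketing the vector two steps earlier with e_2. The exceptional [e_2, e_3] is never
  -- used.
  induction k using Nat.strong_induction_on with
  | _ k ih =>
    obtain ⟨m, r, rfl⟩ := exists_block k
    have hL := n2Left_eq (K := K) m
    fin_cases r
    · rcases m with _ | m
      · exact h0
      · refine left (8 * m + 7) (ih _ (by simp; omega)) ?_
        have := n2Left_eq (K := K) m 7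
        simp at this
        simp [this]
    · rcases m with _ | m
      · exact h1
      · refine right (8 * m + 7) (by omega) (ih _ (by simp; omega)) ?_
        have := n2Right_eq (K := K) m 7
        simp at this
        simp [this]
    · refine left (8 * m + 1) (ih _ (by simp)) ?_
      have := hL 1
      simp at this
      simp [this]
    · refine left (8 * m + 2) (ih _ (by simp)) ?_
      have := hL 2
      simp at this
      simp [this]
    · refine left (8 * m + 3) (ih _ (by simp)) ?_
      have := hL 3
      simp at this
      simp [this]
    · refine left (8 * m + 4) (ih _ (by simp)) ?_
      have := hL 4
      simp at this
      simp [this]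
    · refine right (8 * m + 4) (by omega) (ih _ (by simp)) ?_
      have := n2Right_eq (K := K) m 4
      simp at this
      simp [this]
    · refine right (8 * m + 5) (by omega) (ih _ (by simp)) ?_
      have := n2Right_eq (K := K) m 5
      simp at this
      simp [this]

theorem n2_c_one (k : ℕ) : (n2 K).c 1 k.succPNat = Finsupp.single (k + 1).succPNat (n2Left K k) :=
    by
  simp only [n2, widthOne, n2Left]
  rw [one_eq_succPNat, succPNat_add, show 0 + k + 1 = k + 1 by omega]

theorem n2_c_two (k : ℕ) : (n2 K).c 2 k.succPNat = Finsupp.single (k + 2).succPNat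
    (n2Right K k) := by
  simp only [n2, widthOne, n2Right]
  rw [two_eq_succPNat, succPNat_add, show 1 + k + 1 = k + 2 by omega]

theorem n2_gen [CharZero K] (H : LieSubalgebra K (n2 K).Algebra) (h1 : (n2 K).e 1 ∈ H) (h2 :
    (n2 K).e 2 ∈ H)
    (n : ℕ+) : (n2 K).e n ∈ H := by
  obtain ⟨k, rfl⟩ := exists_succPNat n
  refine mem_of_n2_relations (v := fun k => (n2 K).e k.succPNat) (fun k => ?_) (fun k _ => ?_) H
    h1 h2 k
  · rw [← one_eq_succPNat, LieConstants.lie_e_eq_of, n2_c_one, LieConstants.of_single]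
  · rw [← two_eq_succPNat, LieConstants.lie_e_eq_of, n2_c_two, LieConstants.of_single]

theorem Frame.nonempty_equiv_n2 [CharZero K] [GradedLieAlgebra 𝒜] (F : Frame 𝒜 a b)
    (h : Killed a b 2)
    (h5 : chain a b 5 = 0) (hz : ⁅b, ⁅a, b⁆⁆ = 0) : Nonempty (g ≃ₗ⁅K⁆ (n2 K).Algebra) := by
  refine F.nonempty_lieEquiv (n2 K).basis (E := twistVec K a b Empty ∘ Sum.inl) (p := 1) (q := 2)
    ((F.linearIndependent_twistVec h h5 (fun t => t.elim)).comp Sum.inl Sum.inl_injective) rfl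
    rfl (n2_gen (K := K)) ?_ ?_
  · intro n
    obtain ⟨k, rfl⟩ := exists_succPNat n
    rw [LieConstants.constr_lie, Function.comp_apply, n2_c_one, Finsupp.linearCombination_single,
      Function.comp_apply, twistVec_inl, twistVec_inl, F.lie_left_blockSeq h h5]
  · intro n
    obtain ⟨k, rfl⟩ := exists_succPNat n
    rw [LieConstants.constr_lie, Function.comp_apply, n2_c_two, Finsupp.linearCombination_single,
      Function.comp_apply, twistVec_inl, twistVec_inl]
    by_cases hk : k = 2
    · subst hk
      have h2 : n2Right K 2 = 0 := by simpa using n2Right_eq (K := K) 0 2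
      rw [h2, zero_smul]
      exact hz.symm
    · rw [F.lie_right_blockSeq h h5 k hk]

theorem n23_c_inl (i j : ℕ+) : (n23 K).c (.inl i) (.inl j) =
    ((n2 K).c i j).mapDomain Sum.inl + (n2Cocycle K i j).mapDomain Sum.inr := rfl

theorem n23_c_inr (i : ℕ+ ⊕ Unit) (t : Unit) : (n23 K).c i (.inr t) = 0 := by
  cases i <;> rfl

theorem n2Cocycle_one (i : ℕ+) : n2Cocycle K 1 i = 0 := by
  rw [n2Cocycle, if_neg fun h => absurd h.1 (by decide), if_neg fun h => absurd h.1 (by decide)]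

theorem n2Cocycle_two (k : ℕ) (hk : k ≠ 2) : n2Cocycle K 2 k.succPNat = 0 := by
  rw [n2Cocycle, if_neg, if_neg fun h => absurd h.1 (by decide)]
  rintro ⟨-, h⟩
  exact hk (Nat.succPNat_inj.1 (h.trans (show (3 : ℕ+) = Nat.succPNat 2 from rfl)))

theorem n23_c_one (k : ℕ) : (n23 K).c (.inl 1) (.inl k.succPNat) =
    Finsupp.single (.inl (k + 1).succPNat) (n2Left K k) := by
  rw [n23_c_inl, n2_c_one, n2Cocycle_one, Finsupp.mapDomain_single, Finsupp.mapDomain_zero,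
    add_zero]

theorem n23_c_two (k : ℕ) (hk : k ≠ 2) : (n23 K).c (.inl 2) (.inl k.succPNat) =
    Finsupp.single (.inl (k + 2).succPNat) (n2Right K k) := by
  rw [n23_c_inl, n2_c_two, n2Cocycle_two k hk, Finsupp.mapDomain_single, Finsupp.mapDomain_zero,
    add_zero]

theorem n23_c_two_three : (n23 K).c (.inl 2) (.inl (Nat.succPNat 2)) =
    Finsupp.single (.inr ()) 1 := by
  have h2 : n2Right K 2 = 0 := by simpa using n2Right_eq (K := K) 0 2
  have h : n2Cocycle K 2 (Nat.succPNat 2) = Finsupp.single () 1 := if_pos ⟨rfl, rfl⟩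
  rw [n23_c_inl, n2_c_two, h, h2, Finsupp.single_zero, Finsupp.mapDomain_single,
    Finsupp.mapDomain_zero, zero_add]

theorem n23_gen [CharZero K] (H : LieSubalgebra K (n23 K).Algebra) (h1 : (n23 K).e (.inl 1) ∈ H)
    (h2 : (n23 K).e (.inl 2) ∈ H) (i : ℕ+ ⊕ Unit) : (n23 K).e i ∈ H := by
  have key : ∀ k : ℕ, (n23 K).e (.inl k.succPNat) ∈ H := by
    refine mem_of_n2_relations (v := fun k => (n23 K).e (.inl k.succPNat)) (fun k => ?_)
      (fun k hk => ?_) H h1 h2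
    · rw [← one_eq_succPNat, LieConstants.lie_e_eq_of, n23_c_one, LieConstants.of_single]
    · rw [← two_eq_succPNat, LieConstants.lie_e_eq_of, n23_c_two k hk, LieConstants.of_single]
  rcases i with n | t
  · obtain ⟨k, rfl⟩ := exists_succPNat n
    exact key k
  · have := H.lie_mem h2 (key 2)
    rwa [LieConstants.lie_e_eq_of, n23_c_two_three, LieConstants.of_single, one_smul] at this

theorem Frame.nonempty_equiv_n23 [CharZero K] [GradedLieAlgebra 𝒜] (F : Frame 𝒜 a b)
    (h : Killed a b 2)
    (h5 : chain a b 5 = 0) (hz : ⁅b, ⁅a, b⁆⁆ ≠ 0) : Nonempty (g ≃ₗ⁅K⁆ (n23 K).Algebra) := by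
  refine F.nonempty_lieEquiv (n23 K).basis (E := twistVec K a b Unit) (p := .inl 1) (q := .inl 2)
    (F.linearIndependent_twistVec h h5 (fun _ => hz)) rfl rfl (n23_gen (K := K)) ?_ ?_
  · rintro (n | t)
    · obtain ⟨k, rfl⟩ := exists_succPNat n
      rw [LieConstants.constr_lie, n23_c_one, Finsupp.linearCombination_single,
        twistVec_inl, twistVec_inl, F.lie_left_blockSeq h h5]
    · rw [LieConstants.constr_lie, n23_c_inr, map_zero, twistVec_inr]
      exact (h 1 (by norm_num)).1.symm
  · rintro (n | t)
    · obtain ⟨k, rfl⟩ := exists_succPNat n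
      by_cases hk : k = 2
      · subst hk
        rw [LieConstants.constr_lie, n23_c_two_three, Finsupp.linearCombination_single, one_smul]
        rfl
      · rw [LieConstants.constr_lie, n23_c_two k hk, Finsupp.linearCombination_single,
          twistVec_inl, twistVec_inl, F.lie_right_blockSeq h h5 k hk]
    · rw [LieConstants.constr_lie, n23_c_inr, map_zero, twistVec_inr]
      exact (h 1 (by norm_num)).2.symm

end TwistedModel


/-! ### The monomial basis of n_1, and the existence half of the classification -/

section LoopModel

variable {K : Type*} [Field K] {g : Type*} [LieRing g] [LieAlgebra K g]
variable {𝒜 : ℕ → Submodule K g} {a b : g}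

/-- The vectors `u, v, w`. -/
def uvw (ε : K) (i : Fin 3) : UVW ε := ![UVW.u ε, UVW.v ε, UVW.w ε] i

/-- The coordinates with respect to `u, v, w`. -/
def uvwEquiv (ε : K) : UVW ε ≃ₗ[K] (Fin 3 → K) := LinearEquiv.refl K (Fin 3 → K)

/-- The basis `u, v, w`. -/
def uvwBasis (ε : K) : Module.Basis (Fin 3) K (UVW ε) := Module.Basis.ofEquivFun (uvwEquiv ε)

theorem uvwBasis_apply (ε : K) (i : Fin 3) : uvwBasis ε i = uvw ε i := by
  have h : uvwBasis ε i = (Pi.single i 1 : Fin 3 → K) := by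
    rw [uvwBasis, Module.Basis.coe_ofEquivFun]
    rfl
  rw [h]
  fin_cases i
  · change _ = (![1, 0, 0] : Fin 3 → K)
    funext j; fin_cases j <;> rfl
  · change _ = (![0, 1, 0] : Fin 3 → K)
    funext j; fin_cases j <;> rfl
  · change _ = (![0, 0, 1] : Fin 3 → K)
    funext j; fin_cases j <;> rfl

/-- The exponents of the monomials in `n_1`. -/
def n1Exp (k : ℕ) (i : Fin 3) : ℕ := 2 * k + ![1, 1, 2] i

/-- The monomials `u ⊗ t^(2k+1)`, `v ⊗ t^(2k+1)`, `w ⊗ t^(2k+2)`. -/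
def n1Mon (ε : K) (p : ℕ × Fin 3) : K[X] ⊗[K] UVW ε :=
  (Polynomial.X ^ n1Exp p.1 p.2 : K[X]) ⊗ₜ[K] uvw ε p.2

theorem range_n1Mon (ε : K) : Set.range (n1Mon ε) = n1Monomials ε := by
  apply Set.Subset.antisymm
  · rintro _ ⟨⟨k, i⟩, rfl⟩
    refine ⟨k, ?_⟩
    fin_cases i
    exacts [Or.inl rfl, Or.inr (Or.inl rfl), Or.inr (Or.inr rfl)]
  · rintro x ⟨k, rfl | rfl | rfl⟩
    exacts [⟨(k, 0), rfl⟩, ⟨(k, 1), rfl⟩, ⟨(k, 2), rfl⟩]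

theorem linearIndependent_n1Mon (ε : K) : LinearIndependent K (n1Mon ε) := by
  have h := ((Polynomial.basisMonomials K).tensorProduct (uvwBasis ε)).linearIndependent
  have inj : Function.Injective fun p : ℕ × Fin 3 => (n1Exp p.1 p.2, p.2) := by
    rintro ⟨k, i⟩ ⟨l, j⟩ h
    simp only [Prod.mk.injEq, n1Exp] at h
    obtain ⟨h1, rfl⟩ := h
    simp only [Prod.mk.injEq, and_true]
    omega
  have e : n1Mon ε = (Polynomial.basisMonomials K).tensorProduct (uvwBasis ε) ∘
      fun p : ℕ × Fin 3 => (n1Exp p.1 p.2, p.2) := by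
    funext p
    simp [n1Mon, Module.Basis.tensorProduct_apply, uvwBasis_apply, Polynomial.X_pow_eq_monomial]
  rw [e]
  exact h.comp _ inj

theorem mem_n1_iff (ε : K) (x : K[X] ⊗[K] UVW ε) :
    x ∈ n1 ε ↔ x ∈ Submodule.span K (n1Monomials ε) := Iff.rfl

/-- The monomials as elements of `n_1`. -/
def n1Vec (ε : K) (k : ℕ) (i : Fin 3) : n1 ε :=
  ⟨n1Mon ε (k, i), (mem_n1_iff ε _).2 (Submodule.subset_span (range_n1Mon ε ▸ ⟨(k, i), rfl⟩))⟩

/-- The basis of `n_1` that consists of monomials. -/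
def n1Basis (ε : K) : Module.Basis (ℕ × Fin 3) K (n1 ε) :=
  Module.Basis.mk (v := fun p => n1Vec ε p.1 p.2)
    (LinearIndependent.of_comp (n1 ε).toSubmodule.subtype (linearIndependent_n1Mon ε)) (by
      rintro ⟨x, hx⟩ -
      have h : x ∈ (Submodule.span K (Set.range fun p : ℕ × Fin 3 => n1Vec ε p.1 p.2)).map
          (n1 ε).toSubmodule.subtype := by
        rw [Submodule.map_span, ← Set.range_comp]
        rw [mem_n1_iff, ← range_n1Mon] at hx
        exact hx
      obtain ⟨y, hy, hyx⟩ := h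
      have : y = ⟨x, hx⟩ := Subtype.ext hyx
      exact this ▸ hy)

theorem n1Basis_apply (ε : K) (p : ℕ × Fin 3) : n1Basis ε p = n1Vec ε p.1 p.2 :=
  Module.Basis.mk_apply _ _ _

theorem lie_n1Mon (ε : K) (p q : ℕ × Fin 3) : ⁅n1Mon ε p, n1Mon ε q⁆ =
    (Polynomial.X ^ (n1Exp p.1 p.2 + n1Exp q.1 q.2) : K[X]) ⊗ₜ[K] ⁅uvw ε p.2, uvw ε q.2⁆ := by
  rw [n1Mon, n1Mon, LieAlgebra.ExtendScalars.bracket_tmul, pow_add]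

theorem n1Vec_lie_self (ε : K) (k l : ℕ) (i : Fin 3) : ⁅n1Vec ε k i, n1Vec ε l i⁆ = 0 :=
  Subtype.ext (by
    change ⁅n1Mon ε (k, i), n1Mon ε (l, i)⁆ = 0
    rw [lie_n1Mon, lie_self, TensorProduct.tmul_zero])

theorem n1Vec_lie_zero_one (ε : K) (k l : ℕ) :
    ⁅n1Vec ε k 0, n1Vec ε l 1⁆ = n1Vec ε (k + l) 2 := Subtype.ext (by
  change ⁅n1Mon ε (k, 0), n1Mon ε (l, 1)⁆ = n1Mon ε (k + l, 2)
  have h : ⁅uvw ε 0, uvw ε 1⁆ = uvw ε 2 := UVW.lie_u_v ε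
  have e : n1Exp k 0 + n1Exp l 1 = n1Exp (k + l) 2 := by
    change 2 * k + 1 + (2 * l + 1) = 2 * (k + l) + 2
    omega
  rw [lie_n1Mon, n1Mon, h, e])

theorem n1Vec_lie_one_two (ε : K) (k l : ℕ) :
    ⁅n1Vec ε k 1, n1Vec ε l 2⁆ = ε • n1Vec ε (k + l + 1) 0 := Subtype.ext (by
  change ⁅n1Mon ε (k, 1), n1Mon ε (l, 2)⁆ = ε • n1Mon ε (k + l + 1, 0)
  have h : ⁅uvw ε 1, uvw ε 2⁆ = ε • uvw ε 0 := UVW.lie_v_w ε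
  have e : n1Exp k 1 + n1Exp l 2 = n1Exp (k + l + 1) 0 := by
    change 2 * k + 1 + (2 * l + 2) = 2 * (k + l + 1) + 1
    omega
  rw [lie_n1Mon, n1Mon, h, e, TensorProduct.tmul_smul])

theorem n1Vec_lie_two_zero (ε : K) (k l : ℕ) :
    ⁅n1Vec ε k 2, n1Vec ε l 0⁆ = n1Vec ε (k + l + 1) 1 := Subtype.ext (by
  change ⁅n1Mon ε (k, 2), n1Mon ε (l, 0)⁆ = n1Mon ε (k + l + 1, 1)
  have h : ⁅uvw ε 2, uvw ε 0⁆ = uvw ε 1 := UVW.lie_w_u ε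
  have e : n1Exp k 2 + n1Exp l 0 = n1Exp (k + l + 1) 1 := by
    change 2 * k + 2 + (2 * l + 1) = 2 * (k + l + 1) + 1
    omega
  rw [lie_n1Mon, n1Mon, h, e])

theorem n1Vec_lie_zero_two (ε : K) (k l : ℕ) :
    ⁅n1Vec ε k 0, n1Vec ε l 2⁆ = -n1Vec ε (k + l + 1) 1 := by
  rw [← lie_skew, n1Vec_lie_two_zero, add_comm l k]

theorem n1Vec_lie_one_zero (ε : K) (k l : ℕ) :
    ⁅n1Vec ε k 1, n1Vec ε l 0⁆ = -n1Vec ε (k + l) 2 := by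
  rw [← lie_skew, n1Vec_lie_zero_one, add_comm l k]

variable {ε : K}

theorem n1_gen (hε : ε ≠ 0) (H : LieSubalgebra K (n1 ε)) (h0 : n1Vec ε 0 0 ∈ H)
    (h1 : n1Vec ε 0 1 ∈ H) (p : ℕ × Fin 3) : n1Vec ε p.1 p.2 ∈ H := by
  have key : ∀ k, n1Vec ε k 0 ∈ H ∧ n1Vec ε k 1 ∈ H ∧ n1Vec ε k 2 ∈ H := by
    have two : ∀ k, n1Vec ε k 1 ∈ H → n1Vec ε k 2 ∈ H := fun k hk => by
      have := H.lie_mem h0 hk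
      rwa [n1Vec_lie_zero_one, zero_add] at this
    intro k
    induction k with
    | zero => exact ⟨h0, h1, two 0 h1⟩
    | succ k ih =>
      have e1 : n1Vec ε (k + 1) 1 ∈ H := by
        have := H.lie_mem h0 ih.2.2
        rwa [n1Vec_lie_zero_two, zero_add, neg_mem_iff] at this
      have e0 : n1Vec ε (k + 1) 0 ∈ H := by
        have := H.smul_mem ε⁻¹ (H.lie_mem h1 ih.2.2)
        rwa [n1Vec_lie_one_two, inv_smul_smul₀ hε, zero_add] at this
      exact ⟨e0, e1, two _ e1⟩
  obtain ⟨k, i⟩ := p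
  fin_cases i
  exacts [(key k).1, (key k).2.1, (key k).2.2]

/-- Rescaling the loop algebra. -/
theorem nonempty_n1_equiv {ε' β : K} (hε : ε ≠ 0) (h : ε = β ^ 2 * ε') :
    Nonempty (n1 ε' ≃ₗ⁅K⁆ n1 ε) := by
  have hβ : β ≠ 0 := by
    rintro rfl
    exact hε (by simpa using h)
  -- Fixing u and multiplying v and w by β preserves [u,v] = w and [w,u] = v, and turns [v,w] = ε' u
  -- into [v,w] = β² ε' u.
  let w : ℕ × Fin 3 → Kˣ := fun p => ![1, Units.mk0 β hβ, Units.mk0 β hβ] p.2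
  let φ : n1 ε ≃ₗ[K] n1 ε' := (n1Basis ε).equiv ((n1Basis ε').unitsSMul w) (Equiv.refl _)
  have hφ : ∀ k i, φ (n1Vec ε k i) = (w (k, i) : K) • n1Vec ε' k i := fun k i => by
    have := (n1Basis ε).equiv_apply (k, i) ((n1Basis ε').unitsSMul w) (Equiv.refl _)
    rwa [n1Basis_apply, Equiv.refl_apply, Module.Basis.unitsSMul_apply, n1Basis_apply] at this
  have φ0 : ∀ k, φ (n1Vec ε k 0) = n1Vec ε' k 0 := fun k => by simpa [w] using hφ k 0
  have φ1 : ∀ k, φ (n1Vec ε k 1) = β • n1Vec ε' k 1 := fun k => by simpa [w] using hφ k 1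
  have φ2 : ∀ k, φ (n1Vec ε k 2) = β • n1Vec ε' k 2 := fun k => by simpa [w] using hφ k 2
  refine nonempty_lieEquiv_of_generators (n1Basis ε) φ (x := n1Vec ε 0 0) (y := n1Vec ε 0 1)
    (fun H h0 h1 p => n1Basis_apply ε p ▸ n1_gen hε H h0 h1 p) ?_ ?_
  · rintro ⟨k, i⟩
    rw [n1Basis_apply]
    fin_cases i
    · change φ ⁅n1Vec ε 0 0, n1Vec ε k 0⁆ = ⁅φ (n1Vec ε 0 0), φ (n1Vec ε k 0)⁆
      rw [n1Vec_lie_self, φ0, φ0, n1Vec_lie_self, map_zero]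
    · change φ ⁅n1Vec ε 0 0, n1Vec ε k 1⁆ = ⁅φ (n1Vec ε 0 0), φ (n1Vec ε k 1)⁆
      rw [n1Vec_lie_zero_one, φ0, φ1, φ2, lie_smul, n1Vec_lie_zero_one]
    · change φ ⁅n1Vec ε 0 0, n1Vec ε k 2⁆ = ⁅φ (n1Vec ε 0 0), φ (n1Vec ε k 2)⁆
      rw [n1Vec_lie_zero_two, map_neg, φ0, φ2, φ1, lie_smul, n1Vec_lie_zero_two, smul_neg]
  · rintro ⟨k, i⟩
    rw [n1Basis_apply]
    fin_cases i
    · change φ ⁅n1Vec ε 0 1, n1Vec ε k 0⁆ = ⁅φ (n1Vec ε 0 1), φ (n1Vec ε k 0)⁆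
      rw [n1Vec_lie_one_zero, map_neg, φ0, φ1, φ2, smul_lie, n1Vec_lie_one_zero, smul_neg]
    · change φ ⁅n1Vec ε 0 1, n1Vec ε k 1⁆ = ⁅φ (n1Vec ε 0 1), φ (n1Vec ε k 1)⁆
      rw [n1Vec_lie_self, φ1, φ1, smul_lie, lie_smul, n1Vec_lie_self, map_zero, smul_zero,
        smul_zero]
    · change φ ⁅n1Vec ε 0 1, n1Vec ε k 2⁆ = ⁅φ (n1Vec ε 0 1), φ (n1Vec ε k 2)⁆
      rw [n1Vec_lie_one_two, map_smul, φ1, φ2, φ0, smul_lie, lie_smul, n1Vec_lie_one_two, smul_smul,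
        smul_smul, h]
      congr 1
      ring

/-- The images of the w-monomials span whole components, so they are nonzero. The images of the u-
and v-monomials share a degree and are separated by ad a, which kills the first, and ad b, which
kills the second. -/
theorem Frame.nonempty_equiv_n1 [CharZero K] [GradedLieAlgebra 𝒜] (F : Frame 𝒜 a b) (hε : ε ≠ 0)
    (h1 : ⁅a, ⁅b, ⁅a, b⁆⁆⁆ = 0) (h2 : ⁅b, ⁅b, ⁅a, b⁆⁆⁆ = ε • ⁅a, ⁅a, ⁅a, b⁆⁆⁆) :
    Nonempty (g ≃ₗ⁅K⁆ n1 ε) := by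
  have hL := F.isLoop hε h1 h2
  have hW : ∀ k, loopVec ε a b k 2 ≠ 0 := fun k h0 => by
    have := (hL k).s2
    rw [h0, Submodule.span_zero_singleton] at this
    exact F.ne_bot _ (by omega) (le_bot_iff.1 this)
  have hE : LinearIndependent K (fun p : ℕ × Fin 3 => loopVec ε a b p.1 p.2) := by
    refine linearIndependent_of_degree (𝒜 := 𝒜) (deg := fun p => n1Exp p.1 p.2) ?_ ?_
    · rintro ⟨k, i⟩
      fin_cases i
      exacts [(hL k).m0, (hL k).m1, (hL k).m2]
    · rintro ⟨k, i⟩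
      have e0 : ∀ k, n1Exp k 0 = 2 * k + 1 := fun _ => rfl
      have e1 : ∀ k, n1Exp k 1 = 2 * k + 1 := fun _ => rfl
      have e2 : ∀ k, n1Exp k 2 = 2 * k + 2 := fun _ => rfl
      fin_cases i
      · refine ⟨LinearMap.ker (LieModule.toEnd K g g b : g →ₗ[K] g), ?_, ?_⟩
        · simpa [(hL k).b0] using hW k
        · rintro ⟨l, j⟩ hn hd
          fin_cases j
          · simp [e0] at hd hn
            exact absurd hd hn
          · simp [(hL l).b1]
          · simp [e0, e2] at hd
            omega
      · refine ⟨LinearMap.ker (LieModule.toEnd K g g a : g →ₗ[K] g), ?_, ?_⟩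
        · simpa [(hL k).a1] using hW k
        · rintro ⟨l, j⟩ hn hd
          fin_cases j
          · simp [(hL l).a0]
          · simp [e1] at hd hn
            exact absurd hd hn
          · simp [e1, e2] at hd
            omega
      · refine ⟨⊥, by simpa using hW k, ?_⟩
        rintro ⟨l, j⟩ hn hd
        fin_cases j
        · simp [e0, e2] at hd
          omega
        · simp [e1, e2] at hd
          omega
        · simp [e2] at hd hn
          exact absurd hd hn
  have hc : ∀ k i, (n1Basis ε).constr K (fun p : ℕ × Fin 3 => loopVec ε a b p.1 p.2)
      (n1Vec ε k i) = loopVec ε a b k i := fun k i => by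
    have := (n1Basis ε).constr_basis K (fun p : ℕ × Fin 3 => loopVec ε a b p.1 p.2) (k, i)
    rwa [n1Basis_apply] at this
  refine F.nonempty_lieEquiv (n1Basis ε) hE (p := (0, 0)) (q := (0, 1)) rfl rfl
    (fun H h0 h1 p => ?_) ?_ ?_
  · rw [n1Basis_apply] at *
    exact n1_gen hε H h0 h1 p
  · rintro ⟨k, i⟩
    rw [n1Basis_apply, n1Basis_apply]
    fin_cases i
    · change _ = ⁅a, loopVec ε a b k 0⁆
      rw [(hL k).a0]
      exact (congrArg _ (n1Vec_lie_self ε 0 k 0)).trans (map_zero _)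
    · change _ = ⁅a, loopVec ε a b k 1⁆
      rw [(hL k).a1, ← hc k 2]
      exact congrArg _ ((n1Vec_lie_zero_one ε 0 k).trans (by rw [zero_add]))
    · change _ = ⁅a, loopVec ε a b k 2⁆
      rw [lie_left_loopVec_two, ← hc (k + 1) 1, ← map_neg]
      exact congrArg _ ((n1Vec_lie_zero_two ε 0 k).trans (by rw [zero_add]))
  · rintro ⟨k, i⟩
    rw [n1Basis_apply, n1Basis_apply]
    fin_cases i
    · change _ = ⁅b, loopVec ε a b k 0⁆
      rw [(hL k).b0, ← hc k 2, ← map_neg]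
      exact congrArg _ ((n1Vec_lie_one_zero ε 0 k).trans (by rw [zero_add]))
    · change _ = ⁅b, loopVec ε a b k 1⁆
      rw [(hL k).b1]
      exact (congrArg _ (n1Vec_lie_self ε 0 k 1)).trans (map_zero _)
    · change _ = ⁅b, loopVec ε a b k 2⁆
      rw [lie_right_loopVec_two hε, ← hc (k + 1) 0, ← map_smul]
      exact congrArg _ ((n1Vec_lie_one_two ε 0 k).trans (by rw [zero_add]))

/-- The classification over a field of characteristic zero. -/
theorem IsNarrow.classification [CharZero K] [GradedLieAlgebra 𝒜] (h : IsNarrow 𝒜)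
    (hinf : ¬ FiniteDimensional K g) :
    (∃ ε : K, ε ≠ 0 ∧ Nonempty (g ≃ₗ⁅K⁆ n1 ε)) ∨ Nonempty (g ≃ₗ⁅K⁆ (n2 K).Algebra) ∨
      Nonempty (g ≃ₗ⁅K⁆ (n23 K).Algebra) ∨ Nonempty (g ≃ₗ⁅K⁆ (m0 K).Algebra) ∨
      ∃ S : OddSet, S.1.Nonempty ∧ Nonempty (g ≃ₗ⁅K⁆ (m0S K S).Algebra) := by
  obtain ⟨a, b, F⟩ := h.exists_frame hinf
  obtain ⟨a, b, ε, F, -, h1, h2⟩ := F.exists_diagonal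
  by_cases hε : ε = 0
  · right
    rw [hε, zero_smul] at h2
    -- The form is degenerate: z_0 = [b,b] = 0, and z_1 = [b,[a,b]] is killed by a and b.
    have hk : Killed a b 1 := by
      intro m hm
      interval_cases m
      · simp [chain_zero]
      · exact ⟨h1, h2⟩
    rcases F.killed_or hk with hall | ⟨a, F, hk, h5⟩
    · right; right
      by_cases hS : (centralDegrees a b).Nonempty
      · exact Or.inr ⟨centralOddSet K hall, hS, F.nonempty_equiv_m0S hall⟩
      · exact Or.inl (F.nonempty_equiv_m0 hall hS)
    · by_cases hz : ⁅b, ⁅a, b⁆⁆ = 0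
      · exact Or.inl (F.nonempty_equiv_n2 hk h5 hz)
      · exact Or.inr (Or.inl (F.nonempty_equiv_n23 hk h5 hz))
  · exact Or.inl ⟨ε, hε, F.nonempty_equiv_n1 hε h1 h2⟩

end LoopModel


/-! ### Invariants -/

section Invariants

variable (L : Type*) [LieRing L]

/-- The second derived algebra is central. -/
def IsMetaCentral : Prop := ∀ x y z u v : L, ⁅x, ⁅⁅y, z⁆, ⁅u, v⁆⁆⁆ = 0

/-- An identity of three-dimensional simple Lie algebras. -/
def IsCrossLike : Prop := ∀ x y z : L, ⁅x, ⁅⁅x, y⁆, ⁅x, z⁆⁆⁆ = 0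

/-- The center is trivial. -/
def IsCenterless : Prop := ∀ x : L, (∀ y : L, ⁅y, x⁆ = 0) → x = 0

/-- No element acts with a nontrivial Jordan block for the eigenvalue zero. -/
def IsAnisotropic : Prop := ∀ x y : L, ⁅x, ⁅x, y⁆⁆ = 0 → ⁅x, y⁆ = 0

variable {L} in
theorem IsMetaCentral.isCrossLike (h : IsMetaCentral L) : IsCrossLike L :=
  fun x y z => h x x y x z

variable {K : Type*} [Field K] [LieAlgebra K L]

variable (K) in
/-- The lower central series. -/
def lowerSeries : ℕ → Submodule K L
  | 0 => ⊤
  | k + 1 => Submodule.span K {z | ∃ x : L, ∃ y ∈ lowerSeries k, ⁅x, y⁆ = z}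

variable (K) in
/-- There is a central element that lies in the `r`-th term of the lower central series (counted
from one) but not in the next one. -/
def HasCentral (r : ℕ) : Prop :=
  ∃ x : L, (∀ y : L, ⁅y, x⁆ = 0) ∧ x ∈ lowerSeries L K (r - 1) ∧ x ∉ lowerSeries L K r

variable {L}

theorem lie_mem_lowerSeries {k : ℕ} (x : L) {y : L} (hy : y ∈ lowerSeries L K k) :
    ⁅x, y⁆ ∈ lowerSeries L K (k + 1) := Submodule.subset_span ⟨x, y, hy, rfl⟩

theorem lowerSeries_succ_le (k : ℕ) : lowerSeries L K (k + 1) ≤ lowerSeries L K k := by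
  induction k with
  | zero => exact le_top
  | succ k ih =>
    refine Submodule.span_mono ?_
    rintro _ ⟨x, y, hy, rfl⟩
    exact ⟨x, y, ih hy, rfl⟩

theorem lowerSeries_antitone : Antitone (lowerSeries L K) :=
    antitone_nat_of_succ_le lowerSeries_succ_le

variable {L' : Type*} [LieRing L'] [LieAlgebra K L']

theorem map_mem_lowerSeries (e : L ≃ₗ⁅K⁆ L') (k : ℕ) (x : L) (hx : x ∈ lowerSeries L K k) :
    e x ∈ lowerSeries L' K k := by
  induction k generalizing x with
  | zero => exact Submodule.mem_top
  | succ k ih =>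
    have : lowerSeries L K (k + 1) ≤
        (lowerSeries L' K (k + 1)).comap (e.toLinearEquiv : L →ₗ[K] L') := by
      refine Submodule.span_le.2 ?_
      rintro _ ⟨x, y, hy, rfl⟩
      change e ⁅x, y⁆ ∈ lowerSeries L' K (k + 1)
      rw [LieEquiv.map_lie]
      exact lie_mem_lowerSeries _ (ih y hy)
    exact this hx

theorem map_mem_lowerSeries_iff (e : L ≃ₗ⁅K⁆ L') (k : ℕ) (x : L) :
    e x ∈ lowerSeries L' K k ↔ x ∈ lowerSeries L K k :=
  ⟨fun h => by simpa using map_mem_lowerSeries e.symm k _ h, map_mem_lowerSeries e k x⟩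

theorem map_eq_zero_iff_of_equiv (e : L ≃ₗ⁅K⁆ L') (x : L) : e x = 0 ↔ x = 0 :=
  e.toLinearEquiv.map_eq_zero_iff

theorem forall_lie_map_iff (e : L ≃ₗ⁅K⁆ L') (x : L) :
    (∀ y : L', ⁅y, e x⁆ = 0) ↔ ∀ y : L, ⁅y, x⁆ = 0 := by
  constructor
  · intro h y
    rw [← map_eq_zero_iff_of_equiv e, LieEquiv.map_lie, h]
  · intro h y
    rw [← e.apply_symm_apply y, ← LieEquiv.map_lie, h, map_eq_zero_iff_of_equiv]

theorem IsMetaCentral.congr (e : L ≃ₗ⁅K⁆ L') (h : IsMetaCentral L') : IsMetaCentral L :=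
  fun x y z u v => by
    rw [← map_eq_zero_iff_of_equiv e]
    simp only [LieEquiv.map_lie]
    exact h _ _ _ _ _

theorem IsCrossLike.congr (e : L ≃ₗ⁅K⁆ L') (h : IsCrossLike L') : IsCrossLike L :=
  fun x y z => by
    rw [← map_eq_zero_iff_of_equiv e]
    simp only [LieEquiv.map_lie]
    exact h _ _ _

theorem IsCenterless.congr (e : L ≃ₗ⁅K⁆ L') (h : IsCenterless L') : IsCenterless L :=
  fun x hx => (map_eq_zero_iff_of_equiv e x).1 (h _ ((forall_lie_map_iff e x).2 hx))

theorem IsAnisotropic.congr (e : L ≃ₗ⁅K⁆ L') (h : IsAnisotropic L') : IsAnisotropic L :=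
  fun x y hxy => by
    rw [← map_eq_zero_iff_of_equiv e] at hxy ⊢
    simp only [LieEquiv.map_lie] at hxy ⊢
    exact h _ _ hxy

theorem HasCentral.congr (e : L ≃ₗ⁅K⁆ L') {r : ℕ} (h : HasCentral L K r) : HasCentral L' K r := by
  obtain ⟨x, h1, h2, h3⟩ := h
  exact ⟨e x, (forall_lie_map_iff e x).2 h1, (map_mem_lowerSeries_iff e _ x).2 h2,
    fun h => h3 ((map_mem_lowerSeries_iff e _ x).1 h)⟩

/-- Only B i contributes to the j-th coordinate of [z, x]. For a central x, this coordinate being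
zero then forces the i-th coordinate of x to vanish, which is how centers are computed below. -/
theorem repr_lie_eq {ι : Type*} (B : Module.Basis ι K L) (z x : L) {i j : ι}
    (h : ∀ k, k ≠ i → B.repr ⁅z, B k⁆ j = 0) :
    B.repr ⁅z, x⁆ j = B.repr x i * B.repr ⁅z, B i⁆ j := by
  classical
  have : B.coord j ∘ₗ (LieModule.toEnd K L L z : L →ₗ[K] L)
      = B.repr ⁅z, B i⁆ j • B.coord i := by
    refine B.ext fun k => ?_
    by_cases hk : k = i
    · subst hk
      simp
    · simp [h k hk, hk]
  have := LinearMap.congr_fun this x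
  simpa [mul_comm] using this

theorem repr_eq_zero_of_central {ι : Type*} (B : Module.Basis ι K L) {z x : L} {i j : ι}
    (hx : ∀ y : L, ⁅y, x⁆ = 0) (h : ∀ k, k ≠ i → B.repr ⁅z, B k⁆ j = 0)
    (h' : B.repr ⁅z, B i⁆ j ≠ 0) : B.repr x i = 0 := by
  have := repr_lie_eq B z x h
  rw [hx, map_zero, Finsupp.zero_apply] at this
  exact (mul_eq_zero.1 this.symm).resolve_right h'

theorem lie_mem_of_mem_span {s t : Set L} {M : Submodule K L}
    (h : ∀ x ∈ s, ∀ y ∈ t, ⁅x, y⁆ ∈ M) {x y : L} (hx : x ∈ Submodule.span K s)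
    (hy : y ∈ Submodule.span K t) : ⁅x, y⁆ ∈ M := by
  induction hx using Submodule.span_induction with
  | zero => rw [zero_lie]; exact zero_mem _
  | add a b _ _ ha hb => rw [add_lie]; exact add_mem ha hb
  | smul c a _ ha => rw [smul_lie]; exact M.smul_mem _ ha
  | mem a ha =>
  induction hy using Submodule.span_induction with
  | zero => rw [lie_zero]; exact zero_mem _
  | add c b _ _ hc hb => rw [lie_add]; exact add_mem hc hb
  | smul d c _ hc => rw [lie_smul]; exact M.smul_mem _ hc
  | mem b hb => exact h a ha b hb

end Invariants

/-! ### Invariants of n_1^± -/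

section Loop

variable {K : Type*} [Field K]

/-- Evaluation of polynomial loops. -/
def loopEval (ε t : K) : K[X] ⊗[K] UVW ε →ₗ[K] UVW ε :=
  TensorProduct.lift (LinearMap.lsmul K (UVW ε) ∘ₗ Polynomial.leval t)

theorem loopEval_tmul (ε t : K) (p : K[X]) (v : UVW ε) :
    loopEval ε t (p ⊗ₜ[K] v) = p.eval t • v := rfl

theorem loopEval_lie (ε t : K) (x y : K[X] ⊗[K] UVW ε) :
    loopEval ε t ⁅x, y⁆ = ⁅loopEval ε t x, loopEval ε t y⁆ := by
  induction x using TensorProduct.induction_on with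
  | zero => exact (congrArg (loopEval ε t) (zero_lie y)).trans (by simp)
  | add x x' hx hx' =>
    refine (congrArg (loopEval ε t) (add_lie x x' y)).trans ?_
    rw [map_add, map_add, add_lie, ← hx, ← hx']
  | tmul p v =>
  induction y using TensorProduct.induction_on with
  | zero => exact (congrArg (loopEval ε t) (lie_zero (p ⊗ₜ[K] v))).trans (by simp)
  | add y y' hy hy' =>
    refine (congrArg (loopEval ε t) (lie_add (p ⊗ₜ[K] v) y y')).trans ?_
    rw [map_add, map_add, lie_add, ← hy, ← hy']
  | tmul q w =>
    rw [LieAlgebra.ExtendScalars.bracket_tmul, loopEval_tmul, loopEval_tmul, loopEval_tmul,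
      smul_lie, lie_smul, smul_smul, Polynomial.eval_mul]

/-- The coordinate polynomials of a polynomial loop. -/
def loopCoord (ε : K) (i : Fin 3) : K[X] ⊗[K] UVW ε →ₗ[K] K[X] :=
  TensorProduct.lift ((LinearMap.lsmul K K[X]).flip.compl₂ ((uvwBasis ε).coord i))

theorem loopCoord_tmul (ε : K) (i : Fin 3) (p : K[X]) (v : UVW ε) :
    loopCoord ε i (p ⊗ₜ[K] v) = (uvwBasis ε).repr v i • p := rfl

theorem eval_loopCoord (ε t : K) (i : Fin 3) (x : K[X] ⊗[K] UVW ε) :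
    (loopCoord ε i x).eval t = (uvwBasis ε).repr (loopEval ε t x) i := by
  induction x using TensorProduct.induction_on with
  | zero => simp
  | add x y hx hy => simp [hx, hy]
  | tmul p v => simp [loopCoord_tmul, loopEval_tmul, mul_comm]

theorem sum_loopCoord (ε : K) (x : K[X] ⊗[K] UVW ε) :
    ∑ i, loopCoord ε i x ⊗ₜ[K] uvwBasis ε i = x := by
  induction x using TensorProduct.induction_on with
  | zero => simp
  | add x y hx hy =>
    simp only [map_add, TensorProduct.add_tmul, Finset.sum_add_distrib, hx, hy]
  | tmul p v =>
    conv_rhs => rw [← (uvwBasis ε).sum_repr v, TensorProduct.tmul_sum]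
    refine Finset.sum_congr rfl fun i _ => ?_
    rw [loopCoord_tmul, TensorProduct.smul_tmul]

/-- A polynomial over an infinite field is determined by its values. So identities of the
three-dimensional algebra pass to its polynomial loops. -/
theorem eq_zero_of_loopEval [Infinite K] {ε : K} {x : K[X] ⊗[K] UVW ε}
    (h : ∀ t, loopEval ε t x = 0) : x = 0 := by
  rw [← sum_loopCoord ε x]
  refine Finset.sum_eq_zero fun i _ => ?_
  have : loopCoord ε i x = 0 := Polynomial.funext fun t => by
    rw [eval_loopCoord, h, map_zero, Polynomial.eval_zero, Finsupp.zero_apply]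
  rw [this, TensorProduct.zero_tmul]

/-- For every ε, [[x,y],[x,z]] is ε det(x,y,z) x, which commutes with x. -/
theorem UVW.isCrossLike (ε : K) : IsCrossLike (UVW ε) := by
  intro x y z
  change cross ε x (cross ε (cross ε x y) (cross ε x z)) = 0
  funext i
  fin_cases i <;> simp [cross] <;> first | ring1 | (right; ring1)

theorem isCrossLike_n1 [Infinite K] (ε : K) : IsCrossLike (n1 ε) := fun x y z => by
  refine Subtype.ext (eq_zero_of_loopEval fun t => ?_)
  change loopEval ε t ⁅x.1, ⁅⁅x.1, y.1⁆, ⁅x.1, z.1⁆⁆⁆ = 0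
  simp only [loopEval_lie]
  exact UVW.isCrossLike ε _ _ _

/-- For the Euclidean cross product, pairing x × (x × y) = 0 with y gives |x × y|² = 0. -/
theorem UVW.isAnisotropic : IsAnisotropic (UVW (1 : ℝ)) := by
  intro x y h
  change cross 1 x y = 0
  change cross 1 x (cross 1 x y) = 0 at h
  have h0 := congrFun h 0
  have h1 := congrFun h 1
  have h2 := congrFun h 2
  simp [cross] at h0 h1 h2
  have key : (x 1 * y 2 - x 2 * y 1) ^ 2 + (x 2 * y 0 - x 0 * y 2) ^ 2
      + (x 0 * y 1 - x 1 * y 0) ^ 2 = 0 := by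
    linear_combination -(y 0) * h0 - y 1 * h1 - y 2 * h2
  have k0 : x 1 * y 2 - x 2 * y 1 = 0 := by
    have := sq_nonneg (x 1 * y 2 - x 2 * y 1)
    have := sq_nonneg (x 2 * y 0 - x 0 * y 2)
    have := sq_nonneg (x 0 * y 1 - x 1 * y 0)
    exact pow_eq_zero_iff two_ne_zero |>.1 (by linarith)
  have k1 : x 2 * y 0 - x 0 * y 2 = 0 := by
    have := sq_nonneg (x 1 * y 2 - x 2 * y 1)
    have := sq_nonneg (x 2 * y 0 - x 0 * y 2)
    have := sq_nonneg (x 0 * y 1 - x 1 * y 0)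
    exact pow_eq_zero_iff two_ne_zero |>.1 (by linarith)
  have k2 : x 0 * y 1 - x 1 * y 0 = 0 := by
    rw [k0, k1] at key
    exact pow_eq_zero_iff two_ne_zero |>.1 (by linarith)
  funext i
  fin_cases i
  · simpa [cross] using k0
  · simpa [cross] using k1
  · simpa [cross] using k2

theorem isAnisotropic_n1 : IsAnisotropic (n1 (1 : ℝ)) := fun x y h => by
  refine Subtype.ext (eq_zero_of_loopEval fun t => ?_)
  have h' : ⁅x.1, ⁅x.1, y.1⁆⁆ = 0 := congrArg Subtype.val h
  change loopEval 1 t ⁅x.1, y.1⁆ = 0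
  rw [loopEval_lie]
  apply UVW.isAnisotropic
  rw [← loopEval_lie, ← loopEval_lie, h', map_zero]

theorem n1Vec_ne_zero (ε : K) (k : ℕ) (i : Fin 3) : n1Vec ε k i ≠ 0 :=
  n1Basis_apply ε (k, i) ▸ (n1Basis ε).ne_zero (k, i)

/-- For ε = -1 one has [u + v, w] = -(u + v), so x = (u + v) ⊗ t and y = w ⊗ t² are a
counterexample. -/
theorem not_isAnisotropic_n1 : ¬ IsAnisotropic (n1 (-1 : K)) := by
  intro h
  have h1 : ⁅n1Vec (-1 : K) 0 0 + n1Vec (-1 : K) 0 1, n1Vec (-1 : K) 0 2⁆ =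
      -(n1Vec (-1 : K) 1 0 + n1Vec (-1 : K) 1 1) := by
    rw [add_lie, n1Vec_lie_zero_two, n1Vec_lie_one_two]
    module
  have h2 := h (n1Vec (-1 : K) 0 0 + n1Vec (-1 : K) 0 1) (n1Vec (-1 : K) 0 2) (by
    rw [h1, lie_neg, lie_add, add_lie, add_lie, n1Vec_lie_self, n1Vec_lie_self, n1Vec_lie_zero_one,
      n1Vec_lie_one_zero]
    module)
  rw [h1, neg_eq_zero] at h2
  have h3 := congrArg (fun x => ⁅n1Vec (-1 : K) 0 0, x⁆) h2
  simp only [lie_add, n1Vec_lie_self, n1Vec_lie_zero_one, zero_add, lie_zero] at h3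
  exact n1Vec_ne_zero _ _ _ h3

/-- Witnessed by [v,[[w,u],[u,v]]] = [v,[v,w]] = -ε w, with powers of t omitted. -/
theorem not_isMetaCentral_n1 {ε : K} (hε : ε ≠ 0) : ¬ IsMetaCentral (n1 ε) := by
  intro h
  have := h (n1Vec ε 0 1) (n1Vec ε 0 2) (n1Vec ε 0 0) (n1Vec ε 0 0) (n1Vec ε 0 1)
  rw [n1Vec_lie_two_zero, n1Vec_lie_zero_one, n1Vec_lie_one_two, lie_smul, n1Vec_lie_one_zero,
    smul_neg, neg_eq_zero] at this
  exact smul_ne_zero hε (n1Vec_ne_zero _ _ _) this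

end Loop


/-! ### Invariants of the algebras given by structure constants -/

section Profiles

variable {K : Type*} [Field K] {ι : Type*} (s : LieConstants K ι)

theorem LieConstants.repr_lie (i j : ι) : s.basis.repr ⁅s.basis i, s.basis j⁆ = s.c i j := by
  rw [s.basis_apply, s.basis_apply, s.lie_e_eq_of]
  exact s.of.symm_apply_apply (s.c i j)

theorem LieConstants.lie_basis_mem_span {P : Set ι} {i j : ι} (h : ∀ k, k ∉ P → s.c i j k = 0) :
    ⁅s.basis i, s.basis j⁆ ∈ Submodule.span K (s.basis '' P) := by
  rw [Module.Basis.mem_span_image, s.repr_lie]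
  intro k hk
  by_contra hP
  exact Finsupp.mem_support_iff.1 hk (h k hP)

theorem LieConstants.lie_eq_zero_of_basis {x : s.Algebra} (h : ∀ i, ⁅s.basis i, x⁆ = 0)
    (y : s.Algebra) : ⁅y, x⁆ = 0 := by
  have hy : y ∈ Submodule.span K (Set.range s.basis) := s.basis.span_eq ▸ Submodule.mem_top
  induction hy using Submodule.span_induction with
  | zero => exact zero_lie x
  | add a b _ _ ha hb => rw [add_lie, ha, hb, add_zero]
  | smul c a _ ha => rw [smul_lie, ha, smul_zero]
  | mem a ha =>
    obtain ⟨i, rfl⟩ := ha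
    exact h i

theorem LieConstants.lie_basis_eq_zero {j : ι} (h : ∀ i, s.c i j = 0) (y : s.Algebra) :
    ⁅y, s.basis j⁆ = 0 :=
  s.lie_eq_zero_of_basis (fun i => s.basis.repr.injective (by rw [s.repr_lie, h, map_zero])) y

/-- Brackets avoid the basis vector i₀, brackets of such vectors lie in the span of P, and P is
central. For m_0 and m_0^S, i₀ is e_1 and P consists of the z_r. -/
theorem LieConstants.isMetaCentral {i₀ : ι} {P : Set ι} (h₁ : ∀ i j, s.c i j i₀ = 0)
    (h₂ : ∀ i j, i ≠ i₀ → j ≠ i₀ → ∀ k, k ∉ P → s.c i j k = 0)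
    (h₃ : ∀ i, ∀ k ∈ P, s.c i k = 0) : IsMetaCentral s.Algebra := by
  have hD : ∀ y z : s.Algebra, ⁅y, z⁆ ∈ Submodule.span K (s.basis '' {i₀}ᶜ) := fun y z =>
    lie_mem_of_mem_span (s := Set.range s.basis) (t := Set.range s.basis) (by
      rintro _ ⟨i, rfl⟩ _ ⟨j, rfl⟩
      refine s.lie_basis_mem_span fun k hk => ?_
      rw [Set.mem_compl_iff, not_not, Set.mem_singleton_iff] at hk
      rw [hk, h₁]) (s.basis.span_eq ▸ Submodule.mem_top) (s.basis.span_eq ▸ Submodule.mem_top)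
  intro x y z u v
  have h : ⁅⁅y, z⁆, ⁅u, v⁆⁆ ∈ Submodule.span K (s.basis '' P) :=
    lie_mem_of_mem_span (by
      rintro _ ⟨i, hi, rfl⟩ _ ⟨j, hj, rfl⟩
      exact s.lie_basis_mem_span (h₂ i j hi hj)) (hD y z) (hD u v)
  generalize ⁅⁅y, z⁆, ⁅u, v⁆⁆ = w at h ⊢
  induction h using Submodule.span_induction with
  | zero => exact lie_zero x
  | add a b _ _ ha hb => rw [lie_add, ha, hb, add_zero]
  | smul c a _ ha => rw [lie_smul, ha, smul_zero]
  | mem a ha =>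
    obtain ⟨k, hk, rfl⟩ := ha
    exact s.lie_basis_eq_zero (fun i => h₃ i k hk) x

theorem LieConstants.repr_eq_zero_of_central {x : s.Algebra} (hx : ∀ y : s.Algebra, ⁅y, x⁆ = 0)
    {l i j : ι} (h : ∀ k, k ≠ i → s.c l k j = 0) (h' : s.c l i j ≠ 0) : s.basis.repr x i = 0 :=
  NarrowLie.repr_eq_zero_of_central s.basis (z := s.basis l) (j := j) hx
    (fun k hk => by rw [s.repr_lie, h k hk]) (by rwa [s.repr_lie])

/-- For a positive grading every bracket raises the degree by at least one. -/
theorem LieConstants.lowerSeries_le {deg : ι → ℕ} (hpos : ∀ i, 1 ≤ deg i)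
    (h : ∀ i j k, s.c i j k ≠ 0 → deg k = deg i + deg j) (n : ℕ) :
    lowerSeries s.Algebra K n ≤ Submodule.span K (s.basis '' {l | n < deg l}) := by
  induction n with
  | zero =>
    have : {l : ι | 0 < deg l} = Set.univ := Set.eq_univ_of_forall hpos
    rw [this, Set.image_univ, s.basis.span_eq]
    exact le_top
  | succ n ih =>
    refine Submodule.span_le.2 ?_
    rintro _ ⟨x, y, hy, rfl⟩
    refine lie_mem_of_mem_span (s := Set.range s.basis) ?_ (s.basis.span_eq ▸ Submodule.mem_top)
      (ih hy)
    rintro _ ⟨i, rfl⟩ _ ⟨j, hj, rfl⟩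
    refine s.lie_basis_mem_span fun k hk => ?_
    by_contra hc
    have h1 := h i j k hc
    have h2 := hpos i
    have h3 : n < deg j := hj
    have h4 : ¬ n + 1 < deg k := hk
    omega

theorem mapDomain_add_apply_inl {α β : Type*} (x : α →₀ K) (y : β →₀ K) (k : α) :
    (x.mapDomain Sum.inl + y.mapDomain Sum.inr : α ⊕ β →₀ K) (.inl k) = x k := by
  rw [Finsupp.add_apply, Finsupp.mapDomain_apply Sum.inl_injective,
    Finsupp.mapDomain_of_notMem_range,
    add_zero]
  rintro ⟨_, h⟩
  cases h

theorem mapDomain_add_apply_inr {α β : Type*} (x : α →₀ K) (y : β →₀ K) (k : β) :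
    (x.mapDomain Sum.inl + y.mapDomain Sum.inr : α ⊕ β →₀ K) (.inr k) = y k := by
  rw [Finsupp.add_apply, Finsupp.mapDomain_apply Sum.inr_injective,
    Finsupp.mapDomain_of_notMem_range,
    zero_add]
  rintro ⟨_, h⟩
  cases h

theorem m0_c_apply_one (i j : ℕ+) : (m0 K).c i j 1 = 0 :=
  Finsupp.single_eq_of_ne (add_ne_one i j).symm

theorem m0_c_eq_zero {i j : ℕ+} (hi : i ≠ 1) (hj : j ≠ 1) : (m0 K).c i j = 0 := by
  simp only [m0, widthOne, m0Coeff_eq, hi, hj, if_false, Finsupp.single_zero]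

theorem m0_c_one_apply {n : ℕ} {k : ℕ+} (hk : k ≠ (n + 1).succPNat) :
    (m0 K).c 1 k (n + 2).succPNat = 0 := by
  obtain ⟨m, rfl⟩ := exists_succPNat k
  rcases m with _ | m
  · exact congrArg (fun f : ℕ+ →₀ K => f (n + 2).succPNat) ((m0 K).c_self 1)
  · rw [m0_c_one]
    refine Finsupp.single_eq_of_ne fun h => hk ?_
    have := Nat.succPNat_inj.1 h
    rw [show m = n by omega]

theorem isMetaCentral_m0 : IsMetaCentral (m0 K).Algebra :=
  (m0 K).isMetaCentral (i₀ := 1) (P := ∅) m0_c_apply_one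
    (fun i j hi hj k _ => by rw [m0_c_eq_zero hi hj, Finsupp.zero_apply]) fun _ _ h => h.elim

/-- The coordinate at e_1 is detected by ad e_2, all other coordinates by ad e_1. -/
theorem isCenterless_m0 : IsCenterless (m0 K).Algebra := by
  intro x hx
  refine (m0 K).basis.repr.injective (Finsupp.ext fun i => ?_)
  rw [map_zero, Finsupp.zero_apply]
  obtain ⟨k, rfl⟩ := exists_succPNat i
  rcases k with _ | n
  · refine (m0 K).repr_eq_zero_of_central hx (l := 2) (j := Nat.succPNat 2)
      (fun k hk => by rw [m0_c_eq_zero (by decide) hk, Finsupp.zero_apply]) ?_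
    rw [← one_eq_succPNat, m0_c_two_one, Finsupp.single_eq_same]
    exact neg_ne_zero.2 one_ne_zero
  · refine (m0 K).repr_eq_zero_of_central hx (l := 1) (j := (n + 2).succPNat)
      (fun k hk => m0_c_one_apply hk) ?_
    rw [m0_c_one, Finsupp.single_eq_same]
    exact one_ne_zero

theorem isMetaCentral_m0S (S : OddSet) : IsMetaCentral (m0S K S).Algebra := by
  refine (m0S K S).isMetaCentral (i₀ := .inl 1) (P := Set.range Sum.inr) ?_ ?_ ?_
  · rintro (i | i) (j | j)
    · rw [m0S_c_inl, mapDomain_add_apply_inl, m0_c_apply_one]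
    all_goals rfl
  · rintro (i | i) (j | j) hi hj (k | k) hk
    · rw [m0S_c_inl, mapDomain_add_apply_inl,
        m0_c_eq_zero (fun h => hi (h ▸ rfl)) (fun h => hj (h ▸ rfl)), Finsupp.zero_apply]
    · exact absurd ⟨k, rfl⟩ hk
    all_goals rfl
  · rintro i _ ⟨r, rfl⟩
    exact m0S_c_inr S i r

theorem lie_m0S_inr (S : OddSet) (r : S.1) (y : (m0S K S).Algebra) :
    ⁅y, (m0S K S).basis (.inr r)⁆ = 0 :=
  (m0S K S).lie_basis_eq_zero (fun i => m0S_c_inr S i r) y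

theorem not_isCenterless_m0S (S : OddSet) (hS : S.1.Nonempty) :
    ¬ IsCenterless (m0S K S).Algebra := by
  obtain ⟨r, hr⟩ := hS
  exact fun h => (m0S K S).basis.ne_zero (.inr ⟨r, hr⟩) (h _ (lie_m0S_inr S ⟨r, hr⟩))

theorem m0S_repr_inl_of_central (S : OddSet) {x : (m0S K S).Algebra}
    (hx : ∀ y : (m0S K S).Algebra, ⁅y, x⁆ = 0) (i : ℕ+) : (m0S K S).basis.repr x (.inl i) = 0 := by
  obtain ⟨k, rfl⟩ := exists_succPNat i
  rcases k with _ | n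
  · refine (m0S K S).repr_eq_zero_of_central hx (l := .inl 2) (j := .inl (Nat.succPNat 2)) ?_ ?_
    · rintro (k | k) hk
      · have hk' : k ≠ 1 := fun h => hk (h ▸ rfl)
        rw [m0S_c_inl, mapDomain_add_apply_inl, m0_c_eq_zero (by decide) hk', Finsupp.zero_apply]
      · rfl
    · rw [m0S_c_inl, mapDomain_add_apply_inl, ← one_eq_succPNat, m0_c_two_one,
        Finsupp.single_eq_same]
      exact neg_ne_zero.2 one_ne_zero
  · refine (m0S K S).repr_eq_zero_of_central hx (l := .inl 1) (j := .inl (n + 2).succPNat) ?_ ?_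
    · rintro (k | k) hk
      · rw [m0S_c_inl, mapDomain_add_apply_inl, m0_c_one_apply (fun h => hk (h ▸ rfl))]
      · rfl
    · rw [m0S_c_inl, mapDomain_add_apply_inl, m0_c_one, Finsupp.single_eq_same]
      exact one_ne_zero

theorem m0Cocycle_apply_ne_zero {S : OddSet} {i j : ℕ+} {r : S.1} (h : m0Cocycle K S i j r ≠ 0) :
    2 ≤ (i : ℕ) ∧ 2 ≤ (j : ℕ) ∧ (r : ℕ) + 2 = i + j := by
  unfold m0Cocycle at h
  split_ifs at h with h0
  · have h1 := Finsupp.single_apply_ne_zero.1 h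
    have h2 : (r : ℕ) = (i : ℕ) + j - 2 := congrArg Subtype.val h1.1
    have h3 : 2 ≤ (i : ℕ) := h0.1
    have h4 : 2 ≤ (j : ℕ) := h0.2.1
    omega
  · exact absurd rfl h

theorem one_le_filDegree (S : OddSet) (i : ℕ+ ⊕ S.1) : 1 ≤ filDegree S.1 i := by
  rcases i with i | r
  · exact le_max_left _ _
  · have := (S.2 r r.2).2
    rw [filDegree_inr]
    omega

theorem filDegree_of_c_ne_zero (S : OddSet) (i j k : ℕ+ ⊕ S.1) (h : (m0S K S).c i j k ≠ 0) :
    filDegree S.1 k = filDegree S.1 i + filDegree S.1 j := by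
  rcases i with i | i <;> rcases j with j | j
  · obtain ⟨m, rfl⟩ := exists_succPNat i
    obtain ⟨n, rfl⟩ := exists_succPNat j
    rcases k with k | r
    · rw [m0S_c_inl, mapDomain_add_apply_inl] at h
      simp only [m0, widthOne, m0Coeff_eq, succPNat_add, succPNat_eq_one_iff] at h
      obtain ⟨rfl, hc⟩ := Finsupp.single_apply_ne_zero.1 h
      rw [filDegree_inl, filDegree_inl, filDegree_inl]
      split_ifs at hc <;> first | omega | exact absurd rfl hc
    · rw [m0S_c_inl, mapDomain_add_apply_inr] at h
      have := m0Cocycle_apply_ne_zero h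
      rw [filDegree_inl, filDegree_inl, filDegree_inr]
      simp only [Nat.succPNat_coe] at this
      omega
  all_goals exact absurd rfl h

theorem m0S_basis_inl_mem (S : OddSet) (k : ℕ) :
    (m0S K S).basis (.inl (k + 1).succPNat) ∈ lowerSeries (m0S K S).Algebra K k := by
  induction k with
  | zero => exact Submodule.mem_top
  | succ k ih =>
    have := lie_mem_lowerSeries ((m0S K S).e (.inl 1)) ih
    rwa [LieConstants.basis_apply, m0S_lie_one] at this

theorem m0S_basis_inr_mem (S : OddSet) (r : S.1) :
    (m0S K S).basis (.inr r) ∈ lowerSeries (m0S K S).Algebra K (r - 1) := by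
  obtain ⟨r, hr⟩ := r
  obtain ⟨n, rfl⟩ : ∃ n, r = n + 2 := ⟨r - 2, by have := (S.2 r hr).2; omega⟩
  have := lie_mem_lowerSeries ((m0S K S).e (.inl 2)) (m0S_basis_inl_mem (K := K) S n)
  rw [LieConstants.basis_apply, m0S_lie_two S n hr, neg_mem_iff] at this
  exact this

/-- The center is spanned by the z_q, and z_q, of degree q, lies in the q-th term of the lower
central series but not in the next. So S can be recovered from the isomorphism class. -/
theorem hasCentral_m0S_iff (S : OddSet) (r : ℕ) : HasCentral (m0S K S).Algebra K r ↔ r ∈ S.1 := by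
  have hle := (m0S K S).lowerSeries_le (one_le_filDegree S) (filDegree_of_c_ne_zero S)
  constructor
  · rintro ⟨x, hx, h1, h2⟩
    by_contra hr
    refine h2 ?_
    have h3 := hle _ h1
    rw [Module.Basis.mem_span_image] at h3
    rw [← (m0S K S).basis.linearCombination_repr x, Finsupp.linearCombination_apply]
    refine sum_mem fun i hi => Submodule.smul_mem _ _ ?_
    rcases i with i | q
    · exact absurd (m0S_repr_inl_of_central S hx i) (Finsupp.mem_support_iff.1 hi)
    · have h4 : r - 1 < q := h3 hi
      have h5 := (S.2 q q.2).2
      have h6 : (q : ℕ) ≠ r := fun h => hr (h ▸ q.2)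
      exact lowerSeries_antitone (show r ≤ q - 1 by omega) (m0S_basis_inr_mem S q)
  · intro hr
    refine ⟨(m0S K S).basis (.inr ⟨r, hr⟩), lie_m0S_inr S _, m0S_basis_inr_mem S ⟨r, hr⟩,
      fun h => ?_⟩
    have h1 := hle _ h
    rw [Module.Basis.mem_span_image, Module.Basis.repr_self] at h1
    have h2 := h1 (Finsupp.mem_support_iff.2 (by rw [Finsupp.single_eq_same]; exact one_ne_zero))
    exact lt_irrefl r h2

/-- With x = e_1, y = e_2, z = e_4 the expression is [e_1, [e_3, -3 e_5]] = -3 e_9. These brackets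
are the same in n_2 and n_2^3. -/
theorem not_isCrossLike_of_relations [CharZero K] {L : Type*} [LieRing L] [LieAlgebra K L]
    {v : ℕ → L}
    (h12 : ⁅v 1, v 2⁆ = v 3) (h14 : ⁅v 1, v 4⁆ = (-3 : K) • v 5) (h35 : ⁅v 3, v 5⁆ = -v 8)
    (h18 : ⁅v 1, v 8⁆ = -v 9) (h9 : v 9 ≠ 0) : ¬ IsCrossLike L := by
  intro h
  have := h (v 1) (v 2) (v 4)
  rw [h12, h14, lie_smul, h35, lie_smul, lie_neg, h18, neg_neg] at this
  exact smul_ne_zero (neg_ne_zero.2 three_ne_zero) h9 this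

theorem n2_c_three_five : (n2 K).c 3 5 = Finsupp.single 8 (-1) := by
  have : n2Table (res8 3) (res8 5) = -1 := by decide
  simp only [n2, widthOne, this]
  rw [Int.cast_neg, Int.cast_one]
  rfl

theorem not_isCrossLike_n2 [CharZero K] : ¬ IsCrossLike (n2 K).Algebra := by
  have h1 : n2Left K 1 = 1 := by simpa using n2Left_eq (K := K) 0 1
  have h3 : n2Left K 3 = -3 := by simpa using n2Left_eq (K := K) 0 3
  have h7 : n2Left K 7 = -1 := by simpa using n2Left_eq (K := K) 0 7
  -- The shift makes v k equal to e_k for k ≥ 1. The value at 0 plays no role.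
  refine not_isCrossLike_of_relations (K := K) (v := fun k => (n2 K).e (k - 1).succPNat) ?_ ?_ ?_ ?_
    ((n2 K).basis.ne_zero (Nat.succPNat 8))
  · exact ((n2 K).lie_e_eq_of _ _).trans (by
      rw [show (1 : ℕ) - 1 = 0 from rfl, ← one_eq_succPNat, n2_c_one, LieConstants.of_single, h1,
        one_smul])
  · exact ((n2 K).lie_e_eq_of _ _).trans (by
      rw [show (1 : ℕ) - 1 = 0 from rfl, ← one_eq_succPNat, n2_c_one, LieConstants.of_single, h3])
  · exact ((n2 K).lie_e_eq_of 3 5).trans (by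
      rw [n2_c_three_five, LieConstants.of_single, neg_smul, one_smul]; rfl)
  · exact ((n2 K).lie_e_eq_of _ _).trans (by
      rw [show (1 : ℕ) - 1 = 0 from rfl, ← one_eq_succPNat, n2_c_one, LieConstants.of_single, h7,
        neg_smul, one_smul])

theorem not_isCrossLike_n23 [CharZero K] : ¬ IsCrossLike (n23 K).Algebra := by
  have h1 : n2Left K 1 = 1 := by simpa using n2Left_eq (K := K) 0 1
  have h3 : n2Left K 3 = -3 := by simpa using n2Left_eq (K := K) 0 3
  have h7 : n2Left K 7 = -1 := by simpa using n2Left_eq (K := K) 0 7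
  refine not_isCrossLike_of_relations (K := K) (v := fun k => (n23 K).e (.inl (k - 1).succPNat))
    ?_ ?_ ?_ ?_ ((n23 K).basis.ne_zero (.inl (Nat.succPNat 8)))
  · exact ((n23 K).lie_e_eq_of _ _).trans (by
      rw [show (1 : ℕ) - 1 = 0 from rfl, ← one_eq_succPNat, n23_c_one, LieConstants.of_single, h1,
        one_smul])
  · exact ((n23 K).lie_e_eq_of _ _).trans (by
      rw [show (1 : ℕ) - 1 = 0 from rfl, ← one_eq_succPNat, n23_c_one, LieConstants.of_single, h3])
  · have h0 : n2Cocycle K 3 5 = 0 := by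
      rw [n2Cocycle, if_neg fun h => absurd h.1 (by decide), if_neg fun h => absurd h.2 (by decide)]
    exact ((n23 K).lie_e_eq_of (.inl 3) (.inl 5)).trans (by
      rw [n23_c_inl, n2_c_three_five, h0, Finsupp.mapDomain_single, Finsupp.mapDomain_zero,
        add_zero, LieConstants.of_single, neg_smul, one_smul]; rfl)
  · exact ((n23 K).lie_e_eq_of _ _).trans (by
      rw [show (1 : ℕ) - 1 = 0 from rfl, ← one_eq_succPNat, n23_c_one, LieConstants.of_single, h7,
        neg_smul, one_smul])

theorem n2Left_ne_zero_or [CharZero K] (k : ℕ) : n2Left K k ≠ 0 ∨ n2Right K k ≠ 0 := by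
  obtain ⟨m, r, rfl⟩ := exists_block k
  rw [n2Left_eq, n2Right_eq, Int.cast_ne_zero, Int.cast_ne_zero]
  revert r
  decide

/-- No basis vector commutes with both e_1 and e_2, and each of ad e_1, ad e_2 sends different basis
vectors to multiples of different basis vectors, so no cancellation is possible. -/
theorem isCenterless_n2 [CharZero K] : IsCenterless (n2 K).Algebra := by
  intro x hx
  refine (n2 K).basis.repr.injective (Finsupp.ext fun i => ?_)
  rw [map_zero, Finsupp.zero_apply]
  obtain ⟨k, rfl⟩ := exists_succPNat i
  rcases n2Left_ne_zero_or (K := K) k with h | h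
  · refine (n2 K).repr_eq_zero_of_central hx (l := 1) (j := (k + 1).succPNat) (fun n hn => ?_) ?_
    · obtain ⟨n, rfl⟩ := exists_succPNat n
      rw [n2_c_one]
      refine Finsupp.single_eq_of_ne fun h => hn ?_
      rw [Nat.succPNat_inj] at h ⊢
      omega
    · rwa [n2_c_one, Finsupp.single_eq_same]
  · refine (n2 K).repr_eq_zero_of_central hx (l := 2) (j := (k + 2).succPNat) (fun n hn => ?_) ?_
    · obtain ⟨n, rfl⟩ := exists_succPNat n
      rw [n2_c_two]
      refine Finsupp.single_eq_of_ne fun h => hn ?_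
      rw [Nat.succPNat_inj] at h ⊢
      omega
    · rwa [n2_c_two, Finsupp.single_eq_same]

theorem not_isCenterless_n23 : ¬ IsCenterless (n23 K).Algebra := fun h =>
  (n23 K).basis.ne_zero (.inr ())
    (h _ ((n23 K).lie_basis_eq_zero fun i => n23_c_inr i ()))

end Profiles

/-! ### Distinctness of the algebras on the list, and normalization of ε -/

section Uniqueness

variable {K : Type*} [Field K] {g : Type*} [LieRing g] [LieAlgebra K g]

theorem isMetaCentral_iff_of_equiv {L : Type*} [LieRing L] [LieAlgebra K L] (e : g ≃ₗ⁅K⁆ L) :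
    IsMetaCentral g ↔ IsMetaCentral L := ⟨fun h => h.congr e.symm, fun h => h.congr e⟩

theorem isCrossLike_iff_of_equiv {L : Type*} [LieRing L] [LieAlgebra K L] (e : g ≃ₗ⁅K⁆ L) :
    IsCrossLike g ↔ IsCrossLike L := ⟨fun h => h.congr e.symm, fun h => h.congr e⟩

theorem isCenterless_iff_of_equiv {L : Type*} [LieRing L] [LieAlgebra K L] (e : g ≃ₗ⁅K⁆ L) :
    IsCenterless g ↔ IsCenterless L := ⟨fun h => h.congr e.symm, fun h => h.congr e⟩

/-- The properties by which the algebras on the list are told apart, up to the sign in `n_1^±`. -/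
def Profile (K : Type*) [Field K] (g : Type*) [LieRing g] [LieAlgebra K g] : Name → Prop
  | .n1Plus => ¬ IsMetaCentral g ∧ IsCrossLike g
  | .n1Minus => ¬ IsMetaCentral g ∧ IsCrossLike g
  | .n2 => ¬ IsCrossLike g ∧ IsCenterless g
  | .n23 => ¬ IsCrossLike g ∧ ¬ IsCenterless g
  | .m0 => IsMetaCentral g ∧ IsCenterless g
  | .m0S S _ => IsMetaCentral g ∧ ¬ IsCenterless g ∧ ∀ r, r ∈ S.1 ↔ HasCentral g K r

theorem IsoTo.profile [CharZero K] {N : Name} (h : IsoTo K g N) : Profile K g N := by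
  rcases N with _ | _ | _ | _ | _ | ⟨S, hS⟩ <;> obtain ⟨e⟩ := h
  · exact ⟨by rw [isMetaCentral_iff_of_equiv e]; exact not_isMetaCentral_n1 one_ne_zero,
      (isCrossLike_n1 1).congr e⟩
  · exact ⟨by rw [isMetaCentral_iff_of_equiv e]
              exact not_isMetaCentral_n1 (neg_ne_zero.2 one_ne_zero), (isCrossLike_n1 (-1)).congr e⟩
  · exact ⟨by rw [isCrossLike_iff_of_equiv e]; exact not_isCrossLike_n2, isCenterless_n2.congr e⟩
  · exact ⟨by rw [isCrossLike_iff_of_equiv e]; exact not_isCrossLike_n23,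
      by rw [isCenterless_iff_of_equiv e]; exact not_isCenterless_n23⟩
  · exact ⟨isMetaCentral_m0.congr e, isCenterless_m0.congr e⟩
  · refine ⟨(isMetaCentral_m0S S).congr e,
      by rw [isCenterless_iff_of_equiv e]; exact not_isCenterless_m0S S hS, fun r => ?_⟩
    rw [← hasCentral_m0S_iff (K := K) S r]
    exact ⟨fun h => h.congr e.symm, fun h => h.congr e⟩

/-- A central second derived algebra implies the cross-product identity, so the profiles of
different kinds contradict each other. For m_0^S the profile determines S. Only the sign in n_1^± is
left undecided. -/
theorem Profile.eq {N N' : Name} (h : Profile K g N) (h' : Profile K g N') :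
    N = N' ∨ N = .n1Plus ∧ N' = .n1Minus ∨ N = .n1Minus ∧ N' = .n1Plus := by
  have mc : IsMetaCentral g → IsCrossLike g := IsMetaCentral.isCrossLike
  rcases N with _ | _ | _ | _ | _ | ⟨S, hS⟩ <;> rcases N' with _ | _ | _ | _ | _ | ⟨S', hS'⟩ <;>
    simp only [Profile] at h h' <;>
    first
    | (left; rfl)
    | (right; left; exact ⟨rfl, rfl⟩)
    | (right; right; exact ⟨rfl, rfl⟩)
    | (exfalso; tauto)
    | skip
  left
  have : S = S' := Subtype.ext (Set.ext fun r => (h.2.2 r).trans (h'.2.2 r).symm)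
  subst this
  rfl

theorem not_isoTo_n1Plus_and_n1Minus {g : Type*} [LieRing g] [LieAlgebra ℝ g]
    (h : IsoTo ℝ g .n1Plus) (h' : IsoTo ℝ g .n1Minus) : False := by
  obtain ⟨e⟩ := h
  obtain ⟨e'⟩ := h'
  exact not_isAnisotropic_n1 ((isAnisotropic_n1.congr e).congr e'.symm)

theorem IsoTo.eq_real {g : Type*} [LieRing g] [LieAlgebra ℝ g] {N N' : Name} (h : IsoTo ℝ g N)
    (h' : IsoTo ℝ g N') : N = N' := by
  rcases h.profile.eq h'.profile with h0 | ⟨rfl, rfl⟩ | ⟨rfl, rfl⟩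
  · exact h0
  · exact (not_isoTo_n1Plus_and_n1Minus h h').elim
  · exact (not_isoTo_n1Plus_and_n1Minus h' h).elim

/-- Every nonzero real number is plus or minus a square, and ε matters only up to nonzero squares.
-/
theorem exists_isoTo_real {ε : ℝ} (hε : ε ≠ 0) {g : Type*} [LieRing g] [LieAlgebra ℝ g]
    (e : g ≃ₗ⁅ℝ⁆ n1 ε) : IsoTo ℝ g .n1Plus ∨ IsoTo ℝ g .n1Minus := by
  rcases hε.lt_or_gt with h | h
  · obtain ⟨f⟩ := nonempty_n1_equiv (ε' := -1) (β := √(-ε)) hε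
      (by rw [Real.sq_sqrt (by linarith)]; ring)
    exact Or.inr ⟨e.trans f.symm⟩
  · obtain ⟨f⟩ := nonempty_n1_equiv (ε' := 1) (β := √ε) hε (by rw [Real.sq_sqrt h.le]; ring)
    exact Or.inl ⟨e.trans f.symm⟩

theorem isoTo_n1Plus_complex {ε : ℂ} (hε : ε ≠ 0) {g : Type*} [LieRing g] [LieAlgebra ℂ g]
    (e : g ≃ₗ⁅ℂ⁆ n1 ε) : IsoTo ℂ g .n1Plus := by
  obtain ⟨β, hβ⟩ := IsAlgClosed.exists_pow_nat_eq ε two_pos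
  obtain ⟨f⟩ := nonempty_n1_equiv (ε' := 1) (β := β) hε (by rw [hβ, mul_one])
  exact ⟨e.trans f.symm⟩

end Uniqueness

end NarrowLie

end

/-! ### The classification over ℝ and ℂ -/

theorem theorem1 :
    (∀ (g : Type*) [LieRing g] [LieAlgebra ℝ g] (𝒜 : ℕ → Submodule ℝ g) [GradedLieAlgebra 𝒜],
      ¬ FiniteDimensional ℝ g → NarrowLie.IsNarrow 𝒜 →
        ∃! N : NarrowLie.Name, NarrowLie.IsoTo ℝ g N) ∧
    (∀ (g : Type*) [LieRing g] [LieAlgebra ℂ g] (𝒜 : ℕ → Submodule ℂ g) [GradedLieAlgebra 𝒜],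
      ¬ FiniteDimensional ℂ g → NarrowLie.IsNarrow 𝒜 →
        ∃! N : NarrowLie.Name, N ≠ .n1Minus ∧ NarrowLie.IsoTo ℂ g N) ∧
    Nonempty (NarrowLie.n1 (1 : ℂ) ≃ₗ⁅ℂ⁆ NarrowLie.n1 (-1 : ℂ)) := by
  refine ⟨?_, ?_, NarrowLie.nonempty_n1_equiv (β := Complex.I) (neg_ne_zero.2 one_ne_zero)
    (by rw [Complex.I_sq, mul_one])⟩
  · intro g _ _ 𝒜 _ hinf h
    have ex : ∃ N : NarrowLie.Name, NarrowLie.IsoTo ℝ g N := by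
      rcases h.classification hinf with ⟨ε, hε, ⟨e⟩⟩ | e | e | e | ⟨S, hS, e⟩
      · rcases NarrowLie.exists_isoTo_real hε e with e | e
        · exact ⟨.n1Plus, e⟩
        · exact ⟨.n1Minus, e⟩
      · exact ⟨.n2, e⟩
      · exact ⟨.n23, e⟩
      · exact ⟨.m0, e⟩
      · exact ⟨.m0S S hS, e⟩
    obtain ⟨N, hN⟩ := ex
    exact ⟨N, hN, fun N' hN' => NarrowLie.IsoTo.eq_real hN' hN⟩
  · intro g _ _ 𝒜 _ hinf h
    have ex : ∃ N : NarrowLie.Name, N ≠ .n1Minus ∧ NarrowLie.IsoTo ℂ g N := by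
      rcases h.classification hinf with ⟨ε, hε, ⟨e⟩⟩ | e | e | e | ⟨S, hS, e⟩
      · exact ⟨.n1Plus, nofun, NarrowLie.isoTo_n1Plus_complex hε e⟩
      · exact ⟨.n2, nofun, e⟩
      · exact ⟨.n23, nofun, e⟩
      · exact ⟨.m0, nofun, e⟩
      · exact ⟨.m0S S hS, nofun, e⟩
    obtain ⟨N, hm, hN⟩ := ex
    refine ⟨N, ⟨hm, hN⟩, fun N' ⟨hm', hN'⟩ => ?_⟩
    -- Over ℂ the profile alone suffices, because the only ambiguous pair contains the excluded name
    -- n_1^-.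
    rcases hN'.profile.eq hN.profile with h0 | ⟨-, h0⟩ | ⟨h0, -⟩
    · exact h0
    · exact absurd h0 hm
    · exact absurd h0 hm'
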